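/- Let $R>0$ and let $\varphi\in C^\infty(\mathbb R)$ satisfy: $1\le\varphi\le 2+2R$; $\varphi_x=1$ for $|x|<R$; $\varphi_x=0$ for $|x|\ge R+1$; $0\le\varphi_x\le1$; and $\sqrt{\varphi_x}\in C_c^\infty(\mathbb R)$. Write $\langle f,g\rangle=\int_{\mathbb R}fg\,dx$, $\|u\|_{2,\varphi}=\langle u,\varphi u\rangle^{1/2}$, and let $\mathcal Hf(x)=\mathrm{p.v.}\,\frac1\pi\int_{\mathbb R}\frac{f(x-y)}{y}\,dy$ be the Hilbert transform. For an integer $r\ge2$ and $\Delta x>0$ let $S_{\Delta x}$ be the space of real-valued $v\in H^2(\mathbb R)$ that are polynomials of degree at most $r$ on each interval $[(j-1)\Delta x,j\Delta x]$, $j\in\mathbb Z$. (i) For every integer $r\ge 2$ there are constants $C_1,C_2>0$ such that, for all $\Delta x>0$ and all $z\in S_{\Delta x}$, $$\|z_x\|_{L^\infty(\mathbb R)}\le\frac{C_1^{1/2}}{\Delta x^{1/2}}\|z_x\|_{L^2(\mathbb R)}\le\frac{C_2^{1/2}}{\Delta x^{3/2}}\|z\|_{L^2(\mathbb R)}.\qquad(1)$$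 (ii) There is $\delta>0$, depending only on $\varphi$, such that the following holds. Let $r\ge2$ be an integer, let $C_1,C_2>0$ be constants for which (1) holds for all $\Delta x>0$ and all $z\in S_{\Delta x}$, let $0<L<1$ and $K=\frac{7-L}{1-L}$, let $\Delta x>0$ and $0<\Delta t\le\delta$, and let $u^n\in S_{\Delta x}$. Assume that $\lambda=\Delta t/\Delta x^{3/2}$ satisfies the CFL condition $$\lambda\le\frac{L}{2\sqrt2\,\sqrt{C_2}\,K\,\|u^n\|_{2,\varphi}}$$ (no condition if $u^n=0$). Then there is exactly one sequence $(w^\ell)_{\ell\ge0}$ in $S_{\Delta x}$ with $w^0=u^n$ and, for all $\ell\ge0$ and all $v\in S_{\Delta x}$, $$\langle w^{\ell+1},\varphi v\rangle-\frac{\Delta t}{2}\Big\langle\Big(\frac{w^\ell+u^n}{2}\Big)^2,(\varphi v)_x\Big\rangle+\Delta t\Big\langle\Big(\mathcal H\frac{w^{\ell+1}+u^n}{2}\Big)_x,(\varphi v)_x\Big\rangle=\langle u^n,\varphi v\rangle .$$ Moreover there is $u^{n+1}\in S_{\Delta x}$ with $\|w^\ell-u^{n+1}\|_{2,\varphi}\to0$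 as $\ell\to\infty$, which solves the implicit scheme: with $u^{n+1/2}=(u^{n+1}+u^n)/2$, $$\langle u^{n+1},\varphi v\rangle-\Delta t\Big\langle\frac{(u^{n+1/2})^2}{2},(\varphi v)_x\Big\rangle+\Delta t\big\langle\mathcal H(u^{n+1/2}_x),(\varphi v)_x\big\rangle=\langle u^n,\varphi v\rangle\quad\text{for all }v\in S_{\Delta x},$$ and $\|u^{n+1}\|_{2,\varphi}\le K\|u^n\|_{2,\varphi}$. -/

import Mathlib

open MeasureTheory Filter Topology
open scoped ENNReal ContDiff Polynomial SchwartzMap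

noncomputable section

namespace BOScheme

/-- The Hilbert transform, `(1/π)` times the Cauchy principal value of `∫ f (x - y) / y dy`. -/
def hilbert (f : ℝ → ℝ) (x : ℝ) : ℝ :=
  limUnder (𝓝[>] (0 : ℝ))
    (fun ε : ℝ => (1 / Real.pi) * ∫ y in {y : ℝ | ε < |y|}, f (x - y) / y)

/-- The `L²(ℝ)` inner product of real functions. -/
def pairing (f g : ℝ → ℝ) : ℝ := ∫ x, f x * g x

/-- The weighted norm `‖u‖_{2,φ} = ⟨u, φ u⟩^{1/2}`. -/
def weightedNorm (φ u : ℝ → ℝ) : ℝ := √(pairing u (φ * u))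

/-- The cut-off functions `φ` attached to a radius `R`. -/
structure IsCutoff (R : ℝ) (φ : ℝ → ℝ) : Prop where
  smooth : ContDiff ℝ ∞ φ
  one_le : ∀ x, 1 ≤ φ x
  le_bound : ∀ x, φ x ≤ 2 + 2 * R
  deriv_eq_one : ∀ x, |x| < R → deriv φ x = 1
  deriv_eq_zero : ∀ x, R + 1 ≤ |x| → deriv φ x = 0
  deriv_nonneg : ∀ x, 0 ≤ deriv φ x
  deriv_le_one : ∀ x, deriv φ x ≤ 1
  sqrt_smooth : ContDiff ℝ ∞ (fun x => √(deriv φ x))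
  sqrt_compact : HasCompactSupport (fun x => √(deriv φ x))

/-- A real function `u` belongs to the Sobolev space `H²(ℝ)`: it is in `L²(ℝ)`, and the tempered
distribution it defines is in the `L²`-based Sobolev space of order two. -/
def MemH2 (u : ℝ → ℝ) : Prop :=
  ∃ h : MemLp (fun x => (u x : ℂ)) 2 volume,
    TemperedDistribution.MemSobolev 2 2 (Lp.toTemperedDistribution (h.toLp _))

/-- The finite element space `S_{Δx}`: functions in `H²(ℝ)` which on every closed element
`[(j-1)Δx, jΔx]` are polynomials of degree at most `r`. Neighbouring elements share their end
point, so a member is the continuous representative of its class, and being in `H²(ℝ)` it is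
continuously differentiable. Hence its weak derivative is its pointwise derivative. -/
def femSpace (r : ℕ) (dx : ℝ) : Set (ℝ → ℝ) :=
  {v | MemH2 v ∧ ∀ j : ℤ, ∃ p : ℝ[X], p.natDegree ≤ r ∧
    ∀ x ∈ Set.Icc (((j : ℝ) - 1) * dx) ((j : ℝ) * dx), v x = p.eval x}

/-- `C₁, C₂` are constants in the inverse inequalities
`‖z_x‖_∞ ≤ C₁^{1/2} Δx^{-1/2} ‖z_x‖₂ ≤ C₂^{1/2} Δx^{-3/2} ‖z‖₂`,
valid for every `Δx > 0` and every `z ∈ S_{Δx}`. -/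
def InverseInequality (r : ℕ) (C₁ C₂ : ℝ) : Prop :=
  ∀ dx : ℝ, 0 < dx → ∀ z ∈ femSpace r dx,
    eLpNorm (deriv z) ∞ volume
        ≤ ENNReal.ofReal (√C₁ / dx ^ (1 / 2 : ℝ)) * eLpNorm (deriv z) 2 volume ∧
    ENNReal.ofReal (√C₁ / dx ^ (1 / 2 : ℝ)) * eLpNorm (deriv z) 2 volume
        ≤ ENNReal.ofReal (√C₂ / dx ^ (3 / 2 : ℝ)) * eLpNorm z 2 volume

/-- `u'` solves one step of the Crank--Nicolson Galerkin scheme from `u`: with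
`m = (u' + u)/2`, for all `v ∈ S_{Δx}`,
`⟨u', φv⟩ - Δt ⟨m²/2, (φv)_x⟩ + Δt ⟨H(m_x), (φv)_x⟩ = ⟨u, φv⟩`. -/
def SolvesStep (φ : ℝ → ℝ) (r : ℕ) (dx dt : ℝ) (u u' : ℝ → ℝ) : Prop :=
  u' ∈ femSpace r dx ∧ ∀ v ∈ femSpace r dx,
    pairing u' (φ * v)
      - dt * pairing (fun x => ((u' x + u x) / 2) ^ 2 / 2) (deriv (φ * v))
      + dt * pairing (hilbert (deriv (fun x => (u' x + u x) / 2))) (deriv (φ * v))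
    = pairing u (φ * v)

/-- `w 0, w 1, …` is a sequence of iterates of the linearised scheme started at `w 0 = u`:
for all `ℓ` and all `v ∈ S_{Δx}`,
`⟨w^{ℓ+1}, φv⟩ - (Δt/2) ⟨((w^ℓ + u)/2)², (φv)_x⟩ + Δt ⟨(H((w^{ℓ+1} + u)/2))_x, (φv)_x⟩ = ⟨u, φv⟩`.
-/
def IsIteration (φ : ℝ → ℝ) (r : ℕ) (dx dt : ℝ) (u : ℝ → ℝ) (w : ℕ → ℝ → ℝ) : Prop :=
  w 0 = u ∧ (∀ l, w l ∈ femSpace r dx) ∧ ∀ l, ∀ v ∈ femSpace r dx,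
    pairing (w (l + 1)) (φ * v)
      - dt / 2 * pairing (fun x => ((w l x + u x) / 2) ^ 2) (deriv (φ * v))
      + dt * pairing (deriv (hilbert (fun x => (w (l + 1) x + u x) / 2))) (deriv (φ * v))
    = pairing u (φ * v)

end BOScheme

end

noncomputable section

namespace BOScheme

/-! ### Sobolev regularity through weak second derivatives -/

/-! The scheme is read as a fixed point problem in the Hilbert space `WeightedSpline`, that is
`S_{Δx}` with inner product `⟨u, φ v⟩`. It has two ingredients: a bilinear form `dispForm` for the
dispersive term and a trilinear form `convForm` for the convective term.

Membership in `S_{Δx}` is first made concrete (`mem_femSpace_iff`). A jump of the derivative at a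
node would put a Dirac mass into the second derivative, so `H²` piecewise polynomials are
differentiable. Conversely, inverse estimates put all piecewise derivatives into `L²`. These
estimates come from compactness on the unit interval and scaling, and they also give (1).

For such functions both `H(w_x)` and `(H w)_x` equal `|D| w`, written as the absolutely convergent
integral `fracLap` of second differences. Hence the iteration and the implicit scheme share one
dispersive form. Its essential property is the Gårding inequality
`IsCutoff.exists_integral_fracLap_ge`: `⟨|D| w, (φ w)_x⟩ ≥ -C ‖w‖²` with `C` depending on `φ` alone.
The part with `φ_x w` is a square up to a commutator with `√φ_x`. In the part with `φ w_x`, the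
singular contribution is an exact derivative in the shift `y`, and the rest is a trapezoidal rule
error for `φ`. Since `C` does not see `r` or `Δx`, neither does `δ`.

Integration by parts and (1) bound the convective form by `2κ ‖a‖ ‖b‖ ‖v‖` with `κ = √C₂ /
Δx^{3/2}`. For small `Δt` every linear step is solvable by Lax–Milgram. Testing with the midpoint
gives `‖w¹‖ ≤ 5‖u‖`, so the first increment is at most `6‖u‖`. Under the CFL condition increments
contract by the factor `L` inside the ball of radius `K‖u‖`, and `K = 1 + 6/(1 - L)` is what the
geometric series needs to stay in that ball. Completeness gives the limit, and continuity of the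
forms shows that it solves the implicit scheme. -/

open scoped Laplacian in
-- The symbol of order two is `1 + |ξ|²`, while in this Fourier normalisation the Laplacian has
-- symbol `-(2π)² |ξ|²`; hence the factor `(2π)⁻²`.
theorem besselPotential_two_eq (f : 𝓢'(ℝ, ℂ)) :
    TemperedDistribution.besselPotential ℝ ℂ 2 f =
      f - ((2 * Real.pi) ^ 2 : ℝ)⁻¹ • (Δ f) := by
  rw [TemperedDistribution.laplacian_eq_fourierMultiplierCLM]
  have h1 : (fun x : ℝ => (((1 + ‖x‖ ^ 2) ^ ((2 : ℝ) / 2) : ℝ) : ℂ)) =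
      (fun _ => (1 : ℂ)) + (fun x => Complex.ofReal (‖x‖ ^ 2)) := by
    ext x
    simp
  have h2 : (fun x : ℝ => Complex.ofReal (‖x‖ ^ 2)).HasTemperateGrowth := by fun_prop
  have h3 : (fun _ : ℝ => (1 : ℂ)).HasTemperateGrowth := by fun_prop
  have h4 : TemperedDistribution.besselPotential ℝ ℂ 2 f =
      f + TemperedDistribution.fourierMultiplierCLM ℂ (fun x : ℝ => Complex.ofReal (‖x‖ ^ 2)) f := by
    rw [TemperedDistribution.besselPotential, h1, TemperedDistribution.fourierMultiplierCLM_apply,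
      TemperedDistribution.smulLeftCLM_add h3 h2]
    ext ψ
    simp [TemperedDistribution.fourierMultiplierCLM_apply]
  rw [h4, neg_smul, smul_neg, sub_neg_eq_add, smul_smul, inv_mul_cancel₀ (by positivity), one_smul]

/-- The exceptional set is there for the nodes, where the second derivative of a spline need not
exist. -/
theorem integral_eq_zero_of_hasDerivAt_off_countable {E : Type*} [NormedAddCommGroup E]
    [NormedSpace ℝ E] [CompleteSpace E] {F F' : ℝ → E} {s : Set ℝ} (hs : s.Countable)
    (hF : Continuous F) (hF' : ∀ x, x ∉ s → HasDerivAt F (F' x) x) (hint : Integrable F')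
    (htop : Tendsto F atTop (𝓝 0)) (hbot : Tendsto F atBot (𝓝 0)) : ∫ x, F' x = 0 := by
  have h1 : Tendsto (fun n : ℝ => ∫ x in (-n)..n, F' x) atTop (𝓝 (∫ x, F' x)) :=
    intervalIntegral_tendsto_integral hint tendsto_neg_atTop_atBot tendsto_id
  have h2 : ∀ n : ℝ, ∫ x in (-n)..n, F' x = F n - F (-n) := fun n =>
    integral_eq_of_hasDerivAt_off_countable F F' hs hF.continuousOn
      (fun x hx => hF' x hx.2) hint.intervalIntegrable
  simp_rw [h2] at h1
  have h3 : Tendsto (fun n : ℝ => F n - F (-n)) atTop (𝓝 (0 - 0)) :=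
    htop.sub (hbot.comp tendsto_neg_atTop_atBot)
  rw [sub_zero] at h3
  exact tendsto_nhds_unique h1 h3

theorem SchwartzMap_laplacian_apply (ψ : 𝓢(ℝ, ℂ)) (x : ℝ) :
    (Laplacian.laplacian ψ : 𝓢(ℝ, ℂ)) x = deriv (deriv ψ) x := by
  rw [SchwartzMap.laplacian_apply, InnerProductSpace.laplacian_eq_iteratedDeriv_real]
  rw [iteratedDeriv_succ, iteratedDeriv_one]


/-- `w` is continuously differentiable with derivative `dw`, which is differentiable with derivative
`ddw` off a countable set; the three functions are bounded and square integrable. -/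
structure IsH2Jet (w dw ddw : ℝ → ℝ) : Prop where
  hasDerivAt : ∀ x, HasDerivAt w (dw x) x
  continuous_deriv : Continuous dw
  hasDerivAt_deriv : ∃ s : Set ℝ, s.Countable ∧ ∀ x, x ∉ s → HasDerivAt dw (ddw x) x
  memLp : MemLp w 2
  memLp_deriv : MemLp dw 2
  memLp_deriv2 : MemLp ddw 2
  bounded : ∃ M, 0 ≤ M ∧ ∀ x, |w x| ≤ M ∧ |dw x| ≤ M ∧ |ddw x| ≤ M

theorem IsH2Jet.continuous {w dw ddw : ℝ → ℝ} (h : IsH2Jet w dw ddw) : Continuous w :=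
  continuous_iff_continuousAt.2 fun x => (h.hasDerivAt x).continuousAt

theorem IsH2Jet.integral_laplacian_mul {w dw ddw : ℝ → ℝ} (h : IsH2Jet w dw ddw) (ψ : 𝓢(ℝ, ℂ)) :
    ∫ x, deriv (deriv ψ) x * (w x : ℂ) = ∫ x, ψ x * (ddw x : ℂ) := by
  set ψ₁ : 𝓢(ℝ, ℂ) := SchwartzMap.derivCLM ℂ ℂ ψ with hψ₁
  have e1 : ∀ x, ψ₁ x = deriv ψ x := fun x => SchwartzMap.derivCLM_apply ℂ ψ x
  set ψ₂ : 𝓢(ℝ, ℂ) := SchwartzMap.derivCLM ℂ ℂ ψ₁ with hψ₂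
  have e1' : deriv ψ = ψ₁ := by ext x; exact (e1 x).symm
  have e2 : ∀ x, ψ₂ x = deriv (deriv ψ) x := fun x => by
    rw [hψ₂, SchwartzMap.derivCLM_apply, e1']
  have d0 : ∀ x, HasDerivAt ψ (ψ₁ x) x := fun x => by
    rw [e1]; exact ψ.differentiable.differentiableAt.hasDerivAt
  have d1 : ∀ x, HasDerivAt ψ₁ (ψ₂ x) x := fun x => by
    rw [e2, e1']; exact ψ₁.differentiable.differentiableAt.hasDerivAt
  have dw0 : ∀ x, HasDerivAt (fun x => (w x : ℂ)) (dw x : ℂ) x := fun x =>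
    (h.hasDerivAt x).ofReal_comp
  have i20 : Integrable (fun x => ψ₂ x * (w x : ℂ)) := (ψ₂.memLp 2).integrable_mul h.memLp.ofReal
  have i11 : Integrable (fun x => ψ₁ x * (dw x : ℂ)) :=
    (ψ₁.memLp 2).integrable_mul h.memLp_deriv.ofReal
  have i10 : Integrable (fun x => ψ₁ x * (w x : ℂ)) := (ψ₁.memLp 2).integrable_mul h.memLp.ofReal
  have i02 : Integrable (fun x => ψ x * (ddw x : ℂ)) :=
    (ψ.memLp 2).integrable_mul h.memLp_deriv2.ofReal
  obtain ⟨M, hM0, hM⟩ := h.bounded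
  have s1 : ∫ x, (ψ₂ x * (w x : ℂ) + ψ₁ x * (dw x : ℂ)) = 0 :=
    integral_eq_zero_of_hasDerivAt_of_integrable (fun x => (d1 x).mul (dw0 x)) (i20.add i11) i10
  have hz : Tendsto (fun x => ψ x * (dw x : ℂ)) (cocompact ℝ) (𝓝 0) := by
    refine squeeze_zero_norm (a := fun x => ‖ψ x‖ * M) (fun x => ?_) ?_
    · rw [norm_mul, Complex.norm_real]
      exact mul_le_mul_of_nonneg_left (hM x).2.1 (norm_nonneg _)
    · simpa using (ψ.tendsto_cocompact.norm).mul_const M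
  obtain ⟨s, hs, hds⟩ := h.hasDerivAt_deriv
  have s2 : ∫ x, (ψ₁ x * (dw x : ℂ) + ψ x * (ddw x : ℂ)) = 0 := by
    refine integral_eq_zero_of_hasDerivAt_off_countable hs
      (F := fun x => ψ x * (dw x : ℂ)) ?_ (fun x hx => (d0 x).mul (hds x hx).ofReal_comp)
      (i11.add i02) (hz.mono_left atTop_le_cocompact) (hz.mono_left atBot_le_cocompact)
    exact ψ.continuous.mul (Complex.continuous_ofReal.comp h.continuous_deriv)
  rw [integral_add i20 i11] at s1
  rw [integral_add i11 i02] at s2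
  simp_rw [← e2]
  linear_combination s1 - s2

/-- Two integrations by parts identify the distributional Laplacian with `ddw`, so the Bessel
potential is the `L²` function `w - (2π)⁻² ddw`. -/
theorem IsH2Jet.memH2 {w dw ddw : ℝ → ℝ} (h : IsH2Jet w dw ddw) : MemH2 w := by
  have h0 : MemLp (fun x => (w x : ℂ)) 2 volume := h.memLp.ofReal
  have h2 : MemLp (fun x => (ddw x : ℂ)) 2 volume := h.memLp_deriv2.ofReal
  refine ⟨h0, h0.toLp _ - ((2 * Real.pi) ^ 2 : ℝ)⁻¹ • h2.toLp _, ?_⟩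
  have key : Laplacian.laplacian (Lp.toTemperedDistribution (h0.toLp _)) =
      Lp.toTemperedDistribution (h2.toLp _) := by
    ext ψ
    rw [TemperedDistribution.laplacian_apply_apply, Lp.toTemperedDistribution_apply,
      Lp.toTemperedDistribution_apply]
    have a1 : ∫ x, (Laplacian.laplacian ψ : 𝓢(ℝ, ℂ)) x • h0.toLp _ x =
        ∫ x, deriv (deriv ψ) x * (w x : ℂ) := by
      refine integral_congr_ae ?_
      filter_upwards [h0.coeFn_toLp] with x hx
      rw [hx, SchwartzMap_laplacian_apply, smul_eq_mul]
    have a2 : ∫ x, ψ x • h2.toLp _ x = ∫ x, ψ x * (ddw x : ℂ) := by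
      refine integral_congr_ae ?_
      filter_upwards [h2.coeFn_toLp] with x hx
      rw [hx, smul_eq_mul]
    rw [a1, a2, h.integral_laplacian_mul]
  rw [besselPotential_two_eq, key]
  simp only [← Lp.toTemperedDistributionCLM_apply]
  rw [map_sub, ContinuousLinearMap.map_smul_of_tower]

theorem MemH2.exists_weak_deriv2 {v : ℝ → ℝ} (hv : MemH2 v) :
    ∃ h : ℝ → ℝ, MemLp h 2 ∧ ∀ b : ℝ → ℝ, ContDiff ℝ ∞ b → HasCompactSupport b →
      ∫ x, deriv (deriv b) x * v x = ∫ x, b x * h x := by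
  obtain ⟨h0, hs⟩ := hv
  have hl := hs.laplacian
  -- The Laplacian costs two orders of regularity, and order zero is `L²` itself.
  rw [sub_self, TemperedDistribution.memSobolev_zero_iff] at hl
  obtain ⟨g, hg⟩ := hl
  refine ⟨fun x => (g x).re, (Lp.memLp g).re, fun b hb hbc => ?_⟩
  have hB : HasCompactSupport (fun x => (b x : ℂ)) := hbc.comp_left Complex.ofReal_zero
  have hB' : ContDiff ℝ ∞ (fun x => (b x : ℂ)) := Complex.ofRealCLM.contDiff.comp hb
  set ψ : 𝓢(ℝ, ℂ) := hB.toSchwartzMap hB' with hψ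
  have eψ : ∀ x, ψ x = (b x : ℂ) := fun x => rfl
  have eψ' : (ψ : ℝ → ℂ) = fun x => (b x : ℂ) := rfl
  have hd : Differentiable ℝ b := hb.differentiable (by simp)
  have hd' : Differentiable ℝ (deriv b) :=
    (hb.iterate_deriv 1).differentiable (by simp)
  have e1 : deriv ψ = fun x => ((deriv b x : ℝ) : ℂ) := by
    ext x
    rw [eψ']
    exact (hd x).hasDerivAt.ofReal_comp.deriv
  have e2 : ∀ x, deriv (deriv ψ) x = ((deriv (deriv b) x : ℝ) : ℂ) := fun x => by
    rw [e1]
    exact (hd' x).hasDerivAt.ofReal_comp.deriv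
  have main := congrArg (fun T => T ψ) hg
  rw [TemperedDistribution.laplacian_apply_apply, Lp.toTemperedDistribution_apply,
      Lp.toTemperedDistribution_apply] at main
  have a1 : ∫ x, (Laplacian.laplacian ψ : 𝓢(ℝ, ℂ)) x • h0.toLp _ x =
      ((∫ x, deriv (deriv b) x * v x : ℝ) : ℂ) := by
    rw [← integral_complex_ofReal]
    refine integral_congr_ae ?_
    filter_upwards [h0.coeFn_toLp] with x hx
    rw [hx, SchwartzMap_laplacian_apply, smul_eq_mul, e2]
    push_cast
    rfl
  rw [a1] at main
  have hi : Integrable (fun x => ψ x • g x) := (ψ.memLp 2).integrable_mul (Lp.memLp g)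
  have := congrArg Complex.re main
  rw [Complex.ofReal_re] at this
  rw [this]
  have h3 := (integral_re hi)
  simp only [RCLike.re_to_complex] at h3
  rw [← h3]
  refine integral_congr_ae (Eventually.of_forall fun x => ?_)
  simp [eψ]

theorem integral_deriv2_mul_polynomial (b : ℝ → ℝ) (hb : ContDiff ℝ ∞ b) (p : ℝ[X]) (a c : ℝ) :
    ∫ x in a..c, deriv (deriv b) x * p.eval x =
      (deriv b c * p.eval c - b c * p.derivative.eval c)
        - (deriv b a * p.eval a - b a * p.derivative.eval a)
        + ∫ x in a..c, b x * p.derivative.derivative.eval x := by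
  have hd : Differentiable ℝ b := hb.differentiable (by simp)
  have hd' : Differentiable ℝ (deriv b) :=
    (hb.iterate_deriv 1).differentiable (by simp)
  have hc2 : Continuous (deriv (deriv b)) := (hb.iterate_deriv 2).continuous
  have i1 : IntervalIntegrable (fun x => deriv (deriv b) x * p.eval x) volume a c :=
    (hc2.mul p.continuous).intervalIntegrable _ _
  have i2 : IntervalIntegrable (fun x => b x * p.derivative.derivative.eval x) volume a c :=
    (hb.continuous.mul (Polynomial.continuous _)).intervalIntegrable _ _
  have := intervalIntegral.integral_eq_sub_of_hasDerivAt (a := a) (b := c)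
    (f := fun x => deriv b x * p.eval x - b x * p.derivative.eval x)
    (f' := fun x => deriv (deriv b) x * p.eval x - b x * p.derivative.derivative.eval x)
    (fun x _ => by
      have h1 := ((hd' x).hasDerivAt.mul (p.hasDerivAt x)).sub
        ((hd x).hasDerivAt.mul (p.derivative.hasDerivAt x))
      refine h1.congr_deriv ?_
      ring) (i1.sub i2)
  rw [intervalIntegral.integral_sub i1 i2] at this
  linarith

/-- Unequal one-sided derivatives would give the second derivative a Dirac mass at `x₀`, which no
`L²` function has. Tested against bumps shrinking to `x₀` with value 1 there, the jump equals an
integral that tends to 0. -/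
theorem MemH2.derivative_eval_eq {v : ℝ → ℝ} (hv : MemH2 v) {x₀ : ℝ} {p q : ℝ[X]}
    (hp : ∀ᶠ y in 𝓝[≤] x₀, v y = p.eval y) (hq : ∀ᶠ y in 𝓝[≥] x₀, v y = q.eval y) :
    p.derivative.eval x₀ = q.derivative.eval x₀ := by
  obtain ⟨h, hh, hweak⟩ := hv.exists_weak_deriv2
  obtain ⟨ε, hε, hpq⟩ : ∃ ε > 0, ∀ y, |y - x₀| ≤ ε →
      (y ≤ x₀ → v y = p.eval y) ∧ (x₀ ≤ y → v y = q.eval y) := by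
    rw [eventually_nhdsWithin_iff, Metric.eventually_nhds_iff] at hp hq
    obtain ⟨e1, he1, h1⟩ := hp
    obtain ⟨e2, he2, h2⟩ := hq
    refine ⟨min e1 e2 / 2, by positivity, fun y hy => ⟨fun hyx => h1 ?_ hyx, fun hyx => h2 ?_ hyx⟩⟩
    · rw [Real.dist_eq]; have := min_le_left e1 e2; linarith
    · rw [Real.dist_eq]; have := min_le_right e1 e2; linarith
  have hx₀ : p.eval x₀ = q.eval x₀ := by
    have := hpq x₀ (by simp [hε.le])
    rw [← this.1 le_rfl, ← this.2 le_rfl]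
  set S : Set ℝ := Set.Ioc (x₀ - ε) (x₀ + ε) with hS
  set G : ℝ → ℝ := fun x =>
    if x ≤ x₀ then p.derivative.derivative.eval x else q.derivative.derivative.eval x with hG
  have iP : ∀ (P : ℝ[X]) a c, IntervalIntegrable (fun x => P.eval x) volume a c :=
    fun P a c => P.continuous.intervalIntegrable _ _
  have hGl : ∀ x ∈ Set.Ioc (x₀ - ε) x₀, G x = p.derivative.derivative.eval x := fun x hx => by
    simp [hG, hx.2]
  have hGr : ∀ x ∈ Set.Ioc x₀ (x₀ + ε), G x = q.derivative.derivative.eval x := fun x hx => by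
    simp [hG, hx.1]
  have iG : IntegrableOn G S := by
    rw [hS, ← Set.Ioc_union_Ioc_eq_Ioc (show x₀ - ε ≤ x₀ by linarith) (show x₀ ≤ x₀ + ε by linarith)]
    refine IntegrableOn.union ?_ ?_
    · exact IntegrableOn.congr_fun ((iP p.derivative.derivative (x₀ - ε) x₀).1)
        (fun x hx => (hGl x hx).symm) measurableSet_Ioc
    · exact IntegrableOn.congr_fun ((iP q.derivative.derivative x₀ (x₀ + ε)).1)
        (fun x hx => (hGr x hx).symm) measurableSet_Ioc
  have ih : IntegrableOn h S := by
    have := (hh.restrict S).integrable (by norm_num : (1 : ℝ≥0∞) ≤ 2)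
    exact this
  -- Integrating by parts twice on each side of `x₀` leaves only the boundary terms at `x₀`. Those
  -- with `b'(x₀)` cancel by continuity of `v`, and those with `b(x₀) = 1` give the jump of the
  -- derivative.
  have jump : ∀ b : ℝ → ℝ, ContDiff ℝ ∞ b → HasCompactSupport b → b x₀ = 1 →
      tsupport b ⊆ Set.Ioo (x₀ - ε) (x₀ + ε) →
      q.derivative.eval x₀ - p.derivative.eval x₀ = ∫ x in S, b x * (h x - G x) := by
    intro b hb hbc hb1 hbs
    have z0 : ∀ x, x ∉ Set.Ioo (x₀ - ε) (x₀ + ε) → b x = 0 := fun x hx =>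
      image_eq_zero_of_notMem_tsupport fun hx' => hx (hbs hx')
    have z1 : ∀ x, x ∉ Set.Ioo (x₀ - ε) (x₀ + ε) → deriv b x = 0 := fun x hx =>
      image_eq_zero_of_notMem_tsupport fun hx' => hx (hbs (tsupport_deriv_subset hx'))
    have z2 : ∀ x, x ∉ Set.Ioo (x₀ - ε) (x₀ + ε) → deriv (deriv b) x = 0 := fun x hx =>
      image_eq_zero_of_notMem_tsupport fun hx' =>
        hx (hbs (tsupport_deriv_subset (tsupport_deriv_subset hx')))
    have hsub : Set.Ioo (x₀ - ε) (x₀ + ε) ⊆ S := Set.Ioo_subset_Ioc_self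
    have e1 : ∫ x, deriv (deriv b) x * v x = ∫ x in S, deriv (deriv b) x * v x :=
      (setIntegral_eq_integral_of_forall_compl_eq_zero fun x hx => by
        rw [z2 x fun hx' => hx (hsub hx'), zero_mul]).symm
    have e2 : ∫ x, b x * h x = ∫ x in S, b x * h x :=
      (setIntegral_eq_integral_of_forall_compl_eq_zero fun x hx => by
        rw [z0 x fun hx' => hx (hsub hx'), zero_mul]).symm
    obtain ⟨Cb, hCb⟩ := hb.continuous.bounded_above_of_compact_support hbc
    have ibd : ∀ g : ℝ → ℝ, IntegrableOn g S → IntegrableOn (fun x => b x * g x) S := fun g hg =>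
      hg.bdd_mul hb.continuous.aestronglyMeasurable (Eventually.of_forall hCb)
    have split : ∀ f : ℝ → ℝ, IntegrableOn f (Set.Ioc (x₀ - ε) x₀) →
        IntegrableOn f (Set.Ioc x₀ (x₀ + ε)) →
        ∫ x in S, f x = (∫ x in (x₀ - ε)..x₀, f x) + ∫ x in x₀..(x₀ + ε), f x := by
      intro f hf1 hf2
      rw [hS, ← intervalIntegral.integral_of_le (by linarith),
        intervalIntegral.integral_add_adjacent_intervals]
      · exact (intervalIntegrable_iff_integrableOn_Ioc_of_le (by linarith)).2 hf1
      · exact (intervalIntegrable_iff_integrableOn_Ioc_of_le (by linarith)).2 hf2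
    have hc2 : Continuous (deriv (deriv b)) := (hb.iterate_deriv 2).continuous
    have vL : ∀ x ∈ Set.Ioc (x₀ - ε) x₀, deriv (deriv b) x * p.eval x = deriv (deriv b) x * v x :=
      fun x hx => by
        rw [(hpq x (by rw [abs_le]; constructor <;> linarith [hx.1, hx.2])).1 hx.2]
    have vR : ∀ x ∈ Set.Ioc x₀ (x₀ + ε), deriv (deriv b) x * q.eval x = deriv (deriv b) x * v x :=
      fun x hx => by
        rw [(hpq x (by rw [abs_le]; constructor <;> linarith [hx.1, hx.2])).2 hx.1.le]
    have e3 : ∫ x in S, deriv (deriv b) x * v x =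
        (∫ x in (x₀ - ε)..x₀, deriv (deriv b) x * p.eval x) +
          ∫ x in x₀..(x₀ + ε), deriv (deriv b) x * q.eval x := by
      rw [split]
      · congr 1
        · rw [intervalIntegral.integral_of_le (by linarith),
            intervalIntegral.integral_of_le (by linarith)]
          exact setIntegral_congr_fun measurableSet_Ioc fun x hx => (vL x hx).symm
        · rw [intervalIntegral.integral_of_le (by linarith),
            intervalIntegral.integral_of_le (by linarith)]
          exact setIntegral_congr_fun measurableSet_Ioc fun x hx => (vR x hx).symm
      · exact IntegrableOn.congr_fun
          (((hc2.mul p.continuous).intervalIntegrable (x₀ - ε) x₀).1) vL measurableSet_Ioc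
      · exact IntegrableOn.congr_fun
          (((hc2.mul q.continuous).intervalIntegrable x₀ (x₀ + ε)).1) vR measurableSet_Ioc
    have e4 : ∫ x in S, b x * G x =
        (∫ x in (x₀ - ε)..x₀, b x * p.derivative.derivative.eval x) +
          ∫ x in x₀..(x₀ + ε), b x * q.derivative.derivative.eval x := by
      rw [split]
      · congr 1
        · rw [intervalIntegral.integral_of_le (by linarith),
            intervalIntegral.integral_of_le (by linarith)]
          exact setIntegral_congr_fun measurableSet_Ioc fun x hx => by simp only [hGl x hx]
        · rw [intervalIntegral.integral_of_le (by linarith),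
            intervalIntegral.integral_of_le (by linarith)]
          exact setIntegral_congr_fun measurableSet_Ioc fun x hx => by simp only [hGr x hx]
      · exact (ibd G iG).mono_set (Set.Ioc_subset_Ioc_right (by linarith))
      · exact (ibd G iG).mono_set (Set.Ioc_subset_Ioc_left (by linarith))
    have e5 : ∫ x in S, b x * (h x - G x) = (∫ x in S, b x * h x) - ∫ x in S, b x * G x := by
      rw [← integral_sub (ibd h ih) (ibd G iG)]
      simp_rw [mul_sub]
    have w := hweak b hb hbc
    rw [e1, e2, e3, integral_deriv2_mul_polynomial b hb, integral_deriv2_mul_polynomial b hb,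
      z0 (x₀ - ε) (by simp), z0 (x₀ + ε) (by simp), z1 (x₀ - ε) (by simp), z1 (x₀ + ε) (by simp),
      hb1, hx₀] at w
    rw [e5, e4]
    linarith
  have ihG : IntegrableOn (fun x => h x - G x) S := ih.sub iG
  -- The denominator `n + 2` keeps the outer radius strictly below `ε` even for `n = 0`.
  let B : ℕ → ContDiffBump x₀ := fun n =>
    ⟨ε / (2 * (n + 2)), ε / (n + 2), by positivity, by
      apply div_lt_div_of_pos_left hε (by positivity)
      have : (0 : ℝ) < n + 2 := by positivity
      linarith⟩
  have hrOut : ∀ n, (B n).rOut = ε / (n + 2) := fun n => rfl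
  have lim : Tendsto (fun n => ∫ x in S, B n x * (h x - G x)) atTop (𝓝 (∫ x in S, (0 : ℝ))) := by
    refine tendsto_integral_of_dominated_convergence (fun x => |h x - G x|) ?_ ihG.abs ?_ ?_
    · intro n
      exact ((B n).continuous.aestronglyMeasurable).mul ihG.aestronglyMeasurable
    · intro n
      refine Eventually.of_forall fun x => ?_
      rw [norm_mul, Real.norm_eq_abs, Real.norm_eq_abs, abs_of_nonneg (B n).nonneg]
      exact mul_le_of_le_one_left (abs_nonneg _) (B n).le_one
    · have : ∀ᵐ x ∂(volume.restrict S), x ≠ x₀ :=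
        ae_restrict_of_ae (by simp [ae_iff])
      filter_upwards [this] with x hx
      refine tendsto_const_nhds.congr' ?_
      have h0 : Tendsto (fun n : ℕ => ε / ((n : ℝ) + 2)) atTop (𝓝 0) :=
        tendsto_const_nhds.div_atTop
          (tendsto_atTop_add_const_right _ _ tendsto_natCast_atTop_atTop)
      filter_upwards [h0.eventually_lt_const (show 0 < dist x x₀ from dist_pos.2 hx)] with n hn
      rw [(B n).zero_of_le_dist (by rw [hrOut]; exact hn.le), zero_mul]
  have const : ∀ n, ∫ x in S, B n x * (h x - G x) =
      q.derivative.eval x₀ - p.derivative.eval x₀ := fun n => by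
    refine (jump (B n) (B n).contDiff (B n).hasCompactSupport 
      ((B n).one_of_mem_closedBall (Metric.mem_closedBall_self (B n).rIn_pos.le)) ?_).symm
    · rw [(B n).tsupport_eq, hrOut, Real.closedBall_eq_Icc]
      have : ε / ((n : ℝ) + 2) < ε := div_lt_self hε (by
        have : (0 : ℝ) ≤ n := Nat.cast_nonneg n
        linarith)
      exact Set.Icc_subset_Ioo (by linarith) (by linarith)
  simp_rw [const] at lim
  have := tendsto_nhds_unique lim tendsto_const_nhds
  simp at this
  linarith

/-! ### Inverse estimates for polynomials on an interval -/

/-- The integral is continuous in the coefficients and positive on the unit sphere, because a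
nonzero polynomial has finitely many roots. Its minimum over the compact sphere is `m`, and
homogeneity of degree two does the rest. -/
theorem exists_coeff_sq_le_integral (r : ℕ) : ∃ m : ℝ, 0 < m ∧ ∀ c : Fin (r + 1) → ℝ,
    m * ‖c‖ ^ 2 ≤ ∫ x in (0 : ℝ)..1, (∑ i, c i * x ^ (i : ℕ)) ^ 2 := by
  set F : (Fin (r + 1) → ℝ) → ℝ := fun c => ∫ x in (0 : ℝ)..1, (∑ i, c i * x ^ (i : ℕ)) ^ 2 with hF
  have hcont : Continuous F := by
    apply intervalIntegral.continuous_parametric_intervalIntegral_of_continuous'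
    fun_prop
  have hne : (Metric.sphere (0 : Fin (r + 1) → ℝ) 1).Nonempty :=
    (NormedSpace.sphere_nonempty).2 zero_le_one
  obtain ⟨c₀, hc₀, hmin⟩ := (isCompact_sphere (0 : Fin (r + 1) → ℝ) 1).exists_isMinOn hne
    hcont.continuousOn
  have hc₀n : ‖c₀‖ = 1 := by simpa using hc₀
  have hpos : 0 < F c₀ := by
    have hc₀0 : c₀ ≠ 0 := by
      rintro rfl
      simp at hc₀n
    obtain ⟨i₀, hi₀⟩ := Function.ne_iff.1 hc₀0
    set P : ℝ[X] := ∑ i : Fin (r + 1), Polynomial.monomial (i : ℕ) (c₀ i) with hP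
    have hPe : ∀ x, P.eval x = ∑ i, c₀ i * x ^ (i : ℕ) := fun x => by
      simp [hP, Polynomial.eval_finsetSum]
    have hP0 : P ≠ 0 := by
      intro h
      apply hi₀
      have := congrArg (fun q => Polynomial.coeff q (i₀ : ℕ)) h
      simpa [hP, Polynomial.finsetSum_coeff, Polynomial.coeff_monomial, Fin.val_inj] using this
    obtain ⟨x, hx, hx0⟩ : ∃ x ∈ Set.Icc (0 : ℝ) 1, P.eval x ≠ 0 := by
      by_contra! hcon
      exact hP0 (Polynomial.eq_zero_of_infinite_isRoot P
        ((Set.Icc_infinite (zero_lt_one (α := ℝ))).mono fun x hx => hcon x hx))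
    refine intervalIntegral.integral_pos zero_lt_one (by fun_prop) (fun x _ => sq_nonneg _)
      ⟨x, hx, ?_⟩
    rw [← hPe]
    positivity
  refine ⟨F c₀, hpos, fun c => ?_⟩
  rcases eq_or_ne c 0 with rfl | hc
  · simp
  have hcn : 0 < ‖c‖ := norm_pos_iff.2 hc
  have h1 : F c₀ ≤ F (‖c‖⁻¹ • c) := hmin (by simp [norm_smul, hcn.ne'])
  have h2 : F (‖c‖⁻¹ • c) = (‖c‖ ^ 2)⁻¹ * F c := by
    simp only [hF]
    rw [← intervalIntegral.integral_const_mul]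
    congr 1
    ext x
    rw [← inv_pow, ← mul_pow, Finset.mul_sum]
    simp [mul_assoc]
  rw [h2] at h1
  calc F c₀ * ‖c‖ ^ 2 ≤ ((‖c‖ ^ 2)⁻¹ * F c) * ‖c‖ ^ 2 := by gcongr
    _ = F c := by field_simp

theorem exists_unit_inverse_estimate (r : ℕ) : ∃ C : ℝ, 0 < C ∧ ∀ p : ℝ[X], p.natDegree ≤ r →
    ∀ x ∈ Set.Icc (0 : ℝ) 1,
      p.eval x ^ 2 ≤ C * ∫ t in (0 : ℝ)..1, p.eval t ^ 2 ∧
      p.derivative.eval x ^ 2 ≤ C * ∫ t in (0 : ℝ)..1, p.eval t ^ 2 := by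
  obtain ⟨m, hm, hmc⟩ := exists_coeff_sq_le_integral r
  -- Both `p` and its derivative are sums of `r + 1` terms, each at most `(r + 1)‖c‖` on the unit
  -- interval.
  refine ⟨((r + 1) * (r + 1)) ^ 2 / m, by positivity, fun p hp x hx => ?_⟩
  set c : Fin (r + 1) → ℝ := fun i => p.coeff i with hc
  have hI : m * ‖c‖ ^ 2 ≤ ∫ t in (0 : ℝ)..1, p.eval t ^ 2 := by
    have := hmc c
    have e : ∀ t, p.eval t = ∑ i, c i * t ^ (i : ℕ) := fun t => by
      rw [Polynomial.eval_eq_sum_range' (Nat.lt_succ_of_le hp), Finset.sum_range]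
    simpa only [e] using this
  have hci : ∀ i, i < r + 1 → |p.coeff i| ≤ ‖c‖ := fun i hi => norm_le_pi_norm c ⟨i, hi⟩
  have hxp : ∀ k : ℕ, |x ^ k| ≤ 1 := fun k => by
    rw [abs_of_nonneg (pow_nonneg hx.1 k)]
    exact pow_le_one₀ hx.1 hx.2
  have key : ∀ y : ℝ, |y| ≤ ((r + 1) * (r + 1)) * ‖c‖ →
      y ^ 2 ≤ ((r + 1) * (r + 1)) ^ 2 / m * ∫ t in (0 : ℝ)..1, p.eval t ^ 2 := by
    intro y hy
    calc y ^ 2 = |y| ^ 2 := (sq_abs y).symm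
      _ ≤ (((r + 1) * (r + 1)) * ‖c‖) ^ 2 := by gcongr
      _ = ((r + 1) * (r + 1)) ^ 2 / m * (m * ‖c‖ ^ 2) := by field_simp
      _ ≤ _ := by gcongr
  have hr1 : (1 : ℝ) ≤ r + 1 := by
    have : (0 : ℝ) ≤ r := Nat.cast_nonneg r
    linarith
  constructor
  · apply key
    rw [Polynomial.eval_eq_sum_range' (Nat.lt_succ_of_le hp)]
    refine (Finset.abs_sum_le_sum_abs _ _).trans ?_
    refine (Finset.sum_le_card_nsmul _ _ ((r + 1) * ‖c‖) fun i hi => ?_).trans ?_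
    · rw [abs_mul]
      calc |p.coeff i| * |x ^ i| ≤ ‖c‖ * 1 :=
            mul_le_mul (hci i (Finset.mem_range.1 hi)) (hxp i) (abs_nonneg _) (norm_nonneg _)
        _ ≤ (r + 1) * ‖c‖ := by nlinarith [norm_nonneg c]
    · simp [mul_assoc]
  · apply key
    rw [Polynomial.derivative_eval, Polynomial.sum_over_range' p (by simp) (r + 1)
      (Nat.lt_succ_of_le hp)]
    refine (Finset.abs_sum_le_sum_abs _ _).trans ?_
    refine (Finset.sum_le_card_nsmul _ _ ((r + 1) * ‖c‖) fun i hi => ?_).trans ?_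
    · have hi' : (i : ℝ) ≤ r + 1 := by
        have := Finset.mem_range.1 hi
        exact_mod_cast this.le
      rw [abs_mul, abs_mul, Nat.abs_cast]
      calc |p.coeff i| * i * |x ^ (i - 1)| ≤ ‖c‖ * (r + 1) * 1 := by
            gcongr
            · exact hci i (Finset.mem_range.1 hi)
            · exact hxp _
        _ = (r + 1) * ‖c‖ := by ring
    · simp [mul_assoc]

/-- The constant in the inverse estimates for polynomials of degree at most `r`. -/
def invConst (r : ℕ) : ℝ := (exists_unit_inverse_estimate r).choose

theorem invConst_pos (r : ℕ) : 0 < invConst r := (exists_unit_inverse_estimate r).choose_spec.1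

/-- Affine rescaling to the unit interval: the integral contributes one factor `b - a`, and the
squared derivative two more. -/
theorem inverse_estimate {r : ℕ} {p : ℝ[X]} (hp : p.natDegree ≤ r) {a b : ℝ} (hab : a < b)
    {x : ℝ} (hx : x ∈ Set.Icc a b) :
    p.eval x ^ 2 * (b - a) ≤ invConst r * ∫ t in a..b, p.eval t ^ 2 ∧
      p.derivative.eval x ^ 2 * (b - a) ^ 3 ≤ invConst r * ∫ t in a..b, p.eval t ^ 2 := by
  set h := b - a with hh
  have hpos : 0 < h := sub_pos.2 hab
  set q : ℝ[X] := p.comp (Polynomial.C h * Polynomial.X + Polynomial.C a) with hq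
  have hqe : ∀ t, q.eval t = p.eval (h * t + a) := fun t => by simp [hq]
  have hqd : ∀ t, q.derivative.eval t = h * p.derivative.eval (h * t + a) := fun t => by
    simp [hq, Polynomial.derivative_comp]
  have hqn : q.natDegree ≤ r := by
    refine Polynomial.natDegree_comp_le.trans ?_
    have := Polynomial.natDegree_linear_le (a := h) (b := a)
    calc p.natDegree * _ ≤ r * 1 := Nat.mul_le_mul hp this
      _ = r := mul_one r
  have hxm : (x - a) / h ∈ Set.Icc (0 : ℝ) 1 := by
    constructor
    · exact div_nonneg (by linarith [hx.1]) hpos.le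
    · rw [div_le_one hpos]; linarith [hx.2]
  have hxe : h * ((x - a) / h) + a = x := by field_simp; ring
  have := (exists_unit_inverse_estimate r).choose_spec.2 q hqn _ hxm
  simp only [hqe, hqd, hxe] at this
  have hI : ∫ t in (0 : ℝ)..1, p.eval (h * t + a) ^ 2 = h⁻¹ * ∫ t in a..b, p.eval t ^ 2 := by
    rw [intervalIntegral.integral_comp_mul_add (fun t => p.eval t ^ 2) hpos.ne' a]
    simp [hh]
  rw [hI] at this
  change _ ≤ invConst r * _ ∧ _ ≤ invConst r * _ at this
  obtain ⟨h1, h2⟩ := this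
  constructor
  · calc p.eval x ^ 2 * h ≤ (invConst r * (h⁻¹ * ∫ t in a..b, p.eval t ^ 2)) * h := by gcongr
      _ = _ := by field_simp
  · calc p.derivative.eval x ^ 2 * h ^ 3 = (h * p.derivative.eval x) ^ 2 * h := by ring
      _ ≤ (invConst r * (h⁻¹ * ∫ t in a..b, p.eval t ^ 2)) * h := by gcongr
      _ = _ := by field_simp

/-! ### Piecewise polynomials -/

/-- `v` is on every element `[(j-1)Δx, jΔx]` a polynomial of degree at most `r`. -/
def IsPiecewisePoly (r : ℕ) (dx : ℝ) (v : ℝ → ℝ) : Prop :=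
  ∀ j : ℤ, ∃ p : ℝ[X], p.natDegree ≤ r ∧
    ∀ x ∈ Set.Icc (((j : ℝ) - 1) * dx) ((j : ℝ) * dx), v x = p.eval x

theorem exists_mem_Ioc_element {dx : ℝ} (hdx : 0 < dx) (x : ℝ) :
    ∃ j : ℤ, x ∈ Set.Ioc (((j : ℝ) - 1) * dx) ((j : ℝ) * dx) := by
  refine ⟨⌈x / dx⌉, ?_, ?_⟩
  · rw [← lt_div_iff₀ hdx]; linarith [Int.ceil_lt_add_one (x / dx)]
  · rw [← div_le_iff₀ hdx]; exact Int.le_ceil _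

theorem exists_mem_Ico_element {dx : ℝ} (hdx : 0 < dx) (x : ℝ) :
    ∃ j : ℤ, x ∈ Set.Ico (((j : ℝ) - 1) * dx) ((j : ℝ) * dx) := by
  refine ⟨⌊x / dx⌋ + 1, ?_, ?_⟩
  · rw [← le_div_iff₀ hdx]; push_cast; linarith [Int.floor_le (x / dx)]
  · rw [← div_lt_iff₀ hdx]; push_cast; exact Int.lt_floor_add_one _

theorem element_length (dx : ℝ) (j : ℤ) : (j : ℝ) * dx - ((j : ℝ) - 1) * dx = dx := by ring

theorem element_lt {dx : ℝ} (hdx : 0 < dx) (j : ℤ) : ((j : ℝ) - 1) * dx < (j : ℝ) * dx := by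
  linarith [element_length dx j]

theorem IsPiecewisePoly.exists_left {r : ℕ} {dx : ℝ} (hdx : 0 < dx) {v : ℝ → ℝ}
    (hv : IsPiecewisePoly r dx v) (x : ℝ) :
    ∃ p : ℝ[X], v x = p.eval x ∧ ∀ᶠ y in 𝓝[≤] x, v y = p.eval y := by
  obtain ⟨j, hj⟩ := exists_mem_Ioc_element hdx x
  obtain ⟨p, -, hp⟩ := hv j
  refine ⟨p, hp x ⟨hj.1.le, hj.2⟩, ?_⟩
  filter_upwards [Ioc_mem_nhdsLE hj.1] with y hy
  exact hp y ⟨hy.1.le, hy.2.trans hj.2⟩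

theorem IsPiecewisePoly.exists_right {r : ℕ} {dx : ℝ} (hdx : 0 < dx) {v : ℝ → ℝ}
    (hv : IsPiecewisePoly r dx v) (x : ℝ) :
    ∃ p : ℝ[X], v x = p.eval x ∧ ∀ᶠ y in 𝓝[≥] x, v y = p.eval y := by
  obtain ⟨j, hj⟩ := exists_mem_Ico_element hdx x
  obtain ⟨p, -, hp⟩ := hv j
  refine ⟨p, hp x ⟨hj.1, hj.2.le⟩, ?_⟩
  filter_upwards [Ico_mem_nhdsGE hj.2] with y hy
  exact hp y ⟨hj.1.trans hy.1, hy.2.le⟩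

theorem IsPiecewisePoly.continuous {r : ℕ} {dx : ℝ} (hdx : 0 < dx) {v : ℝ → ℝ}
    (hv : IsPiecewisePoly r dx v) : Continuous v := by
  refine continuous_iff_continuousAt.2 fun x => ?_
  obtain ⟨p, hpx, hp⟩ := hv.exists_left hdx x
  obtain ⟨q, hqx, hq⟩ := hv.exists_right hdx x
  refine continuousAt_iff_continuous_left_right.2 ⟨?_, ?_⟩
  · exact (p.continuous.continuousWithinAt).congr_of_eventuallyEq hp hpx
  · exact (q.continuous.continuousWithinAt).congr_of_eventuallyEq hq hqx

theorem IsPiecewisePoly.differentiable_of_memH2 {r : ℕ} {dx : ℝ} (hdx : 0 < dx) {v : ℝ → ℝ}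
    (hv : IsPiecewisePoly r dx v) (h2 : MemH2 v) : Differentiable ℝ v := by
  intro x
  obtain ⟨p, hpx, hp⟩ := hv.exists_left hdx x
  obtain ⟨q, hqx, hq⟩ := hv.exists_right hdx x
  have hpq := h2.derivative_eval_eq hp hq
  have h1 : HasDerivWithinAt v (p.derivative.eval x) (Set.Iic x) x :=
    (p.hasDerivAt x).hasDerivWithinAt.congr_of_eventuallyEq hp hpx
  have h3 : HasDerivWithinAt v (p.derivative.eval x) (Set.Ici x) x := by
    rw [hpq]
    exact (q.hasDerivAt x).hasDerivWithinAt.congr_of_eventuallyEq hq hqx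
  have := h1.union h3
  rw [Set.Iic_union_Ici, hasDerivWithinAt_univ] at this
  exact this.differentiableAt

theorem IsPiecewisePoly.deriv_eq {dx : ℝ} (hdx : 0 < dx) {v : ℝ → ℝ}
    (hd : Differentiable ℝ v) {j : ℤ} {p : ℝ[X]}
    (hp : ∀ x ∈ Set.Icc (((j : ℝ) - 1) * dx) ((j : ℝ) * dx), v x = p.eval x) :
    ∀ x ∈ Set.Icc (((j : ℝ) - 1) * dx) ((j : ℝ) * dx), deriv v x = p.derivative.eval x := by
  intro x hx
  have h1 := (hd x).hasDerivAt.hasDerivWithinAt (s := Set.Icc (((j : ℝ) - 1) * dx) ((j : ℝ) * dx))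
  have h2 := ((p.hasDerivAt x).hasDerivWithinAt
    (s := Set.Icc (((j : ℝ) - 1) * dx) ((j : ℝ) * dx))).congr hp (hp x hx)
  exact (uniqueDiffOn_Icc (element_lt hdx j) x hx).eq_deriv _ h1 h2

theorem IsPiecewisePoly.deriv {r : ℕ} {dx : ℝ} (hdx : 0 < dx) {v : ℝ → ℝ}
    (hv : IsPiecewisePoly r dx v) (hd : Differentiable ℝ v) : IsPiecewisePoly r dx (deriv v) := by
  intro j
  obtain ⟨p, hpr, hp⟩ := hv j
  exact ⟨p.derivative, (Polynomial.natDegree_derivative_le p).trans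
    ((Nat.sub_le _ _).trans hpr), IsPiecewisePoly.deriv_eq hdx hd hp⟩

/-- `g` is on every element the derivative of the polynomial piece of `f`. -/
def IsPiecewiseDeriv (r : ℕ) (dx : ℝ) (f g : ℝ → ℝ) : Prop :=
  ∀ j : ℤ, ∃ p : ℝ[X], p.natDegree ≤ r ∧
    (∀ x ∈ Set.Icc (((j : ℝ) - 1) * dx) ((j : ℝ) * dx), f x = p.eval x) ∧
    ∀ x ∈ Set.Ioc (((j : ℝ) - 1) * dx) ((j : ℝ) * dx), g x = p.derivative.eval x

theorem IsPiecewisePoly.isPiecewiseDeriv_deriv {r : ℕ} {dx : ℝ} (hdx : 0 < dx) {v : ℝ → ℝ}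
    (hv : IsPiecewisePoly r dx v) (hd : Differentiable ℝ v) :
    IsPiecewiseDeriv r dx v (_root_.deriv v) := by
  intro j
  obtain ⟨p, hpr, hp⟩ := hv j
  exact ⟨p, hpr, hp, fun x hx => IsPiecewisePoly.deriv_eq hdx hd hp x ⟨hx.1.le, hx.2⟩⟩

/-- At a node the two adjacent pieces may have different derivatives. The ceiling selects the left
one, matching the half-open elements in `IsPiecewiseDeriv`. -/
theorem IsPiecewisePoly.exists_isPiecewiseDeriv {r : ℕ} {dx : ℝ} (hdx : 0 < dx) {v : ℝ → ℝ}
    (hv : IsPiecewisePoly r dx v) : ∃ g, IsPiecewiseDeriv r dx v g := by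
  choose p hpr hp using hv
  refine ⟨fun x => (p ⌈x / dx⌉).derivative.eval x, fun j => ⟨p j, hpr j, hp j, fun x hx => ?_⟩⟩
  have : ⌈x / dx⌉ = j := by
    rw [Int.ceil_eq_iff, lt_div_iff₀ hdx, div_le_iff₀ hdx]
    exact hx
  simp only [this]

theorem IsPiecewiseDeriv.hasDerivAt {r : ℕ} {dx : ℝ} (hdx : 0 < dx) {f g : ℝ → ℝ}
    (h : IsPiecewiseDeriv r dx f g) {x : ℝ} (hx : x ∉ Set.range fun j : ℤ => (j : ℝ) * dx) :
    HasDerivAt f (g x) x := by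
  obtain ⟨j, hj⟩ := exists_mem_Ioc_element hdx x
  obtain ⟨p, -, hf, hg⟩ := h j
  have hlt : x < (j : ℝ) * dx := lt_of_le_of_ne hj.2 fun he => hx ⟨j, he.symm⟩
  rw [hg x hj]
  refine (p.hasDerivAt x).congr_of_eventuallyEq ?_
  filter_upwards [Ioo_mem_nhds hj.1 hlt] with y hy
  exact hf y ⟨hy.1.le, hy.2.le⟩

theorem IsPiecewiseDeriv.aestronglyMeasurable {r : ℕ} {dx : ℝ} (hdx : 0 < dx) {f g : ℝ → ℝ}
    (h : IsPiecewiseDeriv r dx f g) : AEStronglyMeasurable g := by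
  refine (stronglyMeasurable_deriv f).aestronglyMeasurable.congr ?_
  have : ∀ᵐ x ∂volume, x ∉ Set.range fun j : ℤ => (j : ℝ) * dx :=
    (Set.countable_range _).ae_notMem _
  filter_upwards [this] with x hx
  exact (h.hasDerivAt hdx hx).deriv

theorem lintegral_le_of_forall_element {dx : ℝ} (hdx : 0 < dx) {F G : ℝ → ℝ≥0∞}
    (h : ∀ j : ℤ, ∫⁻ x in Set.Ioc (((j : ℝ) - 1) * dx) ((j : ℝ) * dx), F x ≤
      ∫⁻ x in Set.Ioc (((j : ℝ) - 1) * dx) ((j : ℝ) * dx), G x) :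
    ∫⁻ x, F x ≤ ∫⁻ x, G x := by
  have hU : (⋃ j : ℤ, Set.Ioc (((j : ℝ) - 1) * dx) ((j : ℝ) * dx)) = Set.univ :=
    Set.eq_univ_of_forall fun x => Set.mem_iUnion.2 (exists_mem_Ioc_element hdx x)
  have hD : Pairwise (Function.onFun Disjoint
      fun j : ℤ => Set.Ioc (((j : ℝ) - 1) * dx) ((j : ℝ) * dx)) := by
    intro i j hij
    refine Set.disjoint_left.2 fun x hxi hxj => hij ?_
    have : ∀ k : ℤ, x ∈ Set.Ioc (((k : ℝ) - 1) * dx) ((k : ℝ) * dx) → ⌈x / dx⌉ = k := by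
      intro k hk
      rw [Int.ceil_eq_iff, lt_div_iff₀ hdx, div_le_iff₀ hdx]
      exact hk
    rw [← this i hxi, ← this j hxj]
  rw [← setLIntegral_univ F, ← setLIntegral_univ G, ← hU,
    lintegral_iUnion (fun _ => measurableSet_Ioc) hD, lintegral_iUnion (fun _ => measurableSet_Ioc) hD]
  exact ENNReal.tsum_le_tsum h

theorem integral_element_eq {dx : ℝ} (hdx : 0 < dx) {f : ℝ → ℝ} {j : ℤ} {p : ℝ[X]}
    (hp : ∀ x ∈ Set.Icc (((j : ℝ) - 1) * dx) ((j : ℝ) * dx), f x = p.eval x) :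
    ∫ t in (((j : ℝ) - 1) * dx)..((j : ℝ) * dx), p.eval t ^ 2 =
      ∫ t in Set.Ioc (((j : ℝ) - 1) * dx) ((j : ℝ) * dx), f t ^ 2 := by
  rw [intervalIntegral.integral_of_le (element_lt hdx j).le]
  exact setIntegral_congr_fun measurableSet_Ioc fun x hx => by
    simp only [hp x ⟨hx.1.le, hx.2⟩]

theorem IsPiecewisePoly.sq_le {r : ℕ} {dx : ℝ} (hdx : 0 < dx) {f : ℝ → ℝ}
    (h : IsPiecewisePoly r dx f) (hf : MemLp f 2) (x : ℝ) :
    f x ^ 2 * dx ≤ invConst r * ∫ t, f t ^ 2 := by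
  obtain ⟨j, hj⟩ := exists_mem_Ioc_element hdx x
  obtain ⟨p, hpr, hp⟩ := h j
  have h1 := (inverse_estimate hpr (element_lt hdx j) (Set.Ioc_subset_Icc_self hj)).1
  rw [element_length, integral_element_eq hdx hp, ← hp x (Set.Ioc_subset_Icc_self hj)] at h1
  refine h1.trans (mul_le_mul_of_nonneg_left ?_ (invConst_pos r).le)
  exact setIntegral_le_integral hf.integrable_sq (Eventually.of_forall fun x => sq_nonneg _)

theorem IsPiecewiseDeriv.sq_le {r : ℕ} {dx : ℝ} (hdx : 0 < dx) {f g : ℝ → ℝ}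
    (h : IsPiecewiseDeriv r dx f g) (hf : MemLp f 2) (x : ℝ) :
    g x ^ 2 * dx ^ 3 ≤ invConst r * ∫ t, f t ^ 2 := by
  obtain ⟨j, hj⟩ := exists_mem_Ioc_element hdx x
  obtain ⟨p, hpr, hp, hg⟩ := h j
  have h1 := (inverse_estimate hpr (element_lt hdx j) (Set.Ioc_subset_Icc_self hj)).2
  rw [element_length, integral_element_eq hdx hp, ← hg x hj] at h1
  refine h1.trans (mul_le_mul_of_nonneg_left ?_ (invConst_pos r).le)
  exact setIntegral_le_integral hf.integrable_sq (Eventually.of_forall fun x => sq_nonneg _)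

/-- On each element the pointwise bound with `dx⁻³` is integrated over a length `dx`, and the
elements are summed. The sum is taken in `ℝ≥0∞`, since integrability of `g²` is part of the claim.
-/
theorem IsPiecewiseDeriv.memLp_and_integral_sq_le {r : ℕ} {dx : ℝ} (hdx : 0 < dx) {f g : ℝ → ℝ}
    (h : IsPiecewiseDeriv r dx f g) (hf : MemLp f 2) :
    MemLp g 2 ∧ (∫ t, g t ^ 2) * dx ^ 2 ≤ invConst r * ∫ t, f t ^ 2 := by
  have hm := h.aestronglyMeasurable hdx
  have hfi := hf.integrable_sq
  have hC := invConst_pos r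
  have key : ∫⁻ t, ENNReal.ofReal (g t ^ 2) ≤
      ∫⁻ t, ENNReal.ofReal (invConst r / dx ^ 2 * f t ^ 2) := by
    refine lintegral_le_of_forall_element hdx fun j => ?_
    obtain ⟨p, hpr, hp, hg⟩ := h j
    set S := Set.Ioc (((j : ℝ) - 1) * dx) ((j : ℝ) * dx) with hS
    set I := ∫ t in S, f t ^ 2 with hI
    have hI0 : 0 ≤ I := integral_nonneg fun _ => sq_nonneg _
    calc ∫⁻ t in S, ENNReal.ofReal (g t ^ 2)
        ≤ ∫⁻ _ in S, ENNReal.ofReal (invConst r / dx ^ 3 * I) := by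
          refine setLIntegral_mono' measurableSet_Ioc fun x hx => ENNReal.ofReal_le_ofReal ?_
          have h1 := (inverse_estimate hpr (element_lt hdx j) (Set.Ioc_subset_Icc_self hx)).2
          rw [element_length, integral_element_eq hdx hp, ← hg x hx] at h1
          rw [div_mul_eq_mul_div, le_div_iff₀ (by positivity)]
          exact h1
      _ = ENNReal.ofReal (invConst r / dx ^ 2 * I) := by
          rw [setLIntegral_const, hS, Real.volume_Ioc, element_length,
            ← ENNReal.ofReal_mul (by positivity)]
          congr 1
          field_simp
      _ = ∫⁻ t in S, ENNReal.ofReal (invConst r / dx ^ 2 * f t ^ 2) := by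
          rw [hI, ← integral_const_mul, ofReal_integral_eq_lintegral_ofReal]
          · exact (hfi.integrableOn).const_mul _
          · exact Eventually.of_forall fun x => by positivity
  have hfin : Integrable (fun t => invConst r / dx ^ 2 * f t ^ 2) := hfi.const_mul _
  have hgi : Integrable (fun t => g t ^ 2) := by
    refine ⟨hm.pow 2, ?_⟩
    rw [hasFiniteIntegral_iff_ofReal (Eventually.of_forall fun x => sq_nonneg _)]
    refine key.trans_lt ?_
    rw [← hasFiniteIntegral_iff_ofReal (Eventually.of_forall fun x => by positivity)]
    exact hfin.2
  refine ⟨(memLp_two_iff_integrable_sq hm).2 hgi, ?_⟩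
  rw [← ofReal_integral_eq_lintegral_ofReal hgi (Eventually.of_forall fun x => sq_nonneg _),
    ← ofReal_integral_eq_lintegral_ofReal hfin (Eventually.of_forall fun x => by positivity),
    ENNReal.ofReal_le_ofReal_iff (integral_nonneg fun x => by positivity), integral_const_mul,
    div_mul_eq_mul_div, le_div_iff₀ (by positivity)] at key
  exact key

theorem abs_le_sqrt_of_sq_mul_le {y c B : ℝ} (hc : 0 < c) (h : y ^ 2 * c ≤ B) : |y| ≤ √(B / c) := by
  apply Real.abs_le_sqrt
  rwa [le_div_iff₀ hc]

theorem IsPiecewisePoly.exists_isH2Jet {r : ℕ} {dx : ℝ} (hdx : 0 < dx) {v : ℝ → ℝ}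
    (hp : IsPiecewisePoly r dx v) (hd : Differentiable ℝ v) (hL : MemLp v 2) :
    ∃ g, IsPiecewiseDeriv r dx (_root_.deriv v) g ∧ IsH2Jet v (_root_.deriv v) g := by
  have hp' := hp.deriv hdx hd
  obtain ⟨g, hg⟩ := hp'.exists_isPiecewiseDeriv hdx
  have h1 := hp.isPiecewiseDeriv_deriv hdx hd
  have hL1 := (h1.memLp_and_integral_sq_le hdx hL).1
  have hL2 := (hg.memLp_and_integral_sq_le hdx hL1).1
  refine ⟨g, hg, ⟨fun x => (hd x).hasDerivAt, hp'.continuous hdx,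
    ⟨_, Set.countable_range _, fun x hx => hg.hasDerivAt hdx hx⟩, hL, hL1, hL2, ?_⟩⟩
  set M₀ := √((invConst r * ∫ t, v t ^ 2) / dx)
  set M₁ := √((invConst r * ∫ t, v t ^ 2) / dx ^ 3)
  set M₂ := √((invConst r * ∫ t, _root_.deriv v t ^ 2) / dx ^ 3)
  have p0 : 0 ≤ M₀ := Real.sqrt_nonneg _
  have p1 : 0 ≤ M₁ := Real.sqrt_nonneg _
  have p2 : 0 ≤ M₂ := Real.sqrt_nonneg _
  refine ⟨M₀ + M₁ + M₂, by positivity, fun x => ⟨?_, ?_, ?_⟩⟩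
  · have : |v x| ≤ M₀ := abs_le_sqrt_of_sq_mul_le hdx (hp.sq_le hdx hL x)
    linarith
  · have : |_root_.deriv v x| ≤ M₁ := abs_le_sqrt_of_sq_mul_le (by positivity) (h1.sq_le hdx hL x)
    linarith
  · have : |g x| ≤ M₂ := abs_le_sqrt_of_sq_mul_le (by positivity) (hg.sq_le hdx hL1 x)
    linarith

/-- Removes distributions from the rest of the argument: forward because derivative jumps are
excluded, backward because the inverse estimates, applied twice, supply bounded `L²` derivatives. -/
theorem mem_femSpace_iff {r : ℕ} {dx : ℝ} (hdx : 0 < dx) {v : ℝ → ℝ} :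
    v ∈ femSpace r dx ↔ IsPiecewisePoly r dx v ∧ Differentiable ℝ v ∧ MemLp v 2 := by
  constructor
  · rintro ⟨h2, hp⟩
    have hp' : IsPiecewisePoly r dx v := hp
    exact ⟨hp', hp'.differentiable_of_memH2 hdx h2, by simpa using h2.choose.re⟩
  · rintro ⟨hp, hd, hL⟩
    obtain ⟨g, -, hg⟩ := hp.exists_isH2Jet hdx hd hL
    exact ⟨hg.memH2, hp⟩

/-- The norm of `L²(ℝ)` as a real number. -/
def l2norm (f : ℝ → ℝ) : ℝ := √(∫ x, f x ^ 2)

theorem l2norm_nonneg (f : ℝ → ℝ) : 0 ≤ l2norm f := Real.sqrt_nonneg _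

theorem l2norm_sq (f : ℝ → ℝ) : l2norm f ^ 2 = ∫ x, f x ^ 2 :=
  Real.sq_sqrt (integral_nonneg fun _ => sq_nonneg _)

theorem eLpNorm_two_eq_ofReal_l2norm {f : ℝ → ℝ} (hf : MemLp f 2) :
    eLpNorm f 2 = ENNReal.ofReal (l2norm f) := by
  rw [hf.eLpNorm_eq_integral_rpow_norm (by norm_num) (by norm_num), l2norm, Real.sqrt_eq_rpow]
  congr 2
  · refine integral_congr_ae (Eventually.of_forall fun x => ?_)
    simp
  · norm_num

theorem exists_inverseInequality (r : ℕ) :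
    ∃ C₁ C₂ : ℝ, 0 < C₁ ∧ 0 < C₂ ∧ InverseInequality r C₁ C₂ := by
  have hC := invConst_pos r
  -- The second inequality uses the `L²` inverse estimate with factor `√(invConst r)` on top of
  -- `√C₁`, so `√C₂` is the product of two such factors.
  refine ⟨invConst r, invConst r ^ 2, hC, by positivity, fun dx hdx z hz => ?_⟩
  obtain ⟨hp, hd, hL⟩ := (mem_femSpace_iff hdx).1 hz
  have h1 := hp.isPiecewiseDeriv_deriv hdx hd
  obtain ⟨hL1, hI⟩ := h1.memLp_and_integral_sq_le hdx hL
  rw [eLpNorm_two_eq_ofReal_l2norm hL1, eLpNorm_two_eq_ofReal_l2norm hL,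
    ← ENNReal.ofReal_mul (by positivity), ← ENNReal.ofReal_mul (by positivity)]
  have e1 : dx ^ (1 / 2 : ℝ) = √dx := (Real.sqrt_eq_rpow dx).symm
  have e3 : dx ^ (3 / 2 : ℝ) = dx * √dx := by
    rw [Real.sqrt_eq_rpow, ← Real.rpow_one_add' hdx.le (by norm_num)]
    norm_num
  rw [e1, e3]
  constructor
  · rw [eLpNorm_exponent_top]
    refine eLpNormEssSup_le_of_ae_bound (Eventually.of_forall fun x => ?_)
    have := abs_le_sqrt_of_sq_mul_le hdx ((hp.deriv hdx hd).sq_le hdx hL1 x)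
    rwa [Real.sqrt_div' _ hdx.le, Real.sqrt_mul hC.le, mul_div_right_comm] at this
  · refine ENNReal.ofReal_le_ofReal ?_
    have h2 : l2norm (deriv z) * dx ≤ √(invConst r) * l2norm z := by
      refine le_of_sq_le_sq ?_ (mul_nonneg (Real.sqrt_nonneg _) (l2norm_nonneg _))
      rw [mul_pow, mul_pow, l2norm_sq, l2norm_sq, Real.sq_sqrt hC.le]
      exact hI
    rw [Real.sqrt_sq hC.le]
    have hs : 0 < √dx := Real.sqrt_pos.2 hdx
    rw [div_mul_eq_mul_div, div_mul_eq_mul_div, div_le_div_iff₀ hs (by positivity)]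
    calc √(invConst r) * l2norm (deriv z) * (dx * √dx)
        = √(invConst r) * √dx * (l2norm (deriv z) * dx) := by ring
      _ ≤ √(invConst r) * √dx * (√(invConst r) * l2norm z) := by gcongr
      _ = (√(invConst r) * √(invConst r)) * l2norm z * √dx := by ring
      _ = invConst r * l2norm z * √dx := by rw [Real.mul_self_sqrt hC.le]

/-! ### The `L²` norm and translations -/

theorem abs_integral_mul_le_sqrt_mul_sqrt {α : Type*} [MeasurableSpace α] {μ : Measure α}
    {f g : α → ℝ} (hf : MemLp f 2 μ) (hg : MemLp g 2 μ) :
    ∫ x, |f x * g x| ∂μ ≤ √(∫ x, f x ^ 2 ∂μ) * √(∫ x, g x ^ 2 ∂μ) := by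
  have h := integral_mul_norm_le_Lp_mul_Lq (μ := μ) (f := f) (g := g) Real.HolderConjugate.two_two
    (by simpa using hf) (by simpa using hg)
  simpa [abs_mul, Real.sqrt_eq_rpow] using h

theorem integral_abs_mul_le {f g : ℝ → ℝ} (hf : MemLp f 2) (hg : MemLp g 2) :
    ∫ x, |f x * g x| ≤ l2norm f * l2norm g := abs_integral_mul_le_sqrt_mul_sqrt hf hg

theorem abs_integral_mul_le {f g : ℝ → ℝ} (hf : MemLp f 2) (hg : MemLp g 2) :
    |∫ x, f x * g x| ≤ l2norm f * l2norm g :=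
  (abs_integral_le_integral_abs).trans (integral_abs_mul_le hf hg)

theorem integrable_mul_of_memLp_two {f g : ℝ → ℝ} (hf : MemLp f 2) (hg : MemLp g 2) :
    Integrable (fun x => f x * g x) := hf.integrable_mul hg

theorem l2norm_add_le {f g : ℝ → ℝ} (hf : MemLp f 2) (hg : MemLp g 2) :
    l2norm (fun x => f x + g x) ≤ l2norm f + l2norm g := by
  refine le_of_sq_le_sq ?_ (add_nonneg (l2norm_nonneg _) (l2norm_nonneg _))
  have h := (le_abs_self _).trans (abs_integral_mul_le hf hg)
  have e : ∫ x, (f x + g x) ^ 2 = (∫ x, f x ^ 2) + 2 * (∫ x, f x * g x) + ∫ x, g x ^ 2 := by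
    have i1 := hf.integrable_sq
    have i2 := hg.integrable_sq
    have i3 := (integrable_mul_of_memLp_two hf hg).const_mul 2
    rw [← integral_const_mul, ← integral_add i1 i3]
    refine Eq.trans ?_ (integral_add (i1.add i3) i2)
    congr 1
    ext x
    ring
  rw [l2norm_sq, e, ← l2norm_sq, ← l2norm_sq]
  nlinarith

theorem l2norm_neg (f : ℝ → ℝ) : l2norm (fun x => -f x) = l2norm f := by
  simp [l2norm]

theorem l2norm_const_mul (c : ℝ) (f : ℝ → ℝ) : l2norm (fun x => c * f x) = |c| * l2norm f := by
  simp only [l2norm, mul_pow]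
  rw [integral_const_mul, Real.sqrt_mul (sq_nonneg c), Real.sqrt_sq_eq_abs]

theorem l2norm_translate (f : ℝ → ℝ) (y : ℝ) : l2norm (fun x => f (x + y)) = l2norm f := by
  simp only [l2norm]
  rw [integral_add_right_eq_self (fun x => f x ^ 2) y]

theorem memLp_translate {f : ℝ → ℝ} (hf : MemLp f 2) (y : ℝ) : MemLp (fun x => f (x + y)) 2 :=
  hf.comp_measurePreserving (measurePreserving_add_right volume y)

/-- The difference is the integral of `f (x + s)` over `0 < s ≤ y`. Cauchy–Schwarz in `s` and Fubini
give a factor `y` each in the squared norm. -/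
theorem l2norm_translate_sub_le {F f : ℝ → ℝ} (hf : MemLp f 2)
    (hFf : ∀ a b, F b - F a = ∫ x in a..b, f x) {y : ℝ} (hy : 0 ≤ y) :
    l2norm (fun x => F (x + y) - F x) ≤ y * l2norm f := by
  -- Fubini needs joint measurability of `f (x + s)`, so `f` is replaced by a strongly measurable
  -- representative.
  wlog hm : StronglyMeasurable f generalizing f with H
  · have hae := hf.aestronglyMeasurable.ae_eq_mk
    have := H (f := hf.aestronglyMeasurable.mk f) (hf.ae_eq hae)
      (fun a b => by
        rw [hFf]
        exact intervalIntegral.integral_congr_ae (hae.mono fun x hx _ => hx))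
      hf.aestronglyMeasurable.stronglyMeasurable_mk
    have e : l2norm (hf.aestronglyMeasurable.mk f) = l2norm f := by
      simp only [l2norm]
      congr 1
      exact integral_congr_ae (hae.mono fun x hx => by simp only [hx])
    rwa [e] at this
  set μ := (volume : Measure ℝ).restrict (Set.Ioc 0 y) with hμ
  have hsq := hf.integrable_sq
  have hprod : Integrable (fun p : ℝ × ℝ => f (p.1 + p.2) ^ 2) (volume.prod μ) := by
    have hms : AEStronglyMeasurable (fun p : ℝ × ℝ => f (p.1 + p.2) ^ 2) (volume.prod μ) :=
      ((hm.comp_measurable measurable_add).pow 2).aestronglyMeasurable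
    rw [integrable_prod_iff' hms]
    constructor
    · exact Eventually.of_forall fun s => hsq.comp_add_right s
    · have : (fun s : ℝ => ∫ x, ‖f (x + s) ^ 2‖) = fun _ => ∫ x, ‖f x ^ 2‖ := by
        ext s
        exact integral_add_right_eq_self (fun x => ‖f x ^ 2‖) s
      simp only [this]
      exact integrable_const _
  have hpt : ∀ x, (F (x + y) - F x) ^ 2 ≤ y * ∫ s, f (x + s) ^ 2 ∂μ := by
    intro x
    have e1 : F (x + y) - F x = ∫ s, f (x + s) * 1 ∂μ := by
      rw [hFf, hμ, ← intervalIntegral.integral_of_le hy]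
      simp only [mul_one]
      rw [intervalIntegral.integral_comp_add_left]
      simp
    have m1 : MemLp (fun s => f (x + s)) 2 μ := by
      have := (memLp_translate hf x).restrict (Set.Ioc 0 y)
      simpa only [add_comm] using this
    have h := (abs_integral_le_integral_abs).trans
      (abs_integral_mul_le_sqrt_mul_sqrt m1 (memLp_const (1 : ℝ)))
    rw [← e1] at h
    have h2 := sq_le_sq' (by linarith [abs_nonneg (F (x + y) - F x)]) h
    rw [sq_abs, mul_pow, Real.sq_sqrt (integral_nonneg fun _ => sq_nonneg _),
      Real.sq_sqrt (integral_nonneg fun _ => sq_nonneg _)] at h2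
    have e2 : ∫ _, (1 : ℝ) ^ 2 ∂μ = y := by
      simp [hμ, hy]
    rw [e2] at h2
    linarith
  have hmain : ∫ x, (F (x + y) - F x) ^ 2 ≤ ∫ x, y * ∫ s, f (x + s) ^ 2 ∂μ :=
    integral_mono_of_nonneg (Eventually.of_forall fun _ => sq_nonneg _)
      (hprod.integral_prod_left.const_mul y) (Eventually.of_forall hpt)
  have hsw : ∫ x, ∫ s, f (x + s) ^ 2 ∂μ = y * ∫ x, f x ^ 2 := by
    rw [integral_integral_swap (f := fun x s => f (x + s) ^ 2) hprod]
    have : ∀ s : ℝ, ∫ x, f (x + s) ^ 2 = ∫ x, f x ^ 2 := fun s =>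
      integral_add_right_eq_self (fun x => f x ^ 2) s
    simp only [this]
    simp [hμ, hy]
  rw [integral_const_mul, hsw] at hmain
  refine le_of_sq_le_sq ?_ (mul_nonneg hy (l2norm_nonneg _))
  rw [mul_pow, l2norm_sq, l2norm_sq]
  linarith

theorem IsH2Jet.sub_eq_integral {w dw ddw : ℝ → ℝ} (h : IsH2Jet w dw ddw) (a b : ℝ) :
    w b - w a = ∫ x in a..b, dw x :=
  (intervalIntegral.integral_eq_sub_of_hasDerivAt (fun x _ => h.hasDerivAt x)
    (h.continuous_deriv.intervalIntegrable _ _)).symm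

theorem IsH2Jet.deriv_sub_eq_integral {w dw ddw : ℝ → ℝ} (h : IsH2Jet w dw ddw) (a b : ℝ) :
    dw b - dw a = ∫ x in a..b, ddw x := by
  obtain ⟨s, hs, hds⟩ := h.hasDerivAt_deriv
  refine (integral_eq_of_hasDerivAt_off_countable dw ddw hs h.continuous_deriv.continuousOn
    (fun x hx => hds x hx.2) ?_).symm
  rw [intervalIntegrable_iff, Set.uIoc]
  exact (h.memLp_deriv2.restrict _).integrable (by norm_num)

theorem IsH2Jet.exists_lipschitz {w dw ddw : ℝ → ℝ} (h : IsH2Jet w dw ddw) :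
    ∃ M, 0 ≤ M ∧ (∀ x, |w x| ≤ M) ∧ (∀ x, |dw x| ≤ M) ∧
      (∀ a b, |w b - w a| ≤ M * |b - a|) ∧ ∀ a b, |dw b - dw a| ≤ M * |b - a| := by
  obtain ⟨M, hM0, hM⟩ := h.bounded
  refine ⟨M, hM0, fun x => (hM x).1, fun x => (hM x).2.1, fun a b => ?_, fun a b => ?_⟩
  · rw [h.sub_eq_integral]
    exact intervalIntegral.norm_integral_le_of_norm_le_const (f := dw) fun x _ => (hM x).2.1
  · rw [h.deriv_sub_eq_integral]
    exact intervalIntegral.norm_integral_le_of_norm_le_const (f := ddw) fun x _ => (hM x).2.2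

/-! ### Second differences and the operator `|D|` -/

/-- The symmetric second difference `2 w(x) - w(x+y) - w(x-y)`. -/
def secondDiff (w : ℝ → ℝ) (y x : ℝ) : ℝ := 2 * w x - w (x + y) - w (x - y)

theorem memLp_secondDiff {w : ℝ → ℝ} (hw : MemLp w 2) (y : ℝ) : MemLp (secondDiff w y) 2 :=
  ((hw.const_mul 2).sub (memLp_translate hw y)).sub (memLp_translate hw (-y))

theorem l2norm_secondDiff_le {w : ℝ → ℝ} (hw : MemLp w 2) (y : ℝ) :
    l2norm (secondDiff w y) ≤ 4 * l2norm w := by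
  have m1 := hw.const_mul 2
  have m2 := memLp_translate hw y
  have m3 := memLp_translate hw (-y)
  have e : secondDiff w y = fun x => (2 * w x + -w (x + y)) + -w (x + -y) := by
    ext x
    simp only [secondDiff]
    ring_nf
  rw [e]
  refine (l2norm_add_le (m1.add m2.neg) m3.neg).trans ?_
  have h1 := l2norm_add_le m1 m2.neg
  change _ ≤ _ + l2norm (fun x => -w (x + y)) at h1
  change l2norm (fun x => 2 * w x + -w (x + y)) + l2norm (fun x => -w (x + -y)) ≤ _
  rw [l2norm_neg, l2norm_translate, l2norm_const_mul] at h1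
  rw [l2norm_neg, l2norm_translate]
  norm_num at h1
  linarith

/-- After translation by `y` and a change of sign, the second difference is a difference of first
differences, so the translation estimate applies twice. -/
theorem IsH2Jet.l2norm_secondDiff_le {w dw ddw : ℝ → ℝ} (h : IsH2Jet w dw ddw) {y : ℝ}
    (hy : 0 ≤ y) : l2norm (secondDiff w y) ≤ y ^ 2 * l2norm ddw := by
  set u : ℝ → ℝ := fun x => w (x + y) - w x with hu
  set du : ℝ → ℝ := fun x => dw (x + y) - dw x with hdu
  have hdu2 : MemLp du 2 := (memLp_translate h.memLp_deriv y).sub h.memLp_deriv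
  have e1 : l2norm (secondDiff w y) = l2norm (fun x => u (x + y) - u x) := by
    rw [← l2norm_translate (secondDiff w y) y, ← l2norm_neg]
    congr 1
    ext x
    simp only [secondDiff, hu, add_sub_cancel_right]
    ring
  have hder : ∀ a b, u b - u a = ∫ x in a..b, du x := fun a b => by
    refine (intervalIntegral.integral_eq_sub_of_hasDerivAt (fun x _ => ?_)
      (Continuous.intervalIntegrable ?_ _ _)).symm
    · exact ((h.hasDerivAt (x + y)).comp_add_const x y).sub (h.hasDerivAt x)
    · exact (h.continuous_deriv.comp (continuous_id.add continuous_const)).sub h.continuous_deriv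
  rw [e1]
  calc _ ≤ y * l2norm du := l2norm_translate_sub_le hdu2 hder hy
    _ ≤ y * (y * l2norm ddw) := by
      gcongr
      exact l2norm_translate_sub_le h.memLp_deriv2 h.deriv_sub_eq_integral hy
    _ = _ := by ring

/-- One majorant handles both the singularity at 0 and the tail. Its integral over the half line is
`cπ`, which cancels the prefactor `1/π` of `fracLap`. -/
theorem div_sq_le_of_le {t c y : ℝ} (hy : 0 < y) (h1 : t ≤ c * y ^ 2) (h2 : t ≤ c) :
    t / y ^ 2 ≤ 2 * c * (1 + y ^ 2)⁻¹ := by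
  rw [← div_eq_mul_inv, div_le_div_iff₀ (by positivity) (by positivity)]
  nlinarith [sq_nonneg y]

/-- The operator `|D| = H ∂ₓ` as a singular integral of second differences. -/
def fracLap (w : ℝ → ℝ) (x : ℝ) : ℝ := 1 / Real.pi * ∫ y in Set.Ioi (0 : ℝ), secondDiff w y x / y ^ 2

theorem continuous_secondDiff {w : ℝ → ℝ} (hw : Continuous w) :
    Continuous fun p : ℝ × ℝ => secondDiff w p.2 p.1 := by
  unfold secondDiff
  fun_prop

theorem integrableOn_const_mul_inv_one_add_sq (c : ℝ) :
    IntegrableOn (fun y : ℝ => c * (1 + y ^ 2)⁻¹) (Set.Ioi 0) :=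
  (integrable_inv_one_add_sq.const_mul c).integrableOn

theorem integral_const_mul_inv_one_add_sq (c : ℝ) :
    ∫ y in Set.Ioi (0 : ℝ), 2 * c * (1 + y ^ 2)⁻¹ = c * Real.pi := by
  rw [integral_const_mul, integral_Ioi_inv_one_add_sq]
  simp
  ring

section
variable {w dw ddw g : ℝ → ℝ}

theorem IsH2Jet.integral_abs_secondDiff_mul_le (h : IsH2Jet w dw ddw) (hg : MemLp g 2) {y : ℝ}
    (hy : 0 < y) : (∫ x, |secondDiff w y x * g x|) / y ^ 2 ≤
      2 * ((l2norm ddw + 4 * l2norm w) * l2norm g) * (1 + y ^ 2)⁻¹ := by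
  have n1 := l2norm_nonneg ddw
  have n2 := l2norm_nonneg w
  have n3 := l2norm_nonneg g
  have hcs := integral_abs_mul_le (memLp_secondDiff h.memLp y) hg
  refine div_sq_le_of_le hy (hcs.trans ?_) (hcs.trans ?_)
  · calc _ ≤ (y ^ 2 * l2norm ddw) * l2norm g := by gcongr; exact h.l2norm_secondDiff_le hy.le
      _ = (l2norm ddw * l2norm g) * y ^ 2 := by ring
      _ ≤ _ := by gcongr; linarith
  · gcongr
    exact (BOScheme.l2norm_secondDiff_le h.memLp y).trans (by linarith)

/-- Absolute convergence of the double integral: it lets the `x` integral be taken first, which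
turns energy estimates into statements about one function of `y`. -/
theorem IsH2Jet.integrable_secondDiff_kernel (h : IsH2Jet w dw ddw) (hg : MemLp g 2) :
    Integrable (fun p : ℝ × ℝ => secondDiff w p.2 p.1 * g p.1 / p.2 ^ 2)
      (volume.prod (volume.restrict (Set.Ioi 0))) := by
  have hms : AEStronglyMeasurable (fun p : ℝ × ℝ => secondDiff w p.2 p.1 * g p.1 / p.2 ^ 2)
      (volume.prod (volume.restrict (Set.Ioi 0))) := by
    have m1 := ((continuous_secondDiff h.continuous).aestronglyMeasurable
      (μ := volume.prod (volume.restrict (Set.Ioi (0 : ℝ)))))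
    have m2 : AEStronglyMeasurable (fun p : ℝ × ℝ => g p.1)
      (volume.prod (volume.restrict (Set.Ioi (0 : ℝ)))) := hg.aestronglyMeasurable.comp_fst
    have m3 : AEStronglyMeasurable (fun p : ℝ × ℝ => (p.2 ^ 2)⁻¹)
      (volume.prod (volume.restrict (Set.Ioi (0 : ℝ)))) :=
        ((measurable_snd.pow_const 2).inv).aestronglyMeasurable
    exact (m1.mul m2).mul m3
  have hxi : ∀ y : ℝ, Integrable fun x => secondDiff w y x * g x := fun y =>
    integrable_mul_of_memLp_two (memLp_secondDiff h.memLp y) hg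
  have en : ∀ y : ℝ, ∫ x, ‖secondDiff w y x * g x / y ^ 2‖ =
      (∫ x, |secondDiff w y x * g x|) / y ^ 2 := fun y => by
    rw [← integral_div]
    congr 1
    ext x
    rw [Real.norm_eq_abs, abs_div, abs_of_nonneg (sq_nonneg y)]
  rw [integrable_prod_iff' hms]
  refine ⟨Eventually.of_forall fun y => (hxi y).div_const (y ^ 2), ?_⟩
  refine Integrable.mono' (integrableOn_const_mul_inv_one_add_sq
    (2 * ((l2norm ddw + 4 * l2norm w) * l2norm g))) hms.norm.prod_swap.integral_prod_right' ?_
  refine (ae_restrict_iff' measurableSet_Ioi).2 (Eventually.of_forall fun y hy => ?_)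
  rw [Real.norm_of_nonneg (integral_nonneg fun _ => norm_nonneg _)]
  simp only [en]
  exact h.integral_abs_secondDiff_mul_le hg hy

theorem fracLap_mul_eq (x : ℝ) : fracLap w x * g x =
    1 / Real.pi * ∫ y in Set.Ioi (0 : ℝ), secondDiff w y x * g x / y ^ 2 := by
  rw [fracLap, mul_assoc, ← integral_mul_const]
  congr 2
  ext y
  ring

theorem IsH2Jet.integrable_fracLap_mul (h : IsH2Jet w dw ddw) (hg : MemLp g 2) :
    Integrable fun x => fracLap w x * g x := by
  simp only [fracLap_mul_eq]
  exact (h.integrable_secondDiff_kernel hg).integral_prod_left.const_mul _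

theorem IsH2Jet.integrableOn_integral_secondDiff_mul (h : IsH2Jet w dw ddw) (hg : MemLp g 2) :
    IntegrableOn (fun y => (∫ x, secondDiff w y x * g x) / y ^ 2) (Set.Ioi 0) := by
  have := (h.integrable_secondDiff_kernel hg).integral_prod_right
  simp only [integral_div] at this
  exact this

theorem IsH2Jet.integral_fracLap_mul (h : IsH2Jet w dw ddw) (hg : MemLp g 2) :
    ∫ x, fracLap w x * g x =
      1 / Real.pi * ∫ y in Set.Ioi (0 : ℝ), (∫ x, secondDiff w y x * g x) / y ^ 2 := by
  simp only [fracLap_mul_eq]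
  rw [integral_const_mul, integral_integral_swap
    (f := fun x y => secondDiff w y x * g x / y ^ 2) (h.integrable_secondDiff_kernel hg)]
  simp only [integral_div]

theorem IsH2Jet.abs_integral_fracLap_mul_le (h : IsH2Jet w dw ddw) (hg : MemLp g 2) :
    |∫ x, fracLap w x * g x| ≤ (l2norm ddw + 4 * l2norm w) * l2norm g := by
  rw [h.integral_fracLap_mul hg, abs_mul, abs_of_pos (by positivity)]
  have : |∫ y in Set.Ioi (0 : ℝ), (∫ x, secondDiff w y x * g x) / y ^ 2| ≤
      ((l2norm ddw + 4 * l2norm w) * l2norm g) * Real.pi := by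
    rw [← integral_const_mul_inv_one_add_sq]
    refine abs_integral_le_integral_abs.trans (setIntegral_mono_on
      (h.integrableOn_integral_secondDiff_mul hg).abs (integrableOn_const_mul_inv_one_add_sq _)
      measurableSet_Ioi fun y hy => ?_)
    rw [abs_div, abs_of_nonneg (sq_nonneg y)]
    refine le_trans ?_ (h.integral_abs_secondDiff_mul_le hg hy)
    gcongr
    exact abs_integral_le_integral_abs
  calc _ ≤ 1 / Real.pi * (((l2norm ddw + 4 * l2norm w) * l2norm g) * Real.pi) := by gcongr
    _ = _ := by field_simp

end

/-! ### The Hilbert transform of Lipschitz functions in `L²` -/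

theorem tendsto_integral_Ioi_nhdsGT_zero {g : ℝ → ℝ} (hg : IntegrableOn g (Set.Ioi 0)) :
    Tendsto (fun ε => ∫ y in Set.Ioi ε, g y) (𝓝[>] 0) (𝓝 (∫ y in Set.Ioi 0, g y)) := by
  have hcov : AECover ((volume : Measure ℝ).restrict (Set.Ioi 0)) (𝓝[>] (0 : ℝ))
      (fun ε => Set.Ioi ε) :=
    aecover_Ioi_of_Ioi (tendsto_id.mono_left nhdsWithin_le_nhds)
  refine (hcov.integral_tendsto_of_countably_generated hg).congr' ?_
  filter_upwards [self_mem_nhdsWithin] with ε hε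
  rw [Measure.restrict_restrict measurableSet_Ioi,
    Set.inter_eq_left.2 (Set.Ioi_subset_Ioi (le_of_lt hε))]

theorem memLp_inv_restrict {ε : ℝ} (hε : 0 < ε) {T : Set ℝ} (hT : MeasurableSet T)
    (hTε : ∀ y ∈ T, ε ≤ |y|) : MemLp (fun y : ℝ => y⁻¹) 2 (volume.restrict T) := by
  rw [memLp_two_iff_integrable_sq measurable_inv.aestronglyMeasurable]
  refine Integrable.mono' ((integrable_inv_one_add_sq.const_mul (1 + (ε ^ 2)⁻¹)).restrict)
    (measurable_inv.pow_const 2).aestronglyMeasurable ?_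
  refine (ae_restrict_iff' hT).2 (Eventually.of_forall fun y hy => ?_)
  have h1 : ε ^ 2 ≤ y ^ 2 := by
    rw [← sq_abs y]
    exact pow_le_pow_left₀ hε.le (hTε y hy) 2
  have hy0 : 0 < y ^ 2 := lt_of_lt_of_le (by positivity) h1
  rw [Real.norm_of_nonneg (sq_nonneg _), ← div_eq_mul_inv, le_div_iff₀ (by positivity), inv_pow]
  have h2 : (y ^ 2)⁻¹ ≤ (ε ^ 2)⁻¹ := inv_anti₀ (by positivity) h1
  have h3 : (y ^ 2)⁻¹ * y ^ 2 = 1 := inv_mul_cancel₀ hy0.ne'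
  nlinarith

theorem memLp_reflect {f : ℝ → ℝ} (hf : MemLp f 2) (x : ℝ) : MemLp (fun y => f (x - y)) 2 :=
  hf.comp_measurePreserving (Measure.measurePreserving_sub_left volume x)

theorem memLp_translate_left {f : ℝ → ℝ} (hf : MemLp f 2) (x : ℝ) : MemLp (fun y => f (x + y)) 2 :=
  hf.comp_measurePreserving (measurePreserving_add_left volume x)

section
variable {f : ℝ → ℝ} {M : ℝ}

theorem integrableOn_div_of_memLp {g : ℝ → ℝ} (hg : MemLp g 2) {ε : ℝ} (hε : 0 < ε) {T : Set ℝ}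
    (hT : MeasurableSet T) (hTε : ∀ y ∈ T, ε ≤ |y|) : IntegrableOn (fun y => g y / y) T :=
  (hg.restrict T).integrable_mul (memLp_inv_restrict hε hT hTε)

theorem abs_oddDiff_div_le (hlip : ∀ a b, |f b - f a| ≤ M * |b - a|) (x : ℝ) {y : ℝ} (hy : 0 < y) :
    |(f (x - y) - f (x + y)) / y| ≤ 2 * M := by
  have h := hlip (x + y) (x - y)
  rw [abs_div, abs_of_pos hy, div_le_iff₀ hy]
  have e : |x - y - (x + y)| = 2 * y := by
    rw [show x - y - (x + y) = -(2 * y) by ring, abs_neg, abs_of_pos (by positivity)]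
  rw [e] at h
  linarith

theorem integrableOn_oddDiff_div (hc : Continuous f) (hlip : ∀ a b, |f b - f a| ≤ M * |b - a|)
    (hf : MemLp f 2) (x : ℝ) :
    IntegrableOn (fun y => (f (x - y) - f (x + y)) / y) (Set.Ioi 0) := by
  rw [← Set.Ioc_union_Ioi_eq_Ioi (zero_le_one (α := ℝ))]
  refine IntegrableOn.union ?_ ?_
  · refine Integrable.mono' (integrable_const (2 * M)) ?_ ?_
    · exact (((hc.comp (continuous_const.sub continuous_id)).sub
        (hc.comp (continuous_const.add continuous_id))).measurable.div
          measurable_id).aestronglyMeasurable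
    · exact (ae_restrict_iff' measurableSet_Ioc).2 (Eventually.of_forall fun y hy =>
        abs_oddDiff_div_le hlip x hy.1)
  · exact integrableOn_div_of_memLp ((memLp_reflect hf x).sub (memLp_translate_left hf x))
      zero_lt_one measurableSet_Ioi fun y hy => (le_of_lt hy).trans (le_abs_self y)

/-- Uniformity in `x` is what Fubini over a bounded interval of `x` requires in
`IsH2Jet.hilbert_sub_eq_integral`. -/
theorem exists_integral_abs_oddDiff_div_le (hc : Continuous f)
    (hlip : ∀ a b, |f b - f a| ≤ M * |b - a|) (hf : MemLp f 2) :
    ∃ C, ∀ x, ∫ y in Set.Ioi (0 : ℝ), |(f (x - y) - f (x + y)) / y| ≤ C := by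
  refine ⟨2 * M + (2 * l2norm f) * √(∫ y in Set.Ioi (1 : ℝ), (y⁻¹) ^ 2), fun x => ?_⟩
  have hi : IntegrableOn (fun y => |(f (x - y) - f (x + y)) / y|) (Set.Ioi 0) :=
    (integrableOn_oddDiff_div hc hlip hf x).abs
  have hsplit : Set.Ioi (0 : ℝ) = Set.Ioc 0 1 ∪ Set.Ioi 1 :=
    (Set.Ioc_union_Ioi_eq_Ioi (zero_le_one (α := ℝ))).symm
  rw [hsplit] at hi ⊢
  rw [setIntegral_union (Set.Ioc_disjoint_Ioi le_rfl) measurableSet_Ioi hi.left_of_union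
    hi.right_of_union]
  have m1 : MemLp (fun y => f (x - y) - f (x + y)) 2 :=
    (memLp_reflect hf x).sub (memLp_translate_left hf x)
  refine add_le_add ?_ ?_
  · refine (setIntegral_mono_on hi.left_of_union (integrable_const (2 * M)) measurableSet_Ioc
      fun y hy => abs_oddDiff_div_le hlip x hy.1).trans ?_
    simp
  · have h := abs_integral_mul_le_sqrt_mul_sqrt (m1.restrict (Set.Ioi 1))
      (memLp_inv_restrict zero_lt_one measurableSet_Ioi
        fun y (hy : y ∈ Set.Ioi (1 : ℝ)) => (le_of_lt hy).trans (le_abs_self y))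
    refine h.trans (mul_le_mul_of_nonneg_right ?_ (Real.sqrt_nonneg _))
    have h1 : √(∫ y in Set.Ioi (1 : ℝ), (f (x - y) - f (x + y)) ^ 2) ≤
        l2norm (fun y => f (x - y) - f (x + y)) :=
      Real.sqrt_le_sqrt (setIntegral_le_integral m1.integrable_sq
        (Eventually.of_forall fun _ => sq_nonneg _))
    refine h1.trans ?_
    have h2 := l2norm_add_le (memLp_reflect hf x) (memLp_translate_left hf x).neg
    have e1 : l2norm (fun y => f (x - y)) = l2norm f := by
      simp only [l2norm]
      rw [integral_sub_left_eq_self (fun y => f y ^ 2) volume x]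
    have e2 : l2norm (-fun y => f (x + y)) = l2norm f := by
      refine (l2norm_neg _).trans ?_
      simpa only [add_comm] using l2norm_translate f x
    rw [e1, e2] at h2
    refine le_trans (le_of_eq ?_) (h2.trans (by linarith))
    congr 1

theorem integral_lt_abs_div_eq (hf : MemLp f 2) (x : ℝ) {ε : ℝ} (hε : 0 < ε) :
    ∫ y in {y : ℝ | ε < |y|}, f (x - y) / y =
      ∫ y in Set.Ioi ε, (f (x - y) - f (x + y)) / y := by
  have hset : {y : ℝ | ε < |y|} = Set.Iic (-ε) \ {-ε} ∪ Set.Ioi ε := by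
    ext y
    simp only [Set.mem_ofPred_eq, lt_abs, Set.mem_union, Set.mem_sdiff, Set.mem_Iic, Set.mem_Ioi,
      Set.mem_singleton_iff]
    constructor
    · rintro (h | h)
      · exact Or.inr h
      · exact Or.inl ⟨by linarith, by intro h'; linarith⟩
    · rintro (⟨h, h'⟩ | h)
      · exact Or.inr (by linarith [lt_of_le_of_ne h h'])
      · exact Or.inl h
  have hr := memLp_reflect hf x
  have i1 : IntegrableOn (fun y => f (x - y) / y) (Set.Iic (-ε)) :=
    integrableOn_div_of_memLp hr hε measurableSet_Iic fun y hy => by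
      rw [le_abs]; right; simp only [Set.mem_Iic] at hy; linarith
  have i2 : IntegrableOn (fun y => f (x - y) / y) (Set.Ioi ε) :=
    integrableOn_div_of_memLp hr hε measurableSet_Ioi fun y hy => (le_of_lt hy).trans (le_abs_self y)
  have i3 : IntegrableOn (fun y => f (x + y) / y) (Set.Ioi ε) :=
    integrableOn_div_of_memLp (memLp_translate_left hf x) hε measurableSet_Ioi
      fun y hy => (le_of_lt hy).trans (le_abs_self y)
  rw [hset, setIntegral_union ?_ measurableSet_Ioi (i1.mono_set Set.sdiff_subset) i2]
  · have e1 : ∫ y in Set.Iic (-ε) \ {-ε}, f (x - y) / y = ∫ y in Set.Iic (-ε), f (x - y) / y := by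
      refine setIntegral_congr_set ?_
      rw [Set.Iic_sdiff_right]
      exact Iio_ae_eq_Iic
    have e2 : ∫ y in Set.Iic (-ε), f (x - y) / y = ∫ y in Set.Ioi ε, -(f (x + y) / y) := by
      rw [← integral_comp_neg_Ioi]
      congr 1
      ext y
      rw [sub_neg_eq_add, div_neg]
    rw [e1, e2, integral_neg, neg_add_eq_sub, ← integral_sub i2 i3]
    congr 1
    ext y
    rw [sub_div]
  · refine Set.disjoint_left.2 fun y hy hy' => ?_
    have h1 : y ≤ -ε := hy.1
    have h2 : ε < y := hy'
    linarith

/-- Folding `y` and `-y` together makes the principal value absolutely convergent: the quotient is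
bounded near 0 by the Lipschitz condition, and at infinity it is a product of two `L²` functions. -/
theorem hilbert_eq (hc : Continuous f) (hlip : ∀ a b, |f b - f a| ≤ M * |b - a|)
    (hf : MemLp f 2) (x : ℝ) :
    hilbert f x = 1 / Real.pi * ∫ y in Set.Ioi (0 : ℝ), (f (x - y) - f (x + y)) / y := by
  refine Tendsto.limUnder_eq ?_
  refine (((tendsto_integral_Ioi_nhdsGT_zero
    (integrableOn_oddDiff_div hc hlip hf x)).const_mul (1 / Real.pi))).congr' ?_
  filter_upwards [self_mem_nhdsWithin] with ε hε
  rw [integral_lt_abs_div_eq hf x hε]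

end

section
variable {w dw ddw : ℝ → ℝ}

theorem hasDerivAt_secondDiff (hw : ∀ x, HasDerivAt w (dw x) x) (x y : ℝ) :
    HasDerivAt (fun y => secondDiff w y x) (dw (x - y) - dw (x + y)) y := by
  have h1 : HasDerivAt (fun y => w (x + y)) (dw (x + y)) y := (hw (x + y)).comp_const_add x y
  have h2 : HasDerivAt (fun y => w (x - y)) (-dw (x - y)) y := (hw (x - y)).comp_const_sub x y
  have := ((hasDerivAt_const y (2 * w x)).sub h1).sub h2
  refine this.congr_deriv ?_
  ring

theorem IsH2Jet.exists_abs_secondDiff_le (h : IsH2Jet w dw ddw) :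
    ∃ M, 0 ≤ M ∧ ∀ x y, |secondDiff w y x| ≤ M ∧ (0 ≤ y → |secondDiff w y x| ≤ M * y ^ 2) := by
  obtain ⟨M, hM, hw, -, -, hlip⟩ := h.exists_lipschitz
  refine ⟨4 * M, by positivity, fun x y => ⟨?_, fun hy => ?_⟩⟩
  · have h1 := abs_le.1 (hw x)
    have h2 := abs_le.1 (hw (x + y))
    have h3 := abs_le.1 (hw (x - y))
    rw [secondDiff, abs_le]
    constructor <;> linarith [h1.1, h1.2, h2.1, h2.2, h3.1, h3.2]
  · have hc := h.continuous_deriv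
    have e : secondDiff w y x = ∫ s in (0 : ℝ)..y, (dw (x - s) - dw (x + s)) := by
      rw [intervalIntegral.integral_eq_sub_of_hasDerivAt
        (fun s _ => hasDerivAt_secondDiff h.hasDerivAt x s)
        (Continuous.intervalIntegrable (by fun_prop) _ _)]
      simp [secondDiff]
      ring
    have hb : ∀ s ∈ Set.uIoc 0 y, ‖dw (x - s) - dw (x + s)‖ ≤ 2 * M * y := by
      intro s hs
      rw [Set.uIoc_of_le hy] at hs
      refine (hlip (x + s) (x - s)).trans ?_
      rw [show x - s - (x + s) = -(2 * s) by ring, abs_neg, abs_of_nonneg (by linarith [hs.1])]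
      nlinarith [hs.1, hs.2]
    rw [e]
    refine (intervalIntegral.norm_integral_le_of_norm_le_const hb).trans ?_
    rw [sub_zero, abs_of_nonneg hy]
    nlinarith [mul_nonneg hM (sq_nonneg y)]

theorem IsH2Jet.integrableOn_secondDiff_div_sq (h : IsH2Jet w dw ddw) (x : ℝ) :
    IntegrableOn (fun y => secondDiff w y x / y ^ 2) (Set.Ioi 0) := by
  obtain ⟨M, hM, hb⟩ := h.exists_abs_secondDiff_le
  have hm : Measurable fun y => secondDiff w y x / y ^ 2 :=
    ((continuous_secondDiff h.continuous).comp (by fun_prop : Continuous fun y : ℝ =>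
      (x, y))).measurable.div (measurable_id.pow_const 2)
  refine Integrable.mono' (integrableOn_const_mul_inv_one_add_sq (2 * M)) hm.aestronglyMeasurable ?_
  refine (ae_restrict_iff' measurableSet_Ioi).2 (Eventually.of_forall fun y hy => ?_)
  rw [Real.norm_eq_abs, abs_div, abs_of_nonneg (sq_nonneg y)]
  exact div_sq_le_of_le hy ((hb x y).2 (le_of_lt hy)) (hb x y).1

theorem IsH2Jet.continuous_fracLap (h : IsH2Jet w dw ddw) : Continuous (fracLap w) := by
  obtain ⟨M, hM, hb⟩ := h.exists_abs_secondDiff_le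
  refine continuous_const.mul (continuous_of_dominated
    (bound := fun y => 2 * M * (1 + y ^ 2)⁻¹) (fun x => ?_) (fun x => ?_)
    (integrableOn_const_mul_inv_one_add_sq _) (Eventually.of_forall fun y => ?_))
  · exact (h.integrableOn_secondDiff_div_sq x).aestronglyMeasurable
  · refine (ae_restrict_iff' measurableSet_Ioi).2 (Eventually.of_forall fun y hy => ?_)
    rw [Real.norm_eq_abs, abs_div, abs_of_nonneg (sq_nonneg y)]
    exact div_sq_le_of_le hy ((hb x y).2 (le_of_lt hy)) (hb x y).1
  · exact ((continuous_secondDiff h.continuous).comp (by fun_prop : Continuous fun x : ℝ =>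
      (x, y))).div_const _

/-- Integration by parts in `y`: the numerator on the left is the `y`-derivative of the second
difference. The boundary term is `O(y)` at 0 and `O(1/y)` at infinity. -/
theorem IsH2Jet.integral_oddDiff_div_eq (h : IsH2Jet w dw ddw) (x : ℝ) :
    ∫ y in Set.Ioi (0 : ℝ), (dw (x - y) - dw (x + y)) / y =
      ∫ y in Set.Ioi (0 : ℝ), secondDiff w y x / y ^ 2 := by
  obtain ⟨M, hM, -, -, -, hlip⟩ := h.exists_lipschitz
  obtain ⟨M', hM', hb⟩ := h.exists_abs_secondDiff_le
  have i1 := integrableOn_oddDiff_div h.continuous_deriv hlip h.memLp_deriv x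
  have i2 := h.integrableOn_secondDiff_div_sq x
  have hlim : Tendsto (fun y => secondDiff w y x / y) atTop (𝓝 0) := by
    have h0 : Tendsto (fun y : ℝ => M' / y) atTop (𝓝 0) := tendsto_const_nhds.div_atTop tendsto_id
    refine squeeze_zero_norm' ?_ h0
    filter_upwards [eventually_gt_atTop 0] with y hy
    rw [Real.norm_eq_abs, abs_div, abs_of_pos hy]
    have := (hb x y).1
    gcongr
  -- At `y = 0` the convention `a / 0 = 0` gives exactly the limit value.
  have hcont : ContinuousWithinAt (fun y => secondDiff w y x / y) (Set.Ici 0) 0 := by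
    have h0 : Tendsto (fun y : ℝ => M' * y) (𝓝[≥] 0) (𝓝 0) := by
      have : Continuous fun y : ℝ => M' * y := by fun_prop
      simpa using (this.tendsto 0).mono_left (nhdsWithin_le_nhds (s := Set.Ici 0))
    rw [ContinuousWithinAt, div_zero]
    refine squeeze_zero_norm' ?_ h0
    filter_upwards [self_mem_nhdsWithin] with y hy
    rcases eq_or_lt_of_le (show (0 : ℝ) ≤ y from hy) with rfl | hy
    · simp
    rw [Real.norm_eq_abs, abs_div, abs_of_pos hy, div_le_iff₀ hy]
    refine ((hb x y).2 hy.le).trans (le_of_eq (by ring))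
  have := integral_Ioi_of_hasDerivAt_of_tendsto (a := 0) (m := 0)
    (f := fun y => secondDiff w y x / y)
    (f' := fun y => (dw (x - y) - dw (x + y)) / y - secondDiff w y x / y ^ 2) hcont
    (fun y hy => by
      have hy' : y ≠ 0 := ne_of_gt hy
      refine ((hasDerivAt_secondDiff h.hasDerivAt x y).div (hasDerivAt_id y) hy').congr_deriv ?_
      simp only [id]
      field_simp) (i1.sub i2) hlim
  rw [integral_sub i1 i2, div_zero, sub_zero] at this
  linarith

theorem IsH2Jet.hilbert_deriv_eq (h : IsH2Jet w dw ddw) (x : ℝ) : hilbert dw x = fracLap w x := by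
  obtain ⟨M, hM, -, -, -, hlip⟩ := h.exists_lipschitz
  rw [hilbert_eq h.continuous_deriv hlip h.memLp_deriv, h.integral_oddDiff_div_eq, fracLap]

/-- Integrating `H(w_x)` over the interval and swapping the integrals recovers `H w`. Together with
continuity of `fracLap w` this yields the pointwise derivative of `H w`. -/
theorem IsH2Jet.hilbert_sub_eq_integral (h : IsH2Jet w dw ddw) {a b : ℝ} (hab : a ≤ b) :
    hilbert w b - hilbert w a = ∫ t in a..b, fracLap w t := by
  obtain ⟨M, hM, -, -, hlip, hlip'⟩ := h.exists_lipschitz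
  obtain ⟨C, hC⟩ := exists_integral_abs_oddDiff_div_le h.continuous_deriv hlip' h.memLp_deriv
  have hcw := h.continuous
  have hcd := h.continuous_deriv
  have hi := fun x => integrableOn_oddDiff_div h.continuous_deriv hlip' h.memLp_deriv x
  set μ := (volume : Measure ℝ).restrict (Set.Ioc a b) with hμ
  set ν := (volume : Measure ℝ).restrict (Set.Ioi 0) with hν
  have hprod : Integrable (fun p : ℝ × ℝ => (dw (p.1 - p.2) - dw (p.1 + p.2)) / p.2) (μ.prod ν) := by
    have hms : AEStronglyMeasurable (fun p : ℝ × ℝ => (dw (p.1 - p.2) - dw (p.1 + p.2)) / p.2)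
        (μ.prod ν) := by
      have : Continuous fun p : ℝ × ℝ => dw (p.1 - p.2) - dw (p.1 + p.2) := by fun_prop
      exact (this.measurable.div measurable_snd).aestronglyMeasurable
    rw [integrable_prod_iff hms]
    refine ⟨Eventually.of_forall fun t => hi t, ?_⟩
    refine Integrable.mono' (integrable_const C) hms.norm.integral_prod_right'
      (Eventually.of_forall fun t => ?_)
    rw [Real.norm_of_nonneg (integral_nonneg fun _ => norm_nonneg _)]
    exact hC t
  have e1 : ∀ t, fracLap w t = 1 / Real.pi * ∫ y, (dw (t - y) - dw (t + y)) / y ∂ν := fun t => by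
    rw [hν, h.integral_oddDiff_div_eq, fracLap]
  have e2 : ∀ y, ∫ t, (dw (t - y) - dw (t + y)) / y ∂μ =
      (w (b - y) - w (b + y)) / y - (w (a - y) - w (a + y)) / y := fun y => by
    rw [integral_div, hμ, ← intervalIntegral.integral_of_le hab,
      intervalIntegral.integral_eq_sub_of_hasDerivAt (f := fun t => w (t - y) - w (t + y))
        (fun t _ => ((h.hasDerivAt (t - y)).comp_sub_const t y).sub
          ((h.hasDerivAt (t + y)).comp_add_const t y))
        (Continuous.intervalIntegrable (by fun_prop) _ _)]
    ring
  rw [intervalIntegral.integral_of_le hab]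
  simp only [e1]
  rw [integral_const_mul, integral_integral_swap
    (f := fun t y => (dw (t - y) - dw (t + y)) / y) hprod]
  simp only [e2]
  rw [integral_sub (integrableOn_oddDiff_div hcw hlip h.memLp b)
    (integrableOn_oddDiff_div hcw hlip h.memLp a), mul_sub, hilbert_eq hcw hlip h.memLp,
    hilbert_eq hcw hlip h.memLp]

theorem IsH2Jet.hasDerivAt_hilbert (h : IsH2Jet w dw ddw) (x : ℝ) :
    HasDerivAt (hilbert w) (fracLap w x) x := by
  have hc := h.continuous_fracLap
  have h1 : HasDerivAt (fun t => hilbert w (x - 1) + ∫ s in (x - 1)..t, fracLap w s)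
      (fracLap w x) x :=
    (intervalIntegral.integral_hasDerivAt_right (hc.intervalIntegrable _ _)
      (hc.stronglyMeasurableAtFilter _ _) hc.continuousAt).const_add _
  refine h1.congr_of_eventuallyEq ?_
  filter_upwards [Ioi_mem_nhds (show x - 1 < x by linarith)] with t ht
  rw [← h.hilbert_sub_eq_integral (le_of_lt ht)]
  ring

end

/-! ### Properties of the cut-off -/

theorem memLp_mul_of_bounded {b f : ℝ → ℝ} {C : ℝ} (hb : Continuous b) (hC : ∀ x, |b x| ≤ C)
    (hf : MemLp f 2) : MemLp (fun x => b x * f x) 2 :=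
  hf.of_le_mul (c := C) (hb.aestronglyMeasurable.mul hf.aestronglyMeasurable)
    (Eventually.of_forall fun x => by
      rw [norm_mul]
      exact mul_le_mul_of_nonneg_right (hC x) (norm_nonneg _))

namespace IsCutoff
variable {R : ℝ} {φ : ℝ → ℝ}

theorem hasDerivAt (h : IsCutoff R φ) (x : ℝ) : HasDerivAt φ (deriv φ x) x :=
  (h.smooth.differentiable (by simp) x).hasDerivAt

theorem hasDerivAt_deriv (h : IsCutoff R φ) (x : ℝ) :
    HasDerivAt (deriv φ) (deriv (deriv φ) x) x :=
  ((h.smooth.iterate_deriv 1).differentiable (by simp) x).hasDerivAt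

theorem hasDerivAt_deriv2 (h : IsCutoff R φ) (x : ℝ) :
    HasDerivAt (deriv (deriv φ)) (deriv (deriv (deriv φ)) x) x :=
  ((h.smooth.iterate_deriv 2).differentiable (by simp) x).hasDerivAt

theorem continuous (h : IsCutoff R φ) : Continuous φ := h.smooth.continuous

theorem continuous_deriv (h : IsCutoff R φ) : Continuous (deriv φ) :=
  (h.smooth.iterate_deriv 1).continuous

theorem continuous_deriv2 (h : IsCutoff R φ) : Continuous (deriv (deriv φ)) :=
  (h.smooth.iterate_deriv 2).continuous

theorem abs_le (h : IsCutoff R φ) (x : ℝ) : |φ x| ≤ 2 + 2 * R := by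
  rw [abs_of_nonneg (by linarith [h.one_le x])]
  exact h.le_bound x

theorem abs_deriv_le (h : IsCutoff R φ) (x : ℝ) : |deriv φ x| ≤ 1 := by
  rw [abs_of_nonneg (h.deriv_nonneg x)]
  exact h.deriv_le_one x

theorem exists_bounds (h : IsCutoff R φ) : ∃ c : ℝ, 1 ≤ c ∧
    (∀ a b, |√(deriv φ b) - √(deriv φ a)| ≤ c * |b - a|) ∧
    (∀ x, |deriv (deriv φ) x| ≤ c) ∧ ∀ x, |deriv (deriv (deriv φ)) x| ≤ c := by
  have hs : HasCompactSupport (deriv φ) :=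
    HasCompactSupport.intro (isCompact_Icc (a := -(R + 1)) (b := R + 1)) fun x hx =>
      h.deriv_eq_zero x (by
        by_contra! hlt
        exact hx (Set.mem_Icc.2 (_root_.abs_le.1 hlt.le)))
  obtain ⟨c1, hc1⟩ := (hs.deriv).exists_bound_of_continuous h.continuous_deriv2
  obtain ⟨c2, hc2⟩ := (hs.deriv.deriv).exists_bound_of_continuous
    (h.smooth.iterate_deriv 3).continuous
  have hgd : Differentiable ℝ fun x => √(deriv φ x) := h.sqrt_smooth.differentiable (by simp)
  obtain ⟨c3, hc3⟩ := (h.sqrt_compact.deriv).exists_bound_of_continuous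
    (h.sqrt_smooth.iterate_deriv 1).continuous
  have p1 := (norm_nonneg _).trans (hc1 0)
  have p2 := (norm_nonneg _).trans (hc2 0)
  have p3 := (norm_nonneg _).trans (hc3 0)
  refine ⟨1 + c1 + c2 + c3, by linarith, fun a b => ?_, fun x => ?_, fun x => ?_⟩
  · have := Convex.norm_image_sub_le_of_norm_deriv_le (f := fun x => √(deriv φ x)) (C := c3)
      (fun x _ => hgd x) (fun x _ => hc3 x) convex_univ (Set.mem_univ a) (Set.mem_univ b)
    refine this.trans (mul_le_mul_of_nonneg_right (by linarith) (abs_nonneg _))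
  · exact (hc1 x).trans (by linarith)
  · exact (hc2 x).trans (by linarith)

theorem sqrt_deriv_sq (h : IsCutoff R φ) (x : ℝ) : √(deriv φ x) ^ 2 = deriv φ x :=
  Real.sq_sqrt (h.deriv_nonneg x)

theorem sqrt_deriv_le_one (h : IsCutoff R φ) (x : ℝ) : √(deriv φ x) ≤ 1 :=
  Real.sqrt_le_one.2 (h.deriv_le_one x)

theorem translate_sub_mem_Icc (h : IsCutoff R φ) (x : ℝ) {y : ℝ} (hy : 0 ≤ y) :
    φ (x + y) - φ x ∈ Set.Icc 0 y := by
  have hd : Differentiable ℝ φ := fun x => (h.hasDerivAt x).differentiableAt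
  constructor
  · exact sub_nonneg.2 (monotone_of_deriv_nonneg hd h.deriv_nonneg (by linarith))
  · have := Convex.norm_image_sub_le_of_norm_deriv_le (f := φ) (C := 1)
      (fun x _ => hd x) (fun x _ => h.abs_deriv_le x) convex_univ (Set.mem_univ x)
      (Set.mem_univ (x + y))
    rw [add_sub_cancel_left, Real.norm_of_nonneg hy, one_mul] at this
    exact (le_abs_self _).trans this

theorem abs_sub_sub_mul_le (h : IsCutoff R φ) {c : ℝ} (hc : ∀ x, |deriv (deriv φ) x| ≤ c)
    (x t : ℝ) : |φ (x + t) - φ x - t * deriv φ x| ≤ c * t ^ 2 := by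
  have h1 : ∀ s ∈ Set.uIcc 0 t, ‖deriv φ (x + s) - deriv φ x‖ ≤ c * |t| := by
    intro s hs
    have := Convex.norm_image_sub_le_of_norm_deriv_le (f := deriv φ) (C := c)
      (fun x _ => (h.hasDerivAt_deriv x).differentiableAt) (fun x _ => hc x) convex_univ
      (Set.mem_univ x) (Set.mem_univ (x + s))
    refine this.trans (mul_le_mul_of_nonneg_left ?_ ((abs_nonneg _).trans (hc 0)))
    rw [add_sub_cancel_left, Real.norm_eq_abs]
    have := Set.abs_sub_left_of_mem_uIcc hs
    simpa using this
  have h2 := Convex.norm_image_sub_le_of_norm_hasDerivWithin_le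
    (f := fun s => φ (x + s) - s * deriv φ x) (f' := fun s => deriv φ (x + s) - deriv φ x)
    (fun s _ => (((h.hasDerivAt (x + s)).comp_const_add x s).sub
      ((hasDerivAt_id s).mul_const _)).hasDerivWithinAt.congr_deriv (by simp)) h1
    (convex_uIcc 0 t) Set.left_mem_uIcc Set.right_mem_uIcc
  simp only [Real.norm_eq_abs, sub_zero, add_zero, zero_mul] at h2
  calc _ = |φ (x + t) - t * deriv φ x - φ x| := by ring_nf
    _ ≤ c * |t| * |t| := h2
    _ = c * t ^ 2 := by rw [mul_assoc, abs_mul_abs_self, sq]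

/-- The left side is twice the error of the trapezoidal rule for `φ'`. Its derivative in `y` is a
first order Taylor remainder of `φ'`, hence `O(y²)`. -/
theorem abs_trapezoid_le (h : IsCutoff R φ) {c : ℝ} (hc : ∀ x, |deriv (deriv (deriv φ)) x| ≤ c)
    (x : ℝ) {y : ℝ} (hy : 0 ≤ y) :
    |y * (deriv φ x + deriv φ (x + y)) - 2 * (φ (x + y) - φ x)| ≤ c * y ^ 2 * y := by
  have hc0 : 0 ≤ c := (abs_nonneg _).trans (hc 0)
  have lip : ∀ a b, |deriv (deriv φ) b - deriv (deriv φ) a| ≤ c * |b - a| := fun a b =>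
    Convex.norm_image_sub_le_of_norm_deriv_le (f := deriv (deriv φ)) (C := c)
      (fun x _ => (h.hasDerivAt_deriv2 x).differentiableAt) (fun x _ => hc x) convex_univ
      (Set.mem_univ a) (Set.mem_univ b)
  have h1 : ∀ s ∈ Set.Icc 0 y,
      ‖deriv φ x - deriv φ (x + s) + s * deriv (deriv φ) (x + s)‖ ≤ c * y ^ 2 := by
    intro s hs
    have h2 := Convex.norm_image_sub_le_of_norm_hasDerivWithin_le
      (f := fun t => deriv φ (x + t) - t * deriv (deriv φ) (x + s))
      (f' := fun t => deriv (deriv φ) (x + t) - deriv (deriv φ) (x + s)) (C := c * s)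
      (s := Set.Icc 0 s)
      (fun t _ => (((h.hasDerivAt_deriv (x + t)).comp_const_add x t).sub
        ((hasDerivAt_id t).mul_const _)).hasDerivWithinAt.congr_deriv (by simp))
      (fun t ht => by
        refine (lip _ _).trans (mul_le_mul_of_nonneg_left ?_ hc0)
        rw [_root_.abs_le]
        constructor <;> linarith [ht.1, ht.2])
      (convex_Icc 0 s) (Set.left_mem_Icc.2 hs.1) (Set.right_mem_Icc.2 hs.1)
    simp only [Real.norm_eq_abs, sub_zero, add_zero, zero_mul] at h2 ⊢
    rw [abs_of_nonneg hs.1] at h2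
    calc _ = |deriv φ (x + s) - s * deriv (deriv φ) (x + s) - deriv φ x| := by
          rw [← abs_neg]; ring_nf
      _ ≤ c * s * s := h2
      _ ≤ c * y ^ 2 := by
        have := mul_le_mul hs.2 hs.2 hs.1 hy
        nlinarith
  have h2 := Convex.norm_image_sub_le_of_norm_hasDerivWithin_le
    (f := fun s => s * (deriv φ x + deriv φ (x + s)) - 2 * (φ (x + s) - φ x))
    (f' := fun s => deriv φ x - deriv φ (x + s) + s * deriv (deriv φ) (x + s))
    (s := Set.Icc 0 y)
    (fun s _ => (((hasDerivAt_id s).mul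
      ((((h.hasDerivAt_deriv (x + s)).comp_const_add x s)).const_add _)).sub
      ((((h.hasDerivAt (x + s)).comp_const_add x s).sub_const _).const_mul
        2)).hasDerivWithinAt.congr_deriv (by simp only [id]; ring)) h1
    (convex_Icc 0 y) (Set.left_mem_Icc.2 hy) (Set.right_mem_Icc.2 hy)
  simp only [Real.norm_eq_abs, sub_zero, add_zero, zero_mul, sub_self, mul_zero] at h2
  rwa [abs_of_nonneg hy] at h2

end IsCutoff

theorem IsH2Jet.mul_cutoff {R : ℝ} {φ w dw ddw : ℝ → ℝ} (hφ : IsCutoff R φ)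
    (h : IsH2Jet w dw ddw) :
    IsH2Jet (fun x => φ x * w x) (fun x => deriv φ x * w x + φ x * dw x)
      (fun x => (deriv (deriv φ) x * w x + deriv φ x * dw x) +
        (deriv φ x * dw x + φ x * ddw x)) := by
  obtain ⟨c, hc1, -, hc2, -⟩ := hφ.exists_bounds
  obtain ⟨M, hM, hb⟩ := h.bounded
  obtain ⟨s, hs, hds⟩ := h.hasDerivAt_deriv
  have m00 := memLp_mul_of_bounded hφ.continuous hφ.abs_le h.memLp
  have m10 := memLp_mul_of_bounded hφ.continuous_deriv hφ.abs_deriv_le h.memLp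
  have m01 := memLp_mul_of_bounded hφ.continuous hφ.abs_le h.memLp_deriv
  have m20 := memLp_mul_of_bounded hφ.continuous_deriv2 hc2 h.memLp
  have m11 := memLp_mul_of_bounded hφ.continuous_deriv hφ.abs_deriv_le h.memLp_deriv
  have m02 := memLp_mul_of_bounded hφ.continuous hφ.abs_le h.memLp_deriv2
  have hR : 0 ≤ 2 + 2 * R := (abs_nonneg _).trans (hφ.abs_le 0)
  have hcw := h.continuous
  have hcd := h.continuous_deriv
  have k1 := hφ.continuous
  have k2 := hφ.continuous_deriv
  refine ⟨fun x => (hφ.hasDerivAt x).mul (h.hasDerivAt x), by fun_prop,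
    ⟨s, hs, fun x hx => ((hφ.hasDerivAt_deriv x).mul (h.hasDerivAt x)).add
      ((hφ.hasDerivAt x).mul (hds x hx))⟩, m00, m10.add m01, (m20.add m11).add (m11.add m02), ?_⟩
  have bd : ∀ {a b A : ℝ}, |a| ≤ A → |b| ≤ M → |a * b| ≤ A * M := fun {a b A} ha hb => by
    rw [abs_mul]
    exact mul_le_mul ha hb (abs_nonneg _) ((abs_nonneg _).trans ha)
  refine ⟨(c * M + 1 * M) + (1 * M + (2 + 2 * R) * M), by positivity, fun x => ?_⟩
  obtain ⟨b0, b1, b2⟩ := hb x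
  have q1 : 0 ≤ (2 + 2 * R) * M := mul_nonneg hR hM
  have q2 : 0 ≤ c * M := by positivity
  refine ⟨?_, ?_, ?_⟩
  · have := bd (hφ.abs_le x) b0
    linarith
  · have e1 := bd (hφ.abs_deriv_le x) b0
    have e2 := bd (hφ.abs_le x) b1
    have := abs_add_le (deriv φ x * w x) (φ x * dw x)
    linarith
  · have e1 := bd (hc2 x) b0
    have e2 := bd (hφ.abs_deriv_le x) b1
    have e3 := bd (hφ.abs_le x) b2
    refine (abs_add_le _ _).trans (add_le_add ((abs_add_le _ _).trans (add_le_add e1 e2))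
      ((abs_add_le _ _).trans (add_le_add e2 e3)))

/-! ### Differentiating correlations -/

/-- Fubini writes the increment as an integral of the candidate derivative. That candidate is
Lipschitz in `y` by the translation estimate for `dk`, so the fundamental theorem of calculus
applies. -/
theorem hasDerivAt_correlation {f k dk ddk : ℝ → ℝ} (hf : MemLp f 2) (h : IsH2Jet k dk ddk)
    (y : ℝ) :
    HasDerivAt (fun y => ∫ x, f x * k (x + y)) (∫ x, f x * dk (x + y)) y := by
  set c1 : ℝ → ℝ := fun y => ∫ x, f x * dk (x + y) with hc1
  have hi : ∀ y, Integrable fun x => f x * k (x + y) := fun y =>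
    integrable_mul_of_memLp_two hf (memLp_translate h.memLp y)
  have hi' : ∀ y, Integrable fun x => f x * dk (x + y) := fun y =>
    integrable_mul_of_memLp_two hf (memLp_translate h.memLp_deriv y)
  have hle : ∀ a b, a ≤ b → |c1 b - c1 a| ≤ l2norm f * l2norm ddk * (b - a) := by
    intro a b hab
    have e : c1 b - c1 a = ∫ x, f x * (dk (x + b) - dk (x + a)) := by
      simp only [hc1]
      rw [← integral_sub (hi' b) (hi' a)]
      simp only [mul_sub]
    have e2 : l2norm (fun x => dk (x + b) - dk (x + a)) =
        l2norm (fun x => dk (x + (b - a)) - dk x) := by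
      rw [← l2norm_translate (fun x => dk (x + (b - a)) - dk x) a]
      congr 1
      ext x
      ring_nf
    rw [e]
    refine (abs_integral_mul_le hf ((memLp_translate h.memLp_deriv b).sub
      (memLp_translate h.memLp_deriv a))).trans ?_
    have := l2norm_translate_sub_le h.memLp_deriv2 h.deriv_sub_eq_integral (sub_nonneg.2 hab)
    change l2norm f * l2norm (fun x => dk (x + b) - dk (x + a)) ≤ _
    rw [e2]
    calc _ ≤ l2norm f * ((b - a) * l2norm ddk) := mul_le_mul_of_nonneg_left this (l2norm_nonneg _)
      _ = _ := by ring
  have hcont : Continuous c1 := by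
    refine (LipschitzWith.of_dist_le_mul (K := (l2norm f * l2norm ddk).toNNReal) fun a b => ?_).continuous
    rw [Real.coe_toNNReal _ (mul_nonneg (l2norm_nonneg _) (l2norm_nonneg _)), Real.dist_eq,
      Real.dist_eq]
    rcases le_total a b with hab | hab
    · rw [abs_sub_comm, abs_sub_comm a b, abs_of_nonneg (sub_nonneg.2 hab)]
      exact hle a b hab
    · rw [abs_of_nonneg (sub_nonneg.2 hab)]
      exact hle b a hab
  have hint : ∀ a b, a ≤ b → (∫ x, f x * k (x + b)) - (∫ x, f x * k (x + a)) =
      ∫ t in a..b, c1 t := by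
    intro a b hab
    set μ := (volume : Measure ℝ).restrict (Set.Ioc a b) with hμ
    have hms : AEStronglyMeasurable (fun p : ℝ × ℝ => f p.1 * dk (p.1 + p.2)) (volume.prod μ) := by
      have m1 : AEStronglyMeasurable (fun p : ℝ × ℝ => f p.1) (volume.prod μ) :=
        hf.aestronglyMeasurable.comp_fst
      have m2 : Continuous (fun p : ℝ × ℝ => dk (p.1 + p.2)) := by
        have := h.continuous_deriv
        fun_prop
      exact m1.mul m2.aestronglyMeasurable
    have hprod : Integrable (fun p : ℝ × ℝ => f p.1 * dk (p.1 + p.2)) (volume.prod μ) := by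
      rw [integrable_prod_iff' hms]
      refine ⟨Eventually.of_forall hi', ?_⟩
      refine Integrable.mono' (integrable_const (l2norm f * l2norm dk))
        hms.norm.prod_swap.integral_prod_right' (Eventually.of_forall fun t => ?_)
      rw [Real.norm_of_nonneg (integral_nonneg fun _ => norm_nonneg _)]
      have := integral_abs_mul_le hf (memLp_translate h.memLp_deriv t)
      rwa [l2norm_translate] at this
    rw [← integral_sub (hi b) (hi a), intervalIntegral.integral_of_le hab]
    simp only [hc1]
    rw [← integral_integral_swap (f := fun x t => f x * dk (x + t)) hprod]
    congr 1
    ext x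
    rw [integral_const_mul, ← mul_sub, hμ, ← intervalIntegral.integral_of_le hab,
      intervalIntegral.integral_comp_add_left, h.sub_eq_integral]
  have h1 : HasDerivAt (fun t => (∫ x, f x * k (x + (y - 1))) + ∫ s in (y - 1)..t, c1 s)
      (c1 y) y :=
    (intervalIntegral.integral_hasDerivAt_right (hcont.intervalIntegrable _ _)
      (hcont.stronglyMeasurableAtFilter _ _) hcont.continuousAt).const_add _
  refine h1.congr_of_eventuallyEq ?_
  filter_upwards [Ioi_mem_nhds (show y - 1 < y by linarith)] with t ht
  rw [← hint _ _ (le_of_lt ht)]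
  ring

/-! ### The energy estimate -/

/-- Only the negative part of `J` needs control, so nonnegative squares in `J` can be dropped before
integrating. -/
theorem integral_div_sq_ge {J : ℝ → ℝ} {B ε : ℝ} (hε : 0 ≤ ε) (hB : 0 ≤ B)
    (hJ : IntegrableOn (fun y => J y / y ^ 2) (Set.Ioi ε))
    (h1 : ∀ y, 0 < y → -J y ≤ B * y ^ 2) (h2 : ∀ y, 0 < y → -J y ≤ B) :
    -(B * Real.pi) ≤ ∫ y in Set.Ioi ε, J y / y ^ 2 := by
  have hi : IntegrableOn (fun y : ℝ => 2 * B * (1 + y ^ 2)⁻¹) (Set.Ioi 0) :=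
    integrableOn_const_mul_inv_one_add_sq _
  have hsub : Set.Ioi ε ⊆ Set.Ioi 0 := Set.Ioi_subset_Ioi hε
  have hle : ∫ y in Set.Ioi ε, -(J y / y ^ 2) ≤ ∫ y in Set.Ioi ε, 2 * B * (1 + y ^ 2)⁻¹ := by
    refine setIntegral_mono_on hJ.neg (hi.mono_set hsub) measurableSet_Ioi fun y hy => ?_
    rw [← neg_div]
    have hy0 : 0 < y := hsub hy
    exact div_sq_le_of_le hy0 (h1 y hy0) (h2 y hy0)
  have hle2 : ∫ y in Set.Ioi ε, 2 * B * (1 + y ^ 2)⁻¹ ≤ ∫ y in Set.Ioi (0 : ℝ), 2 * B * (1 + y ^ 2)⁻¹ :=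
    setIntegral_mono_set hi (Eventually.of_forall fun y => by positivity)
      (LE.le.eventuallyLE hsub)
  rw [integral_const_mul_inv_one_add_sq] at hle2
  rw [integral_neg] at hle
  linarith

section
variable {R : ℝ} {φ w dw ddw : ℝ → ℝ} {c : ℝ}

theorem integral_sq_mul_le_of_abs_le {k : ℝ → ℝ} {B y : ℝ} (hw : MemLp w 2)
    (hB : ∀ x, |k x| ≤ B) :
    |∫ x, k x * (w x * w (x + y))| ≤ B * l2norm w ^ 2 := by
  have hB0 : 0 ≤ B := (abs_nonneg _).trans (hB 0)
  have hi := integrable_mul_of_memLp_two hw (memLp_translate hw y)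
  have h1 : ∫ x, |k x * (w x * w (x + y))| ≤ ∫ x, B * |w x * w (x + y)| := by
    refine integral_mono_of_nonneg (Eventually.of_forall fun _ => abs_nonneg _)
      (hi.abs.const_mul B) (Eventually.of_forall fun x => ?_)
    simp only
    rw [abs_mul]
    exact mul_le_mul_of_nonneg_right (hB x) (abs_nonneg _)
  have h2 := integral_abs_mul_le hw (memLp_translate hw y)
  rw [l2norm_translate] at h2
  rw [integral_const_mul] at h1
  calc _ ≤ _ := abs_integral_le_integral_abs
    _ ≤ _ := h1
    _ ≤ B * (l2norm w * l2norm w) := by gcongr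
    _ = _ := by ring

/-- Translating the half of the second difference that involves `x - y` gives the symmetric
Dirichlet form. -/
theorem integral_secondDiff_mul_eq {h : ℝ → ℝ} (hw : MemLp w 2) (hh : MemLp h 2) (y : ℝ) :
    ∫ x, secondDiff w y x * h x = ∫ x, (w x - w (x + y)) * (h x - h (x + y)) := by
  have hwy := memLp_translate hw y
  have hhy := memLp_translate hh y
  have hwm := memLp_translate hw (-y)
  have i1 : Integrable fun x => (w x - w (x + y)) * h x :=
    integrable_mul_of_memLp_two (hw.sub hwy) hh
  have i2 : Integrable fun x => (w x - w (x - y)) * h x :=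
    integrable_mul_of_memLp_two (hw.sub hwm) hh
  have i3 : Integrable fun x => (w (x + y) - w x) * h (x + y) :=
    integrable_mul_of_memLp_two (hwy.sub hw) hhy
  have e1 : ∫ x, (w x - w (x - y)) * h x = ∫ x, (w (x + y) - w x) * h (x + y) := by
    rw [← integral_add_right_eq_self (fun x => (w x - w (x - y)) * h x) y]
    simp only [add_sub_cancel_right]
  calc _ = ∫ x, ((w x - w (x + y)) * h x + (w x - w (x - y)) * h x) := by
        congr 1
        ext x
        rw [secondDiff]
        ring
    _ = _ := by
        rw [integral_add i1 i2, e1, ← integral_add i1 i3]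
        congr 1
        ext x
        ring

/-- With `g = √φ_x` and primes for the shift by `y`, `(w - w')(g² w - g'² w') = (g w - g' w')² - (g
- g')² w w'`. The square is dropped, and `(g - g')²` is at most `c² y²` and at most 1. This is where
smoothness of `√φ_x` enters. -/
theorem IsH2Jet.integral_fracLap_mul_deriv_cutoff_ge (hφ : IsCutoff R φ) (hc1 : 1 ≤ c)
    (hc : ∀ a b, |√(deriv φ b) - √(deriv φ a)| ≤ c * |b - a|) (h : IsH2Jet w dw ddw) :
    -(c ^ 2 * l2norm w ^ 2) ≤ ∫ x, fracLap w x * (deriv φ x * w x) := by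
  have hm := memLp_mul_of_bounded hφ.continuous_deriv hφ.abs_deriv_le h.memLp
  set g : ℝ → ℝ := fun x => √(deriv φ x) with hg
  have hgc : Continuous g := hφ.sqrt_smooth.continuous
  have hg1 : ∀ x, |g x| ≤ 1 := fun x => by
    rw [abs_of_nonneg (Real.sqrt_nonneg _)]
    exact hφ.sqrt_deriv_le_one x
  have hgm := memLp_mul_of_bounded hgc hg1 h.memLp
  have hJ : ∀ y B, (∀ x, |(g x - g (x + y)) ^ 2| ≤ B) →
      -(∫ x, secondDiff w y x * (deriv φ x * w x)) ≤ B * l2norm w ^ 2 := by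
    intro y B hB
    have hk : Continuous fun x => (g x - g (x + y)) ^ 2 := by fun_prop
    have hb := integral_sq_mul_le_of_abs_le (y := y) h.memLp hB
    have i1 : Integrable fun x => (g x * w x - g (x + y) * w (x + y)) ^ 2 :=
      (hgm.sub (memLp_translate hgm y)).integrable_sq
    have i2 : Integrable fun x => (g x - g (x + y)) ^ 2 * (w x * w (x + y)) :=
      (integrable_mul_of_memLp_two h.memLp (memLp_translate h.memLp y)).bdd_mul
        hk.aestronglyMeasurable (Eventually.of_forall hB)
    have e : ∫ x, secondDiff w y x * (deriv φ x * w x) =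
        (∫ x, (g x * w x - g (x + y) * w (x + y)) ^ 2) -
          ∫ x, (g x - g (x + y)) ^ 2 * (w x * w (x + y)) := by
      rw [integral_secondDiff_mul_eq h.memLp hm, ← integral_sub i1 i2]
      congr 1
      ext x
      rw [← hφ.sqrt_deriv_sq x, ← hφ.sqrt_deriv_sq (x + y)]
      simp only [hg]
      ring
    have p : 0 ≤ ∫ x, (g x * w x - g (x + y) * w (x + y)) ^ 2 :=
      integral_nonneg fun _ => sq_nonneg _
    rw [e]
    linarith [le_abs_self (∫ x, (g x - g (x + y)) ^ 2 * (w x * w (x + y)))]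
  have hW := sq_nonneg (l2norm w)
  have hlow := integral_div_sq_ge le_rfl (B := c ^ 2 * l2norm w ^ 2) (by positivity)
    (h.integrableOn_integral_secondDiff_mul hm)
    (fun y hy => by
      refine (hJ y (c ^ 2 * y ^ 2) fun x => ?_).trans (le_of_eq (by ring))
      have := hc (x + y) x
      rw [abs_of_nonneg (sq_nonneg _), ← sq_abs, ← mul_pow]
      refine pow_le_pow_left₀ (abs_nonneg _) (this.trans (le_of_eq ?_)) 2
      rw [sub_add_cancel_left, abs_neg, abs_of_pos hy])
    (fun y hy => by
      refine (hJ y 1 fun x => ?_).trans ?_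
      · rw [abs_of_nonneg (sq_nonneg _), sq_le_one_iff_abs_le_one, abs_le]
        have a1 := hφ.sqrt_deriv_le_one x
        have a2 := hφ.sqrt_deriv_le_one (x + y)
        have a3 := Real.sqrt_nonneg (deriv φ x)
        have a4 := Real.sqrt_nonneg (deriv φ (x + y))
        simp only [hg]
        constructor <;> linarith
      · have : (1 : ℝ) ≤ c ^ 2 := one_le_pow₀ hc1
        exact mul_le_mul_of_nonneg_right this hW)
  rw [h.integral_fracLap_mul hm]
  calc -(c ^ 2 * l2norm w ^ 2) = 1 / Real.pi * -(c ^ 2 * l2norm w ^ 2 * Real.pi) := by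
        field_simp
    _ ≤ _ := by gcongr

/-- The correlation `∫ (φ(x+y) - φ(x)) w(x) w(x+y) dx`. -/
def cutoffCorrelation (φ w : ℝ → ℝ) (y : ℝ) : ℝ :=
  (∫ x, w x * (φ (x + y) * w (x + y))) - ∫ x, (φ x * w x) * w (x + y)

theorem cutoffCorrelation_eq (hφ : IsCutoff R φ) (hw : MemLp w 2) (y : ℝ) :
    cutoffCorrelation φ w y = ∫ x, (φ (x + y) - φ x) * (w x * w (x + y)) := by
  have m := memLp_mul_of_bounded hφ.continuous hφ.abs_le hw
  rw [cutoffCorrelation, ← integral_sub (integrable_mul_of_memLp_two hw (memLp_translate m y))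
    (integrable_mul_of_memLp_two m (memLp_translate hw y))]
  congr 1
  ext x
  ring

/-- Each half of `cutoffCorrelation` pairs a fixed function with a translate, once of `φ w` and once
of `w`, so each can be differentiated separately. -/
theorem IsH2Jet.hasDerivAt_cutoffCorrelation (hφ : IsCutoff R φ) (h : IsH2Jet w dw ddw) (y : ℝ) :
    HasDerivAt (cutoffCorrelation φ w)
      ((∫ x, w x * (deriv φ (x + y) * w (x + y) + φ (x + y) * dw (x + y))) -
        ∫ x, (φ x * w x) * dw (x + y)) y :=
  (hasDerivAt_correlation h.memLp (h.mul_cutoff hφ) y).sub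
    (hasDerivAt_correlation (memLp_mul_of_bounded hφ.continuous hφ.abs_le h.memLp) h y)

/-- Integration by parts in `x` for the terms `w(x)` and `w(x + y)`, translation for `w(x - y)`. All
products that contain `dw` are collected into the derivative of `cutoffCorrelation`, so no norm of
`dw` is paid. -/
theorem IsH2Jet.integral_secondDiff_mul_cutoff_deriv (hφ : IsCutoff R φ) (h : IsH2Jet w dw ddw)
    (y : ℝ) :
    ∫ x, secondDiff w y x * (φ x * dw x) =
      -(∫ x, deriv φ x * w x ^ 2) + (∫ x, (deriv φ x + deriv φ (x + y)) * (w x * w (x + y))) -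
        ((∫ x, w x * (deriv φ (x + y) * w (x + y) + φ (x + y) * dw (x + y))) -
          ∫ x, (φ x * w x) * dw (x + y)) := by
  have m0 := h.memLp
  have m1 := h.memLp_deriv
  have m0y := memLp_translate m0 y
  have m1y := memLp_translate m1 y
  have m0m := memLp_translate m0 (-y)
  have n00 := memLp_mul_of_bounded hφ.continuous hφ.abs_le m0
  have n01 := memLp_mul_of_bounded hφ.continuous hφ.abs_le m1
  have n10 := memLp_mul_of_bounded hφ.continuous_deriv hφ.abs_deriv_le m0
  have n00y := memLp_translate n00 y
  have n01y := memLp_translate n01 y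
  have n10y := memLp_translate n10 y
  have ia : Integrable fun x => deriv φ x * w x ^ 2 :=
    (integrable_mul_of_memLp_two n10 m0).congr (Eventually.of_forall fun x => by simp only; ring)
  have ib : Integrable fun x => w x * (φ x * dw x) := integrable_mul_of_memLp_two m0 n01
  have ic : Integrable fun x => w (x + y) * (φ x * dw x) := integrable_mul_of_memLp_two m0y n01
  have id : Integrable fun x => w (x - y) * (φ x * dw x) := integrable_mul_of_memLp_two m0m n01
  have ie : Integrable fun x => w x * (φ (x + y) * dw (x + y)) :=
    integrable_mul_of_memLp_two m0 n01y
  have ig : Integrable fun x => (deriv φ x * w x) * w (x + y) := integrable_mul_of_memLp_two n10 m0y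
  have ih : Integrable fun x => w x * (deriv φ (x + y) * w (x + y)) :=
    integrable_mul_of_memLp_two m0 n10y
  have ij : Integrable fun x => (φ x * w x) * dw (x + y) := integrable_mul_of_memLp_two n00 m1y
  have ik : Integrable fun x => (φ x * w x) * w (x + y) := integrable_mul_of_memLp_two n00 m0y
  have il : Integrable fun x => (φ x * w x) * w x := integrable_mul_of_memLp_two n00 m0
  have z1 : (∫ x, deriv φ x * w x ^ 2) + 2 * ∫ x, w x * (φ x * dw x) = 0 := by
    rw [← integral_const_mul, ← integral_add ia (ib.const_mul 2)]
    refine integral_eq_zero_of_hasDerivAt_of_integrable (f := fun x => (φ x * w x) * w x)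
      (fun x => ?_) (ia.add (ib.const_mul 2)) il
    refine (((hφ.hasDerivAt x).mul (h.hasDerivAt x)).mul (h.hasDerivAt x)).congr_deriv ?_
    simp only [Pi.mul_apply]
    ring
  have z2 : (∫ x, (deriv φ x * w x) * w (x + y)) + (∫ x, w (x + y) * (φ x * dw x)) +
      ∫ x, (φ x * w x) * dw (x + y) = 0 := by
    have igc : Integrable fun x => (deriv φ x * w x) * w (x + y) + w (x + y) * (φ x * dw x) :=
      ig.add ic
    rw [← integral_add ig ic, ← integral_add igc ij]
    refine integral_eq_zero_of_hasDerivAt_of_integrable (f := fun x => (φ x * w x) * w (x + y))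
      (fun x => ?_) ((ig.add ic).add ij) ik
    refine (((hφ.hasDerivAt x).mul (h.hasDerivAt x)).mul
      ((h.hasDerivAt (x + y)).comp_add_const x y)).congr_deriv ?_
    simp only [Pi.mul_apply]
    ring
  have z3 : ∫ x, w (x - y) * (φ x * dw x) = ∫ x, w x * (φ (x + y) * dw (x + y)) := by
    rw [← integral_add_right_eq_self (fun x => w (x - y) * (φ x * dw x)) y]
    simp only [add_sub_cancel_right]
  have s1 : ∫ x, secondDiff w y x * (φ x * dw x) = 2 * (∫ x, w x * (φ x * dw x)) -
      (∫ x, w (x + y) * (φ x * dw x)) - ∫ x, w (x - y) * (φ x * dw x) := by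
    have ibc : Integrable fun x => 2 * (w x * (φ x * dw x)) - w (x + y) * (φ x * dw x) :=
      (ib.const_mul 2).sub ic
    rw [← integral_const_mul, ← integral_sub (ib.const_mul 2) ic, ← integral_sub ibc id]
    congr 1
    ext x
    simp only [secondDiff]
    ring
  have s2 : ∫ x, (deriv φ x + deriv φ (x + y)) * (w x * w (x + y)) =
      (∫ x, (deriv φ x * w x) * w (x + y)) + ∫ x, w x * (deriv φ (x + y) * w (x + y)) := by
    rw [← integral_add ig ih]
    congr 1
    ext x
    ring
  have s3 : ∫ x, w x * (deriv φ (x + y) * w (x + y) + φ (x + y) * dw (x + y)) =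
      (∫ x, w x * (deriv φ (x + y) * w (x + y))) + ∫ x, w x * (φ (x + y) * dw (x + y)) := by
    rw [← integral_add ih ie]
    congr 1
    ext x
    ring
  linarith

/-- Write `2 w w'` as the sum of squares minus `(w' - w)²`. After translation the squares carry the
weight `φ(x+ε) - φ(x-ε) = 2ε φ_x + O(ε²)`, which produces the subtracted term. The last square has
weight at most `ε` and size `ε² ‖dw‖²`, so it vanishes as `ε → 0`. -/
theorem IsH2Jet.cutoffCorrelation_ge (hφ : IsCutoff R φ) (hc : ∀ x, |deriv (deriv φ) x| ≤ c)
    (h : IsH2Jet w dw ddw) {ε : ℝ} (hε : 0 < ε) :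
    -(c * l2norm w ^ 2) - ε * l2norm dw ^ 2 / 2 ≤
      cutoffCorrelation φ w ε / ε ^ 2 - (∫ x, deriv φ x * w x ^ 2) / ε := by
  have m0 := h.memLp
  have m0y := memLp_translate m0 ε
  have hs : Integrable fun x => w x ^ 2 := m0.integrable_sq
  have hsy : Integrable fun x => w (x + ε) ^ 2 := m0y.integrable_sq
  have hd : Integrable fun x => (w (x + ε) - w x) ^ 2 := (m0y.sub m0).integrable_sq
  have hψc : Continuous fun x => φ (x + ε) - φ x := by
    have := hφ.continuous
    fun_prop
  have hψc' : Continuous fun x => φ x - φ (x - ε) := by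
    have := hφ.continuous
    fun_prop
  have hψ := fun x => hφ.translate_sub_mem_Icc x hε.le
  have hψ' : ∀ x, φ x - φ (x - ε) ∈ Set.Icc 0 ε := fun x => by
    have := hψ (x - ε)
    rwa [sub_add_cancel] at this
  have hψb : ∀ x, ‖φ (x + ε) - φ x‖ ≤ ε := fun x => by
    rw [Real.norm_of_nonneg (hψ x).1]; exact (hψ x).2
  have hψb' : ∀ x, ‖φ x - φ (x - ε)‖ ≤ ε := fun x => by
    rw [Real.norm_of_nonneg (hψ' x).1]; exact (hψ' x).2
  have i1 : Integrable fun x => (φ (x + ε) - φ x) * w x ^ 2 :=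
    hs.bdd_mul hψc.aestronglyMeasurable (Eventually.of_forall hψb)
  have i2 : Integrable fun x => (φ (x + ε) - φ x) * w (x + ε) ^ 2 :=
    hsy.bdd_mul hψc.aestronglyMeasurable (Eventually.of_forall hψb)
  have i2' : Integrable fun x => (φ x - φ (x - ε)) * w x ^ 2 :=
    hs.bdd_mul hψc'.aestronglyMeasurable (Eventually.of_forall hψb')
  have i3 : Integrable fun x => (φ (x + ε) - φ x) * (w x * w (x + ε)) :=
    (integrable_mul_of_memLp_two m0 m0y).bdd_mul hψc.aestronglyMeasurable (Eventually.of_forall hψb)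
  have i4 : Integrable fun x => deriv φ x * w x ^ 2 :=
    hs.bdd_mul hφ.continuous_deriv.aestronglyMeasurable (Eventually.of_forall hφ.abs_deriv_le)
  have e1 : ∫ x, (φ (x + ε) - φ x) * w (x + ε) ^ 2 = ∫ x, (φ x - φ (x - ε)) * w x ^ 2 := by
    rw [← integral_add_right_eq_self (fun x => (φ x - φ (x - ε)) * w x ^ 2) ε]
    simp only [add_sub_cancel_right]
  have b1 : ∫ x, ((φ (x + ε) - φ x) * w x ^ 2 + (φ (x + ε) - φ x) * w (x + ε) ^ 2) ≤
      ∫ x, (2 * ((φ (x + ε) - φ x) * (w x * w (x + ε))) + ε * (w (x + ε) - w x) ^ 2) := by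
    refine integral_mono (i1.add i2) ((i3.const_mul 2).add (hd.const_mul ε)) fun x => ?_
    have := mul_le_mul_of_nonneg_right (hψ x).2 (sq_nonneg (w (x + ε) - w x))
    simp only
    nlinarith
  rw [integral_add i1 i2, integral_add (i3.const_mul 2) (hd.const_mul ε), integral_const_mul,
    integral_const_mul, e1, ← cutoffCorrelation_eq hφ m0] at b1
  have b2 : ∫ x, (2 * ε * (deriv φ x * w x ^ 2) - 2 * c * ε ^ 2 * w x ^ 2) ≤
      ∫ x, ((φ (x + ε) - φ x) * w x ^ 2 + (φ x - φ (x - ε)) * w x ^ 2) := by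
    refine integral_mono ((i4.const_mul _).sub (hs.const_mul _)) (i1.add i2') fun x => ?_
    have t1 := (abs_le.1 (hφ.abs_sub_sub_mul_le hc x ε)).1
    have t2 := (abs_le.1 (hφ.abs_sub_sub_mul_le hc x (-ε))).2
    rw [← sub_eq_add_neg, neg_sq] at t2
    have t3 : 0 ≤ (φ (x + ε) - φ (x - ε)) - (2 * ε * deriv φ x - 2 * c * ε ^ 2) := by linarith
    have := mul_nonneg t3 (sq_nonneg (w x))
    simp only
    nlinarith
  rw [integral_sub (i4.const_mul _) (hs.const_mul _), integral_add i1 i2', integral_const_mul,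
    integral_const_mul, ← l2norm_sq w] at b2
  have b3 : ∫ x, (w (x + ε) - w x) ^ 2 ≤ ε ^ 2 * l2norm dw ^ 2 := by
    have := l2norm_translate_sub_le h.memLp_deriv h.sub_eq_integral hε.le
    rw [← mul_pow, ← l2norm_sq]
    exact pow_le_pow_left₀ (l2norm_nonneg _) this 2
  have b4 := mul_le_mul_of_nonneg_left b3 hε.le
  rw [div_sub_div _ _ (by positivity) hε.ne', le_div_iff₀ (by positivity)]
  have b5 : -(c * l2norm w ^ 2) * ε ^ 2 - ε ^ 3 * l2norm dw ^ 2 / 2 ≤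
      cutoffCorrelation φ w ε - ε * ∫ x, deriv φ x * w x ^ 2 := by
    nlinarith
  have b6 := mul_le_mul_of_nonneg_right b5 hε.le
  nlinarith

/-- Dividing `I = -m + E - Q'` by `y²` gives the exact derivative of `-Q/y² + m/y` plus `K/y²`,
where `K = E - 2Q/y` has a trapezoidal defect as kernel and is therefore harmless at 0. -/
theorem IsH2Jet.integral_fracLap_mul_cutoff_deriv_ge (hφ : IsCutoff R φ) (hc1 : 1 ≤ c)
    (hc2 : ∀ x, |deriv (deriv φ) x| ≤ c) (hc3 : ∀ x, |deriv (deriv (deriv φ)) x| ≤ c)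
    (h : IsH2Jet w dw ddw) :
    -((2 * c + 4) * l2norm w ^ 2) ≤ ∫ x, fracLap w x * (φ x * dw x) := by
  have hm := memLp_mul_of_bounded hφ.continuous hφ.abs_le h.memLp_deriv
  have m0 := h.memLp
  set W := l2norm w ^ 2 with hW
  have hW0 : 0 ≤ W := sq_nonneg _
  set m := ∫ x, deriv φ x * w x ^ 2 with hmdef
  set I : ℝ → ℝ := fun y => ∫ x, secondDiff w y x * (φ x * dw x) with hI
  set E : ℝ → ℝ := fun y => ∫ x, (deriv φ x + deriv φ (x + y)) * (w x * w (x + y)) with hE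
  set Q := cutoffCorrelation φ w with hQ
  set Q' : ℝ → ℝ := fun y =>
    (∫ x, w x * (deriv φ (x + y) * w (x + y) + φ (x + y) * dw (x + y))) -
      ∫ x, (φ x * w x) * dw (x + y) with hQ'
  have hQd : ∀ y, HasDerivAt Q (Q' y) y := h.hasDerivAt_cutoffCorrelation hφ
  have hIeq : ∀ y, I y = -m + E y - Q' y := h.integral_secondDiff_mul_cutoff_deriv hφ
  have hIi : IntegrableOn (fun y => I y / y ^ 2) (Set.Ioi 0) :=
    h.integrableOn_integral_secondDiff_mul hm
  have hφc := hφ.continuous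
  have hφc' := hφ.continuous_deriv
  have hwc := h.continuous
  set k : ℝ → ℝ → ℝ := fun y x => deriv φ x + deriv φ (x + y) - 2 * (φ (x + y) - φ x) / y with hk
  have hk1 : ∀ y, 0 < y → ∀ x, |k y x| ≤ c * y ^ 2 := fun y hy x => by
    have := hφ.abs_trapezoid_le hc3 x hy.le
    have e : k y x = (y * (deriv φ x + deriv φ (x + y)) - 2 * (φ (x + y) - φ x)) / y := by
      simp only [hk]
      field_simp
    rw [e, abs_div, abs_of_pos hy, div_le_iff₀ hy]
    exact this
  have hk2 : ∀ y, 0 < y → ∀ x, |k y x| ≤ 4 := fun y hy x => by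
    have t := hφ.translate_sub_mem_Icc x hy.le
    have t1 : 0 ≤ (φ (x + y) - φ x) / y := div_nonneg t.1 hy.le
    have t2 : (φ (x + y) - φ x) / y ≤ 1 := (div_le_one hy).2 t.2
    have a1 := hφ.deriv_nonneg x
    have a2 := hφ.deriv_nonneg (x + y)
    have a3 := hφ.deriv_le_one x
    have a4 := hφ.deriv_le_one (x + y)
    simp only [hk]
    rw [mul_div_assoc, abs_le]
    constructor <;> linarith
  set K : ℝ → ℝ := fun y => ∫ x, k y x * (w x * w (x + y)) with hK
  have hKE : ∀ y, 0 < y → K y = E y - 2 * Q y / y := by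
    intro y hy
    have iw := integrable_mul_of_memLp_two m0 (memLp_translate m0 y)
    have i1 : Integrable fun x => (deriv φ x + deriv φ (x + y)) * (w x * w (x + y)) :=
      iw.bdd_mul (c := 2) (by fun_prop) (Eventually.of_forall fun x => by
        refine (norm_add_le _ _).trans ?_
        have a1 := hφ.abs_deriv_le x
        have a2 := hφ.abs_deriv_le (x + y)
        simp only [Real.norm_eq_abs]
        linarith)
    have i2 : Integrable fun x => (φ (x + y) - φ x) * (w x * w (x + y)) :=
      iw.bdd_mul (c := y) (by fun_prop) (Eventually.of_forall fun x => by
        have t := hφ.translate_sub_mem_Icc x hy.le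
        rw [Real.norm_of_nonneg t.1]
        exact t.2)
    have e : 2 * Q y / y = ∫ x, 2 / y * ((φ (x + y) - φ x) * (w x * w (x + y))) := by
      rw [integral_const_mul, hQ, cutoffCorrelation_eq hφ m0]
      ring
    rw [e, hE, hK]
    simp only
    rw [← integral_sub i1 (i2.const_mul _)]
    congr 1
    ext x
    simp only [hk]
    ring
  have hKb1 : ∀ y, 0 < y → |K y| ≤ (c + 4) * W * y ^ 2 := fun y hy => by
    refine (integral_sq_mul_le_of_abs_le m0 (hk1 y hy)).trans ?_
    have : 0 ≤ W * y ^ 2 := by positivity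
    rw [← hW]
    nlinarith
  have hKb2 : ∀ y, 0 < y → |K y| ≤ (c + 4) * W := fun y hy => by
    refine (integral_sq_mul_le_of_abs_le m0 (hk2 y hy)).trans ?_
    rw [← hW]
    nlinarith
  have hKm : AEStronglyMeasurable (fun y => K y / y ^ 2) (volume.restrict (Set.Ioi (0 : ℝ))) := by
    have hsm : StronglyMeasurable fun p : ℝ × ℝ => k p.1 p.2 * (w p.2 * w (p.2 + p.1)) := by
      have c1 : Continuous fun p : ℝ × ℝ => deriv φ p.2 + deriv φ (p.2 + p.1) := by fun_prop
      have c2 : Continuous fun p : ℝ × ℝ => 2 * (φ (p.2 + p.1) - φ p.2) := by fun_prop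
      have c3 : Continuous fun p : ℝ × ℝ => w p.2 * w (p.2 + p.1) := by fun_prop
      exact ((c1.measurable.sub (c2.measurable.div measurable_fst)).mul
        c3.measurable).stronglyMeasurable
    have := hsm.integral_prod_right' (ν := (volume : Measure ℝ))
    exact (this.measurable.div (measurable_id.pow_const 2)).aestronglyMeasurable
  have hKi : IntegrableOn (fun y => K y / y ^ 2) (Set.Ioi 0) := by
    refine Integrable.mono' (integrableOn_const_mul_inv_one_add_sq (2 * ((c + 4) * W))) hKm ?_
    refine (ae_restrict_iff' measurableSet_Ioi).2 (Eventually.of_forall fun y hy => ?_)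
    rw [Real.norm_eq_abs, abs_div, abs_of_nonneg (sq_nonneg y)]
    exact div_sq_le_of_le hy (hKb1 y hy) (hKb2 y hy)
  have hQb : ∀ y, |Q y| ≤ 2 * (2 + 2 * R) * W := fun y => by
    rw [hQ, cutoffCorrelation_eq hφ m0]
    refine integral_sq_mul_le_of_abs_le m0 fun x => ?_
    refine (abs_sub _ _).trans ?_
    linarith [hφ.abs_le x, hφ.abs_le (x + y)]
  -- The boundary terms `Q/ε²` and `m/ε` are controlled only jointly, by
  -- `IsH2Jet.cutoffCorrelation_ge`. The integral is therefore cut at `ε`, and the limit removes the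
  -- term with `dw`.
  have hstep : ∀ ε, 0 < ε →
      -((2 * c + 4) * W * Real.pi) - ε * l2norm dw ^ 2 / 2 ≤ ∫ y in Set.Ioi ε, I y / y ^ 2 := by
    intro ε hε
    have hsub : Set.Ioi ε ⊆ Set.Ioi 0 := Set.Ioi_subset_Ioi hε.le
    have i1 := hIi.mono_set hsub
    have i2 := hKi.mono_set hsub
    have hlim : Tendsto (fun y => -(Q y / y ^ 2) + m / y) atTop (𝓝 0) := by
      have l1 : Tendsto (fun y => Q y / y ^ 2) atTop (𝓝 0) := by
        have l0 : Tendsto (fun y : ℝ => (2 * (2 + 2 * R) * W) / y ^ 2) atTop (𝓝 0) :=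
          tendsto_const_nhds.div_atTop (tendsto_pow_atTop two_ne_zero)
        refine squeeze_zero_norm (fun y => ?_) l0
        rw [Real.norm_eq_abs, abs_div, abs_of_nonneg (sq_nonneg y)]
        exact div_le_div_of_nonneg_right (hQb y) (sq_nonneg y)
      have l2 : Tendsto (fun y : ℝ => m / y) atTop (𝓝 0) :=
        tendsto_const_nhds.div_atTop tendsto_id
      simpa using l1.neg.add l2
    have hft := integral_Ioi_of_hasDerivAt_of_tendsto' (a := ε) (m := 0)
      (f := fun y => -(Q y / y ^ 2) + m / y) (f' := fun y => I y / y ^ 2 - K y / y ^ 2)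
      (fun y hy => by
        have hy0 : 0 < y := lt_of_lt_of_le hε hy
        have hd := (((hQd y).div (hasDerivAt_pow 2 y) (by positivity)).neg).add
          ((hasDerivAt_const y m).div (hasDerivAt_id y) hy0.ne')
        refine hd.congr_deriv ?_
        rw [hIeq, hKE y hy0]
        simp only [id]
        field_simp
        ring) (i1.sub i2) hlim
    rw [integral_sub i1 i2] at hft
    have hKlow := integral_div_sq_ge hε.le (B := (c + 4) * W) (by positivity) i2
      (fun y hy => (neg_le_abs _).trans (hKb1 y hy)) (fun y hy => (neg_le_abs _).trans (hKb2 y hy))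
    have hbd := h.cutoffCorrelation_ge hφ hc2 hε
    -- The boundary contributes `c W` and the remainder `(c + 4) W π`; enlarging the former by `π`
    -- gives the constant `2c + 4` after division by `π`.
    have hpi : c * W ≤ c * W * Real.pi :=
      le_mul_of_one_le_right (by positivity) (by linarith [Real.pi_gt_three])
    rw [← hW, ← hmdef, ← hQ] at hbd
    nlinarith
  have hfin : -((2 * c + 4) * W * Real.pi) ≤ ∫ y in Set.Ioi (0 : ℝ), I y / y ^ 2 := by
    have t1 : Tendsto (fun ε : ℝ => -((2 * c + 4) * W * Real.pi) - ε * l2norm dw ^ 2 / 2)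
        (𝓝[>] 0) (𝓝 (-((2 * c + 4) * W * Real.pi))) := by
      have : Continuous fun ε : ℝ => -((2 * c + 4) * W * Real.pi) - ε * l2norm dw ^ 2 / 2 := by
        fun_prop
      simpa using (this.tendsto 0).mono_left (nhdsWithin_le_nhds (s := Set.Ioi 0))
    refine le_of_tendsto_of_tendsto t1 (tendsto_integral_Ioi_nhdsGT_zero hIi) ?_
    filter_upwards [self_mem_nhdsWithin] with ε hε
    exact hstep ε hε
  rw [h.integral_fracLap_mul hm]
  calc -((2 * c + 4) * W) = 1 / Real.pi * -((2 * c + 4) * W * Real.pi) := by field_simp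
    _ ≤ _ := by gcongr

/-- Gårding's inequality for the dispersive term of the scheme. -/
theorem IsCutoff.exists_integral_fracLap_ge (hφ : IsCutoff R φ) :
    ∃ C, 0 ≤ C ∧ ∀ w dw ddw : ℝ → ℝ, IsH2Jet w dw ddw →
      -(C * l2norm w ^ 2) ≤ ∫ x, fracLap w x * (deriv φ x * w x + φ x * dw x) := by
  obtain ⟨c, hc1, hc, hc2, hc3⟩ := hφ.exists_bounds
  refine ⟨c ^ 2 + (2 * c + 4), by positivity, fun w dw ddw h => ?_⟩
  have i1 := h.integrable_fracLap_mul
    (memLp_mul_of_bounded hφ.continuous_deriv hφ.abs_deriv_le h.memLp)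
  have i2 := h.integrable_fracLap_mul (memLp_mul_of_bounded hφ.continuous hφ.abs_le h.memLp_deriv)
  have e1 := h.integral_fracLap_mul_deriv_cutoff_ge hφ hc1 hc
  have e2 := h.integral_fracLap_mul_cutoff_deriv_ge hφ hc1 hc2 hc3
  simp only [mul_add]
  rw [integral_add i1 i2]
  linarith

end

/-! ### The fixed point iteration in a Hilbert space -/

section
variable {V : Type*} [NormedAddCommGroup V] [InnerProductSpace ℝ V]

/-- Lax–Milgram for a form that need not be symmetric. -/
theorem existsUnique_inner_add_bilin_eq [CompleteSpace V] {B : V →ₗ[ℝ] V →ₗ[ℝ] ℝ} {C c s : ℝ}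
    (hBC : ∀ u v, |B u v| ≤ C * ‖u‖ * ‖v‖) (hc : 0 < c)
    (hco : ∀ v, c * ‖v‖ ^ 2 ≤ ‖v‖ ^ 2 + s * B v v) (ℓ : V →L[ℝ] ℝ) :
    ∃! w, ∀ v, inner ℝ w v + s * B w v = ℓ v := by
  have hbd : ∀ u v, ‖(innerₗ V + s • B) u v‖ ≤ (1 + |s| * C) * ‖u‖ * ‖v‖ := fun u v => by
    have h1 := abs_real_inner_le_norm u v
    have h2 := mul_le_mul_of_nonneg_left (hBC u v) (abs_nonneg s)
    simp only [LinearMap.add_apply, LinearMap.smul_apply, innerₗ_apply_apply, smul_eq_mul]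
    refine (norm_add_le _ _).trans ?_
    simp only [Real.norm_eq_abs, abs_mul]
    linarith
  set F : V →L[ℝ] V →L[ℝ] ℝ := (innerₗ V + s • B).mkContinuous₂ (1 + |s| * C) hbd with hF
  have hFa : ∀ u v, F u v = inner ℝ u v + s * B u v := fun u v => by
    simp [hF]
  have hcoer : IsCoercive F := ⟨c, hc, fun v => by
    rw [hFa, real_inner_self_eq_norm_sq, mul_assoc, ← sq]
    exact hco v⟩
  set T := hcoer.continuousLinearEquivOfBilin with hT
  have hTa : ∀ u v, inner ℝ (T u) v = F u v := fun u v =>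
    hcoer.continuousLinearEquivOfBilin_apply u v
  set z : V := (InnerProductSpace.toDual ℝ V).symm ℓ with hz
  have hza : ∀ v, inner ℝ z v = ℓ v := fun v => InnerProductSpace.toDual_symm_apply
  refine ⟨T.symm z, fun v => ?_, fun w hw => ?_⟩
  · rw [← hFa, ← hTa, T.apply_symm_apply, hza]
  · rw [T.eq_symm_apply]
    refine ext_inner_right ℝ fun v => ?_
    rw [hTa, hFa, hza]
    exact hw v

/-- One step of the linearised scheme: `w'` is computed from `w` and the initial value `u`. -/
def LinStep (B : V →ₗ[ℝ] V →ₗ[ℝ] ℝ) (q : V →ₗ[ℝ] V →ₗ[ℝ] V →ₗ[ℝ] ℝ) (dt : ℝ) (u w w' : V) : Prop :=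
  ∀ v, inner ℝ w' v - dt / 2 * q ((1 / 2 : ℝ) • (w + u)) ((1 / 2 : ℝ) • (w + u)) v +
    dt * B ((1 / 2 : ℝ) • (w' + u)) v = inner ℝ u v

variable {B : V →ₗ[ℝ] V →ₗ[ℝ] ℝ} {q : V →ₗ[ℝ] V →ₗ[ℝ] V →ₗ[ℝ] ℝ} {C C₀ κ dt L K : ℝ} {u : V}

theorem LinStep.existsUnique [CompleteSpace V] (hBC : ∀ u v, |B u v| ≤ C * ‖u‖ * ‖v‖)
    (hB : ∀ v, -(C₀ * ‖v‖ ^ 2) ≤ B v v) (hq : ∀ a b v, |q a b v| ≤ 2 * κ * ‖a‖ * ‖b‖ * ‖v‖)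
    (hdt : 0 < dt) (hdtC : dt * C₀ ≤ 1 / 10) (w : V) : ∃! w', LinStep B q dt u w w' := by
  set m := (1 / 2 : ℝ) • (w + u) with hm
  set ℓ : V →ₗ[ℝ] ℝ := innerₛₗ ℝ u + (dt / 2) • q m m - (dt / 2) • B u with hℓ
  have hℓa : ∀ v, ℓ v = inner ℝ u v + dt / 2 * q m m v - dt / 2 * B u v := fun v => by
    simp [hℓ]
  have hbd : ∀ v, ‖ℓ v‖ ≤ (‖u‖ + dt / 2 * (2 * κ * ‖m‖ * ‖m‖) + dt / 2 * (C * ‖u‖)) * ‖v‖ := by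
    intro v
    rw [hℓa]
    have h1 := abs_real_inner_le_norm u v
    have h2 := mul_le_mul_of_nonneg_left (hq m m v) (half_pos hdt).le
    have h3 := mul_le_mul_of_nonneg_left (hBC u v) (half_pos hdt).le
    refine (norm_sub_le _ _).trans ((add_le_add_left (norm_add_le _ _) _).trans ?_)
    simp only [Real.norm_eq_abs, abs_mul, abs_of_pos (half_pos hdt)]
    linarith
  obtain ⟨w', hw', huniq⟩ := existsUnique_inner_add_bilin_eq (B := B) (C := C) (c := 1 / 2)
    (s := dt / 2) hBC (by norm_num) (fun v => by
      have := mul_le_mul_of_nonneg_left (hB v) (half_pos hdt).le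
      nlinarith [sq_nonneg ‖v‖]) (ℓ.mkContinuous _ hbd)
  have key : ∀ x, LinStep B q dt u w x ↔
      ∀ v, inner ℝ x v + dt / 2 * B x v = ℓ.mkContinuous _ hbd v := by
    intro x
    refine forall_congr' fun v => ?_
    rw [LinearMap.mkContinuous_apply, hℓa]
    have e : B ((1 / 2 : ℝ) • (x + u)) v = 1 / 2 * (B x v + B u v) := by
      simp
      ring
    rw [e, ← hm]
    constructor <;> intro h <;> linarith
  exact ⟨w', (key w').2 hw', fun x hx => huniq x ((key x).1 hx)⟩

/-- Testing with the midpoint `M` makes the inner products telescope to `(‖w‖² - ‖u‖²)/2` and the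
dispersive term become `B M M`, to which the lower bound applies. -/
theorem LinStep.norm_first_le (hB : ∀ v, -(C₀ * ‖v‖ ^ 2) ≤ B v v)
    (hq : ∀ a b v, |q a b v| ≤ 2 * κ * ‖a‖ * ‖b‖ * ‖v‖) (hdt : 0 < dt)
    (hdtC : dt * C₀ ≤ 1 / 10) (hsmall : dt * κ * ‖u‖ ≤ 1 / 14) {w : V}
    (h : LinStep B q dt u u w) : ‖w‖ ≤ 5 * ‖u‖ := by
  set M := (1 / 2 : ℝ) • (w + u) with hM
  have hu : (1 / 2 : ℝ) • (u + u) = u := by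
    rw [← two_smul ℝ u, smul_smul]
    norm_num
  have h1 := h M
  rw [hu] at h1
  have e1 : inner ℝ w M - inner ℝ u M = (‖w‖ ^ 2 - ‖u‖ ^ 2) / 2 := by
    rw [hM, inner_smul_right, inner_smul_right, inner_add_right, inner_add_right,
      real_inner_self_eq_norm_sq, real_inner_self_eq_norm_sq, real_inner_comm w u]
    ring
  have hMn : ‖M‖ ≤ (‖w‖ + ‖u‖) / 2 := by
    rw [hM, norm_smul]
    have := norm_add_le w u
    norm_num
    linarith
  have hq1 := (abs_le.1 (hq u u M)).2
  have hBM := hB M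
  set s := ‖w‖
  set t := ‖u‖
  have hs : 0 ≤ s := norm_nonneg w
  have ht : 0 ≤ t := norm_nonneg u
  have hM0 : 0 ≤ ‖M‖ := norm_nonneg M
  have hM2 : ‖M‖ ^ 2 ≤ ((s + t) / 2) ^ 2 := pow_le_pow_left₀ hM0 hMn 2
  have a1 : dt / 2 * q u u M ≤ 1 / 14 * t * ((s + t) / 2) := by
    calc dt / 2 * q u u M ≤ dt / 2 * (2 * κ * t * t * ‖M‖) := by gcongr
      _ = (dt * κ * t) * (t * ‖M‖) := by ring
      _ ≤ 1 / 14 * (t * ‖M‖) := by gcongr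
      _ ≤ 1 / 14 * (t * ((s + t) / 2)) := by gcongr
      _ = _ := by ring
  have a2 : -(1 / 10 * ((s + t) / 2) ^ 2) ≤ dt * B M M := by
    have b1 : dt * -(C₀ * ‖M‖ ^ 2) ≤ dt * B M M := by gcongr
    have b2 : dt * C₀ * ‖M‖ ^ 2 ≤ 1 / 10 * ‖M‖ ^ 2 := by gcongr
    linarith
  by_contra! hlt
  have hspos : 0 < s := by linarith
  -- All terms carry the factor `s + t`; what remains after removing it contradicts `s > 5t`.
  have hbr : 0 < (s - t) / 2 - (s + t) / 40 - t / 28 := by linarith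
  have : 0 < (s + t) * ((s - t) / 2 - (s + t) / 40 - t / 28) := mul_pos (by linarith) hbr
  nlinarith

/-- Subtract two consecutive steps and test with the new increment. By symmetry the quadratic terms
differ by `q (m' - m) (m' + m)`, which is linear in the old increment. -/
theorem LinStep.norm_sub_le (hB : ∀ v, -(C₀ * ‖v‖ ^ 2) ≤ B v v)
    (hsymm : ∀ a b v, q a b v = q b a v)
    (hq : ∀ a b v, |q a b v| ≤ 2 * κ * ‖a‖ * ‖b‖ * ‖v‖) (hκ : 0 ≤ κ) (hdt : 0 < dt)
    (hdtC : dt * C₀ ≤ 1 / 10) (hK : 7 ≤ K) (hsmall : dt * κ * (K * ‖u‖) ≤ L / 2.8)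
    {w w' w'' : V} (h : LinStep B q dt u w w') (h' : LinStep B q dt u w' w'')
    (hw : ‖w‖ ≤ K * ‖u‖) (hw' : ‖w'‖ ≤ K * ‖u‖) : ‖w'' - w'‖ ≤ L * ‖w' - w‖ := by
  set d' := w'' - w' with hd'
  set d := w' - w with hd
  set m := (1 / 2 : ℝ) • (w + u) with hm
  set m' := (1 / 2 : ℝ) • (w' + u) with hm'
  have h1 := h d'
  have h2 := h' d'
  have e1 : B ((1 / 2 : ℝ) • (w'' + u)) d' - B m' d' = 1 / 2 * B d' d' := by
    rw [← LinearMap.sub_apply, ← map_sub, hm', ← smul_sub, add_sub_add_right_eq_sub, map_smul,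
      LinearMap.smul_apply, smul_eq_mul]
  have e2 : inner ℝ w'' d' - inner ℝ w' d' = ‖d'‖ ^ 2 := by
    rw [← inner_sub_left, real_inner_self_eq_norm_sq]
  have e3 : q m' m' d' - q m m d' = q (m' - m) (m' + m) d' := by
    have := hsymm m m' d'
    simp only [map_sub, map_add, LinearMap.sub_apply, LinearMap.add_apply]
    linarith
  have n1 : ‖m' - m‖ = 1 / 2 * ‖d‖ := by
    rw [hm', hm, ← smul_sub, add_sub_add_right_eq_sub, norm_smul, Real.norm_of_nonneg (by norm_num)]
  -- The sum is at most `(K + 1)‖u‖`, and `K ≥ 7`.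
  have n2 : ‖m' + m‖ ≤ 8 / 7 * (K * ‖u‖) := by
    have : ‖m' + m‖ ≤ (‖w'‖ + ‖u‖) / 2 + (‖w‖ + ‖u‖) / 2 := by
      refine (norm_add_le _ _).trans (add_le_add ?_ ?_)
      · rw [hm', norm_smul]; have := norm_add_le w' u; norm_num; linarith
      · rw [hm, norm_smul]; have := norm_add_le w u; norm_num; linarith
    have hu := norm_nonneg u
    nlinarith
  have hd0 : 0 ≤ ‖d‖ := norm_nonneg d
  have hd'0 : 0 ≤ ‖d'‖ := norm_nonneg d'
  have b1 : dt / 2 * q (m' - m) (m' + m) d' ≤ 4 / 7 * (L / 2.8) * (‖d‖ * ‖d'‖) := by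
    calc dt / 2 * q (m' - m) (m' + m) d'
        ≤ dt / 2 * (2 * κ * ‖m' - m‖ * ‖m' + m‖ * ‖d'‖) := by
          gcongr
          exact (abs_le.1 (hq _ _ _)).2
      _ ≤ dt / 2 * (2 * κ * (1 / 2 * ‖d‖) * (8 / 7 * (K * ‖u‖)) * ‖d'‖) := by
          rw [n1]
          gcongr
      _ = 4 / 7 * (dt * κ * (K * ‖u‖)) * (‖d‖ * ‖d'‖) := by ring
      _ ≤ _ := by gcongr
  have b2 : -(1 / 20 * ‖d'‖ ^ 2) ≤ dt / 2 * B d' d' := by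
    have c1 := mul_le_mul_of_nonneg_left (hB d') (half_pos hdt).le
    have c2 : dt * C₀ * ‖d'‖ ^ 2 ≤ 1 / 10 * ‖d'‖ ^ 2 := by gcongr
    linarith
  rw [← e3] at b1
  rcases hd'0.eq_or_lt with h0 | hpos
  · have hL : 0 ≤ L := by
      have : 0 ≤ dt * κ * (K * ‖u‖) := by positivity
      have := this.trans hsmall
      norm_num at this
      linarith
    rw [← h0]
    positivity
  · have hL : 0 ≤ L := by
      have : 0 ≤ dt * κ * (K * ‖u‖) := by positivity
      have := this.trans hsmall
      norm_num at this
      linarith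
    -- Since `4 / (7 · 2.8)` is well below `19/20`, the contraction factor `L` is reached with room
    -- to spare.
    have hmain : 19 / 20 * ‖d'‖ ^ 2 ≤ 4 / 7 * (L / 2.8) * (‖d‖ * ‖d'‖) := by nlinarith
    have : 19 / 20 * ‖d'‖ ≤ 4 / 7 * (L / 2.8) * ‖d‖ := by
      refine le_of_mul_le_mul_right ?_ hpos
      linarith
    have hLd : 0 ≤ L * ‖d‖ := by positivity
    norm_num at this
    linarith

theorem LinStep.exists_limit [CompleteSpace V] (hBC : ∀ u v, |B u v| ≤ C * ‖u‖ * ‖v‖)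
    (hB : ∀ v, -(C₀ * ‖v‖ ^ 2) ≤ B v v) (hsymm : ∀ a b v, q a b v = q b a v)
    (hq : ∀ a b v, |q a b v| ≤ 2 * κ * ‖a‖ * ‖b‖ * ‖v‖) (hκ : 0 ≤ κ) (hdt : 0 < dt)
    (hdtC : dt * C₀ ≤ 1 / 10) (hL0 : 0 < L) (hL1 : L < 1) (hK : K = (7 - L) / (1 - L))
    (hcfl : dt * κ * (2 * √2 * K * ‖u‖) ≤ L) {w : ℕ → V} (hw0 : w 0 = u)
    (hw : ∀ l, LinStep B q dt u (w l) (w (l + 1))) :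
    ∃ u', Tendsto w atTop (𝓝 u') ∧ LinStep B q dt u u' u' ∧ ‖u'‖ ≤ K * ‖u‖ := by
  have h1L : 0 < 1 - L := sub_pos.2 hL1
  have hKe : K = 1 + 6 / (1 - L) := by
    rw [hK]
    field_simp
    ring
  have hK7 : 7 ≤ K := by
    have : 6 ≤ 6 / (1 - L) := by
      rw [le_div_iff₀ h1L]
      linarith
    linarith
  have hu0 := norm_nonneg u
  have hsq2 : 1.4 ≤ √2 := Real.le_sqrt_of_sq_le (by norm_num)
  have hp : 0 ≤ dt * κ * (K * ‖u‖) := by positivity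
  have hsmall : dt * κ * (K * ‖u‖) ≤ L / 2.8 := by
    rw [le_div_iff₀ (by norm_num)]
    nlinarith
  -- A factor `1/7` comes from `K ≥ 7`, and `1/2` bounds `L / 2.8`.
  have hsmall' : dt * κ * ‖u‖ ≤ 1 / 14 := by
    have h1 : dt * κ * ‖u‖ * 7 ≤ dt * κ * ‖u‖ * K := by gcongr
    have h2 : L / 2.8 ≤ 1 / 2 := by
      rw [div_le_iff₀ (by norm_num)]
      linarith
    linarith
  -- The two claims need each other: contraction requires the iterates to lie in the ball of radius
  -- `K‖u‖`, and the partial geometric sums keep them there.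
  have hind : ∀ l, ‖w l - u‖ ≤ 6 * ‖u‖ * ((1 - L ^ l) / (1 - L)) ∧
      ‖w (l + 1) - w l‖ ≤ 6 * ‖u‖ * L ^ l := by
    have hbd : ∀ l, ‖w l - u‖ ≤ 6 * ‖u‖ * ((1 - L ^ l) / (1 - L)) → ‖w l‖ ≤ K * ‖u‖ := by
      intro l hl
      have t1 : ‖w l‖ ≤ ‖w l - u‖ + ‖u‖ := by
        simpa using norm_add_le (w l - u) u
      have t2 : (1 - L ^ l) / (1 - L) ≤ 1 / (1 - L) := by
        have : 0 ≤ L ^ l := by positivity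
        gcongr
        linarith
      have t3 := mul_le_mul_of_nonneg_left t2 (by positivity : 0 ≤ 6 * ‖u‖)
      have t4 : K * ‖u‖ = ‖u‖ + 6 * ‖u‖ * (1 / (1 - L)) := by
        rw [hKe]
        ring
      linarith
    intro l
    induction l with
    | zero =>
      refine ⟨by simp [hw0], ?_⟩
      have h0 := hw 0
      rw [hw0] at h0
      have := h0.norm_first_le hB hq hdt hdtC hsmall'
      rw [hw0]
      have t := _root_.norm_sub_le (w (0 + 1)) u
      rw [pow_zero]
      linarith
    | succ l ih =>
      obtain ⟨ih1, ih2⟩ := ih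
      have hfirst : ‖w (l + 1) - u‖ ≤ 6 * ‖u‖ * ((1 - L ^ (l + 1)) / (1 - L)) := by
        have t : ‖w (l + 1) - u‖ ≤ ‖w (l + 1) - w l‖ + ‖w l - u‖ := by
          simpa using norm_add_le (w (l + 1) - w l) (w l - u)
        have e : (1 - L ^ (l + 1)) / (1 - L) = L ^ l + (1 - L ^ l) / (1 - L) := by
          rw [pow_succ]
          field_simp
          ring
        rw [e]
        linarith
      refine ⟨hfirst, ?_⟩
      have := LinStep.norm_sub_le hB hsymm hq hκ hdt hdtC hK7 hsmall (hw l) (hw (l + 1))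
        (hbd l ih1) (hbd (l + 1) hfirst)
      calc _ ≤ L * ‖w (l + 1) - w l‖ := this
        _ ≤ L * (6 * ‖u‖ * L ^ l) := by gcongr
        _ = _ := by ring
  have hcau : CauchySeq w := cauchySeq_of_le_geometric L (6 * ‖u‖) hL1 fun l => by
    rw [dist_comm, dist_eq_norm]
    exact (hind l).2
  obtain ⟨u', hu'⟩ := cauchySeq_tendsto_of_complete hcau
  refine ⟨u', hu', fun v => ?_, ?_⟩
  · have hm : Tendsto (fun l => (1 / 2 : ℝ) • (w l + u)) atTop (𝓝 ((1 / 2 : ℝ) • (u' + u))) :=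
      (hu'.add_const u).const_smul _
    have hw1 : Tendsto (fun l => w (l + 1)) atTop (𝓝 u') := hu'.comp (tendsto_add_atTop_nat 1)
    have hm1 : Tendsto (fun l => (1 / 2 : ℝ) • (w (l + 1) + u)) atTop
        (𝓝 ((1 / 2 : ℝ) • (u' + u))) := hm.comp (tendsto_add_atTop_nat 1)
    set M := (1 / 2 : ℝ) • (u' + u) with hM
    have t1 : Tendsto (fun l => inner ℝ (w (l + 1)) v) atTop (𝓝 (inner ℝ u' v)) :=
      hw1.inner tendsto_const_nhds
    have t2 : Tendsto (fun l => B ((1 / 2 : ℝ) • (w (l + 1) + u)) v) atTop (𝓝 (B M v)) := by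
      have := ((B.mkContinuous₂ C hBC).continuous.tendsto M).comp hm1
      exact ((ContinuousLinearMap.apply ℝ ℝ v).continuous.tendsto _).comp this
    -- By symmetry the difference of the two values is `q (m - M) (m + M) v`, which tends to 0.
    have t3 : Tendsto (fun l => q ((1 / 2 : ℝ) • (w l + u)) ((1 / 2 : ℝ) • (w l + u)) v) atTop
        (𝓝 (q M M v)) := by
      rw [tendsto_iff_norm_sub_tendsto_zero]
      have hz : Tendsto (fun l => 2 * κ * ‖(1 / 2 : ℝ) • (w l + u) - M‖ *
          ‖(1 / 2 : ℝ) • (w l + u) + M‖ * ‖v‖) atTop (𝓝 0) := by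
        have z1 := (tendsto_iff_norm_sub_tendsto_zero.1 hm).const_mul (2 * κ)
        have z2 := (hm.add_const M).norm
        simpa using (z1.mul z2).mul_const ‖v‖
      refine squeeze_zero (fun _ => norm_nonneg _) (fun l => ?_) hz
      refine le_trans (le_of_eq ?_) (hq _ _ v)
      rw [Real.norm_eq_abs]
      congr 1
      have := hsymm M ((1 / 2 : ℝ) • (w l + u)) v
      simp only [map_sub, map_add (q _), LinearMap.sub_apply, LinearMap.add_apply]
      linarith
    have lim := (t1.sub (t3.const_mul (dt / 2))).add (t2.const_mul dt)
    exact tendsto_nhds_unique lim (tendsto_const_nhds.congr fun l => (hw l v).symm)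
  · refine le_of_tendsto hu'.norm (Eventually.of_forall fun l => ?_)
    have t1 : ‖w l‖ ≤ ‖w l - u‖ + ‖u‖ := by
      simpa using norm_add_le (w l - u) u
    have t2 : (1 - L ^ l) / (1 - L) ≤ 1 / (1 - L) := by
      have : 0 ≤ L ^ l := by positivity
      gcongr
      linarith
    have t3 := mul_le_mul_of_nonneg_left t2 (by positivity : 0 ≤ 6 * ‖u‖)
    have t4 : K * ‖u‖ = ‖u‖ + 6 * ‖u‖ * (1 / (1 - L)) := by
      rw [hKe]
      ring
    linarith [(hind l).1]

theorem LinStep.existsUnique_seq (hstep : ∀ w, ∃! w', LinStep B q dt u w w') :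
    ∃! w : ℕ → V, w 0 = u ∧ ∀ l, LinStep B q dt u (w l) (w (l + 1)) := by
  choose f hf huniq using hstep
  refine ⟨fun l => f^[l] u, ⟨rfl, fun l => ?_⟩, fun w hw => ?_⟩
  · simp only [Function.iterate_succ_apply']
    exact hf _
  · ext l
    induction l with
    | zero => exact hw.1
    | succ l ih =>
      rw [Function.iterate_succ_apply', ← ih]
      exact huniq _ _ (hw.2 l)

end

/-! ### The finite element space as a Hilbert space -/

/-- The finite element space as a space of continuously differentiable, square integrable piecewise
polynomials. -/
def splineSpace (r : ℕ) (dx : ℝ) : Submodule ℝ (ℝ → ℝ) where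
  carrier := {v | IsPiecewisePoly r dx v ∧ Differentiable ℝ v ∧ MemLp v 2}
  zero_mem' := ⟨fun _ => ⟨0, by simp, fun x _ => by simp⟩, differentiable_const 0, MemLp.zero⟩
  add_mem' := by
    rintro a b ⟨ha, hda, hla⟩ ⟨hb, hdb, hlb⟩
    refine ⟨fun j => ?_, hda.add hdb, hla.add hlb⟩
    obtain ⟨p, hp, hpe⟩ := ha j
    obtain ⟨q, hq, hqe⟩ := hb j
    exact ⟨p + q, Polynomial.natDegree_add_le_of_degree_le hp hq, fun x hx => by
      simp [hpe x hx, hqe x hx]⟩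
  smul_mem' := by
    rintro c a ⟨ha, hda, hla⟩
    refine ⟨fun j => ?_, hda.const_smul c, hla.const_smul c⟩
    obtain ⟨p, hp, hpe⟩ := ha j
    exact ⟨c • p, (Polynomial.natDegree_smul_le c p).trans hp, fun x hx => by simp [hpe x hx]⟩

theorem mem_femSpace_iff_mem_splineSpace {r : ℕ} {dx : ℝ} (hdx : 0 < dx) {v : ℝ → ℝ} :
    v ∈ femSpace r dx ↔ v ∈ splineSpace r dx := mem_femSpace_iff hdx

theorem exists_isH2Jet_of_mem {r : ℕ} {dx : ℝ} (hdx : 0 < dx) {v : ℝ → ℝ}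
    (hv : v ∈ splineSpace r dx) : ∃ g, IsH2Jet v (deriv v) g ∧
      l2norm (deriv v) ≤ √(invConst r) / dx * l2norm v ∧
      l2norm g ≤ (√(invConst r) / dx) ^ 2 * l2norm v := by
  obtain ⟨hp, hd, hL⟩ := hv
  obtain ⟨g, hg, hj⟩ := hp.exists_isH2Jet hdx hd hL
  have hC := (invConst_pos r).le
  have key : ∀ {f g : ℝ → ℝ}, (∫ t, g t ^ 2) * dx ^ 2 ≤ invConst r * ∫ t, f t ^ 2 →
      l2norm g ≤ √(invConst r) / dx * l2norm f := by
    intro f g h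
    rw [div_mul_eq_mul_div, le_div_iff₀ hdx]
    refine le_of_sq_le_sq ?_ (mul_nonneg (Real.sqrt_nonneg _) (l2norm_nonneg _))
    rw [mul_pow, mul_pow, l2norm_sq, l2norm_sq, Real.sq_sqrt hC]
    exact h
  have k1 := key ((hp.isPiecewiseDeriv_deriv hdx hd).memLp_and_integral_sq_le hdx hL).2
  have k2 := key (hg.memLp_and_integral_sq_le hdx hj.memLp_deriv).2
  refine ⟨g, hj, k1, k2.trans ?_⟩
  rw [sq, mul_assoc]
  exact mul_le_mul_of_nonneg_left k1 (by positivity)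

/-- Degree at most `r` means being the Lagrange interpolant at `r + 1` fixed points of the interval,
and the interpolant depends continuously on the values there. -/
theorem exists_polynomial_of_tendsto {r : ℕ} {a b : ℝ} (hab : a < b) {p : ℕ → ℝ[X]} {f : ℝ → ℝ}
    (hp : ∀ n, (p n).natDegree ≤ r)
    (hlim : ∀ x ∈ Set.Icc a b, Tendsto (fun n => (p n).eval x) atTop (𝓝 (f x))) :
    ∃ q : ℝ[X], q.natDegree ≤ r ∧ ∀ x ∈ Set.Icc a b, f x = q.eval x := by
  set t : ℕ → ℝ := fun i => a + (b - a) / (i + 1) with ht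
  have hba : 0 < b - a := sub_pos.2 hab
  have htm : ∀ i, t i ∈ Set.Icc a b := fun i => by
    have h1 : 0 < (b - a) / ((i : ℝ) + 1) := by positivity
    have h2 : (b - a) / ((i : ℝ) + 1) ≤ b - a := div_le_self hba.le (by
      have : (0 : ℝ) ≤ i := Nat.cast_nonneg i
      linarith)
    constructor <;> simp only [ht] <;> linarith
  have hinj : Set.InjOn t (Finset.range (r + 1)) := by
    intro i _ j _ hij
    simp only [ht, add_right_inj] at hij
    rw [div_eq_div_iff (by positivity) (by positivity)] at hij
    have h1 := mul_left_cancel₀ hba.ne' hij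
    exact_mod_cast (add_right_cancel h1).symm
  have hcard : (Finset.range (r + 1)).card = r + 1 := Finset.card_range _
  have hev : ∀ (c : ℕ → ℝ) x, (Lagrange.interpolate (Finset.range (r + 1)) t c).eval x =
      ∑ i ∈ Finset.range (r + 1), c i * (Lagrange.basis (Finset.range (r + 1)) t i).eval x := by
    intro c x
    simp [Lagrange.interpolate_apply, Polynomial.eval_finsetSum]
  have hpn : ∀ n, p n = Lagrange.interpolate (Finset.range (r + 1)) t fun i => (p n).eval (t i) :=
    fun n => Lagrange.eq_interpolate hinj (by
      rw [hcard]
      exact lt_of_le_of_lt Polynomial.degree_le_natDegree (by exact_mod_cast Nat.lt_succ_of_le (hp n)))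
  refine ⟨Lagrange.interpolate (Finset.range (r + 1)) t fun i => f (t i), ?_, fun x hx => ?_⟩
  · have := Lagrange.degree_interpolate_lt (r := fun i => f (t i)) hinj
    rw [hcard] at this
    exact Polynomial.natDegree_le_iff_degree_le.2 (Order.le_of_lt_succ this)
  · refine tendsto_nhds_unique (hlim x hx) ?_
    rw [hev]
    have h1 : ∀ n, (p n).eval x = ∑ i ∈ Finset.range (r + 1), (p n).eval (t i) *
        (Lagrange.basis (Finset.range (r + 1)) t i).eval x := fun n => by
      conv_lhs => rw [hpn n]
      exact hev _ x
    simp only [h1]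
    exact tendsto_finsetSum _ fun i _ => (hlim _ (htm i)).mul_const _

section
variable {R : ℝ} {φ : ℝ → ℝ}

theorem IsCutoff.integrable_mul_mul (hφ : IsCutoff R φ) {u v : ℝ → ℝ} (hu : MemLp u 2)
    (hv : MemLp v 2) : Integrable fun x => u x * (φ x * v x) :=
  integrable_mul_of_memLp_two hu (memLp_mul_of_bounded hφ.continuous hφ.abs_le hv)

theorem IsCutoff.integral_sq_le_pairing (hφ : IsCutoff R φ) {u : ℝ → ℝ} (hu : MemLp u 2) :
    ∫ x, u x ^ 2 ≤ pairing u (φ * u) := by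
  refine integral_mono hu.integrable_sq (hφ.integrable_mul_mul hu hu) fun x => ?_
  have := mul_le_mul_of_nonneg_right (hφ.one_le x) (sq_nonneg (u x))
  simp only [Pi.mul_apply]
  nlinarith

/-- The space `S_{Δx}` with the weighted inner product `⟨u, φ v⟩`. -/
def WeightedSpline (_ : IsCutoff R φ) (r : ℕ) {dx : ℝ} (_ : 0 < dx) : Type := splineSpace r dx

namespace WeightedSpline
variable {hφ : IsCutoff R φ} {r : ℕ} {dx : ℝ} {hdx : 0 < dx}

instance : AddCommGroup (WeightedSpline hφ r hdx) :=
  inferInstanceAs (AddCommGroup (splineSpace r dx))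

instance : Module ℝ (WeightedSpline hφ r hdx) :=
  inferInstanceAs (Module ℝ (splineSpace r dx))

/-- The function underlying an element of `S_{Δx}`. -/
def fn (v : WeightedSpline hφ r hdx) : ℝ → ℝ := Subtype.val (p := fun f => f ∈ splineSpace r dx) v

theorem fn_mem (v : WeightedSpline hφ r hdx) : v.fn ∈ splineSpace r dx :=
  Subtype.property (p := fun f => f ∈ splineSpace r dx) v

theorem fn_injective : Function.Injective (fn : WeightedSpline hφ r hdx → ℝ → ℝ) :=
  Subtype.val_injective (p := fun f => f ∈ splineSpace r dx)

/-- An element of `S_{Δx}` from a function. -/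
def of (f : ℝ → ℝ) (hf : f ∈ splineSpace r dx) : WeightedSpline hφ r hdx :=
  (⟨f, hf⟩ : splineSpace r dx)

theorem fn_of (f : ℝ → ℝ) (hf : f ∈ splineSpace r dx) :
    (of f hf : WeightedSpline hφ r hdx).fn = f := rfl

theorem fn_add (u v : WeightedSpline hφ r hdx) : (u + v).fn = fun x => u.fn x + v.fn x := rfl

theorem fn_sub (u v : WeightedSpline hφ r hdx) : (u - v).fn = u.fn - v.fn := rfl

theorem fn_smul (c : ℝ) (v : WeightedSpline hφ r hdx) : (c • v).fn = fun x => c * v.fn x := rfl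

theorem memLp (v : WeightedSpline hφ r hdx) : MemLp v.fn 2 := v.fn_mem.2.2

theorem hasDerivAt (v : WeightedSpline hφ r hdx) (x : ℝ) : HasDerivAt v.fn (deriv v.fn x) x :=
  (v.fn_mem.2.1 x).hasDerivAt

theorem deriv_add (u v : WeightedSpline hφ r hdx) (x : ℝ) :
    deriv (u + v).fn x = deriv u.fn x + deriv v.fn x :=
  ((u.hasDerivAt x).add (v.hasDerivAt x)).deriv

theorem deriv_smul (c : ℝ) (v : WeightedSpline hφ r hdx) (x : ℝ) :
    deriv (c • v).fn x = c * deriv v.fn x :=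
  ((v.hasDerivAt x).const_mul c).deriv

/-- The weighted inner product. -/
@[reducible]
def core (hφ : IsCutoff R φ) (r : ℕ) {dx : ℝ} (hdx : 0 < dx) :
    InnerProductSpace.Core ℝ (WeightedSpline hφ r hdx) where
  inner u v := pairing u.fn (φ * v.fn)
  conj_inner_symm u v := by
    simp only [pairing, conj_trivial, Pi.mul_apply]
    congr 1
    ext x
    ring
  re_inner_nonneg v := by
    refine integral_nonneg fun x => ?_
    have := mul_nonneg (zero_le_one.trans (hφ.one_le x)) (sq_nonneg (v.fn x))
    simp only [Pi.mul_apply, Pi.zero_apply]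
    nlinarith
  add_left u v z := by
    simp only [pairing, Pi.mul_apply, fn_add, add_mul]
    exact integral_add (hφ.integrable_mul_mul u.memLp z.memLp)
      (hφ.integrable_mul_mul v.memLp z.memLp)
  smul_left u v c := by
    simp only [pairing, Pi.mul_apply, fn_smul, mul_assoc, conj_trivial]
    exact integral_const_mul c _
  -- Elements are functions, not classes; the pointwise inverse estimate turns a vanishing `L²` norm
  -- into a vanishing function.
  definite v hv := by
    have h1 := hφ.integral_sq_le_pairing v.memLp
    have hv' : pairing v.fn (φ * v.fn) = 0 := hv
    rw [hv'] at h1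
    refine fn_injective (funext fun x => ?_)
    have h2 := v.fn_mem.1.sq_le hdx v.memLp x
    have h3 : invConst r * ∫ t, v.fn t ^ 2 ≤ 0 := mul_nonpos_of_nonneg_of_nonpos (invConst_pos r).le h1
    have h4 : v.fn x ^ 2 ≤ 0 := nonpos_of_mul_nonpos_left (h2.trans h3) hdx
    exact pow_eq_zero_iff two_ne_zero |>.1 (le_antisymm h4 (sq_nonneg _))

instance : NormedAddCommGroup (WeightedSpline hφ r hdx) :=
  (core hφ r hdx).toNormedAddCommGroup

instance : InnerProductSpace ℝ (WeightedSpline hφ r hdx) :=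
  InnerProductSpace.ofCore (core hφ r hdx).toCore

theorem inner_eq (u v : WeightedSpline hφ r hdx) : inner ℝ u v = pairing u.fn (φ * v.fn) := rfl

theorem norm_eq (v : WeightedSpline hφ r hdx) : ‖v‖ = weightedNorm φ v.fn := by
  rw [norm_eq_sqrt_real_inner, inner_eq]
  rfl

theorem norm_sq_eq (v : WeightedSpline hφ r hdx) : ‖v‖ ^ 2 = ∫ x, v.fn x * (φ x * v.fn x) := by
  rw [← real_inner_self_eq_norm_sq, inner_eq]
  rfl

theorem l2norm_le_norm (v : WeightedSpline hφ r hdx) : l2norm v.fn ≤ ‖v‖ := by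
  refine le_of_sq_le_sq ?_ (norm_nonneg _)
  rw [l2norm_sq, norm_sq_eq]
  exact hφ.integral_sq_le_pairing v.memLp

theorem exists_abs_le_norm (hφ : IsCutoff R φ) (r : ℕ) {dx : ℝ} (hdx : 0 < dx) :
    ∃ c, 0 ≤ c ∧ ∀ (v : WeightedSpline hφ r hdx) (x : ℝ),
      |v.fn x| ≤ c * ‖v‖ ∧ |deriv v.fn x| ≤ c * ‖v‖ := by
  have hC := (invConst_pos r).le
  have key : ∀ (v : WeightedSpline hφ r hdx) (y d : ℝ), 0 < d →
      y ^ 2 * d ≤ invConst r * ∫ t, v.fn t ^ 2 → |y| ≤ √(invConst r / d) * ‖v‖ := by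
    intro v y d hd h
    have h1 := abs_le_sqrt_of_sq_mul_le hd h
    rw [mul_div_right_comm, Real.sqrt_mul (by positivity)] at h1
    refine h1.trans (mul_le_mul_of_nonneg_left v.l2norm_le_norm (Real.sqrt_nonneg _))
  refine ⟨√(invConst r / dx) + √(invConst r / dx ^ 3), by positivity, fun v x => ⟨?_, ?_⟩⟩
  · have := key v _ dx hdx (v.fn_mem.1.sq_le hdx v.memLp x)
    have h2 : 0 ≤ √(invConst r / dx ^ 3) * ‖v‖ := by positivity
    linarith
  · have := key v _ (dx ^ 3) (by positivity)
      ((v.fn_mem.1.isPiecewiseDeriv_deriv hdx v.fn_mem.2.1).sq_le hdx v.memLp x)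
    have h2 : 0 ≤ √(invConst r / dx) * ‖v‖ := by positivity
    linarith

theorem lintegral_eq_norm_sq (v : WeightedSpline hφ r hdx) :
    ∫⁻ x, ENNReal.ofReal (v.fn x * (φ x * v.fn x)) = ENNReal.ofReal (‖v‖ ^ 2) := by
  rw [norm_sq_eq, ofReal_integral_eq_lintegral_ofReal (hφ.integrable_mul_mul v.memLp v.memLp)]
  refine Eventually.of_forall fun x => ?_
  have := mul_nonneg (zero_le_one.trans (hφ.one_le x)) (sq_nonneg (v.fn x))
  simp only [Pi.zero_apply]
  nlinarith

/-- There are infinitely many elements, so finite dimension is not available. The norm controls `v`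
and its derivative uniformly, hence a Cauchy sequence converges uniformly with derivatives to a
differentiable piecewise polynomial. -/
instance : CompleteSpace (WeightedSpline hφ r hdx) := by
  refine Metric.complete_of_cauchySeq_tendsto fun v hv => ?_
  obtain ⟨c, hc0, hc⟩ := exists_abs_le_norm hφ r hdx
  have hfn : ∀ n m x, |(v n).fn x - (v m).fn x| ≤ c * dist (v n) (v m) := fun n m x => by
    rw [dist_eq_norm]
    exact (hc (v n - v m) x).1
  have hdf : ∀ n m x, |deriv (v n).fn x - deriv (v m).fn x| ≤ c * dist (v n) (v m) := fun n m x => by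
    rw [dist_eq_norm]
    have h := (hc (v n - v m) x).2
    have e : deriv (v n - v m).fn x = deriv (v n).fn x - deriv (v m).fn x :=
      (((v n).hasDerivAt x).sub ((v m).hasDerivAt x)).deriv
    rwa [e] at h
  have hcauchy : ∀ F : ℕ → ℝ → ℝ, (∀ n m x, |F n x - F m x| ≤ c * dist (v n) (v m)) →
      ∃ f : ℝ → ℝ, TendstoUniformly F f atTop := by
    intro F hF
    have hu : UniformCauchySeqOn F atTop Set.univ := by
      rw [Metric.uniformCauchySeqOn_iff]
      intro ε hε
      obtain ⟨N, hN⟩ := Metric.cauchySeq_iff.1 hv (ε / (c + 1)) (by positivity)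
      refine ⟨N, fun m hm n hn x _ => ?_⟩
      rw [Real.dist_eq]
      have h1 := hN m hm n hn
      rw [lt_div_iff₀ (by positivity)] at h1
      have h2 := hF m n x
      have h3 : 0 ≤ dist (v m) (v n) := dist_nonneg
      rcases h3.eq_or_lt with h0 | hpos
      · rw [← h0] at h2
        linarith
      · nlinarith
    have hpt : ∀ x, ∃ y, Tendsto (fun n => F n x) atTop (𝓝 y) := fun x =>
      cauchySeq_tendsto_of_complete (hu.cauchySeq (Set.mem_univ x))
    choose f hf using hpt
    exact ⟨f, tendstoUniformlyOn_univ.1 (hu.tendstoUniformlyOn_of_tendsto fun x _ => hf x)⟩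
  obtain ⟨f, hf⟩ := hcauchy (fun n => (v n).fn) hfn
  obtain ⟨g, hg⟩ := hcauchy (fun n => deriv (v n).fn) hdf
  have hfx : ∀ x, Tendsto (fun n => (v n).fn x) atTop (𝓝 (f x)) := fun x => hf.tendsto_at x
  have hdiff : Differentiable ℝ f := fun x =>
    (hasDerivAt_of_tendstoUniformly hg (Eventually.of_forall fun n x => (v n).hasDerivAt x) hfx
      x).differentiableAt
  have hpoly : IsPiecewisePoly r dx f := by
    intro j
    have h1 : ∀ n, ∃ p : ℝ[X], p.natDegree ≤ r ∧
        ∀ x ∈ Set.Icc (((j : ℝ) - 1) * dx) ((j : ℝ) * dx), (v n).fn x = p.eval x :=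
      fun n => (v n).fn_mem.1 j
    choose p hp hpe using h1
    exact exists_polynomial_of_tendsto (element_lt hdx j) hp fun x hx =>
      (hfx x).congr fun n => hpe n x hx
  have hfc := hpoly.continuous hdx
  -- Fatou's lemma is used twice: with `ε = 1` it puts the limit into `L²`, and with small `ε` it
  -- gives convergence in norm.
  have hfatou : ∀ ε, 0 < ε → ∃ N, ∀ n ≥ N,
      ∫⁻ x, ENNReal.ofReal ((f x - (v n).fn x) * (φ x * (f x - (v n).fn x))) ≤
        ENNReal.ofReal (ε ^ 2) := by
    intro ε hε
    obtain ⟨N, hN⟩ := Metric.cauchySeq_iff.1 hv ε hε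
    refine ⟨N, fun n hn => ?_⟩
    have hlim : ∀ x, Tendsto (fun m => ENNReal.ofReal
        ((v m - v n).fn x * (φ x * (v m - v n).fn x))) atTop
        (𝓝 (ENNReal.ofReal ((f x - (v n).fn x) * (φ x * (f x - (v n).fn x))))) := fun x => by
      have h1 : Tendsto (fun m => (v m - v n).fn x) atTop (𝓝 (f x - (v n).fn x)) :=
        (hfx x).sub_const _
      exact (ENNReal.continuous_ofReal.tendsto _).comp (h1.mul (h1.const_mul _))
    calc _ = ∫⁻ x, liminf (fun m => ENNReal.ofReal
        ((v m - v n).fn x * (φ x * (v m - v n).fn x))) atTop := by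
          refine lintegral_congr fun x => (hlim x).liminf_eq.symm
      _ ≤ liminf (fun m => ∫⁻ x, ENNReal.ofReal
        ((v m - v n).fn x * (φ x * (v m - v n).fn x))) atTop := by
          refine lintegral_liminf_le fun m => ?_
          have h1 : Continuous (v m - v n).fn := (v m - v n).fn_mem.1.continuous hdx
          have h2 := hφ.continuous
          exact (ENNReal.continuous_ofReal.comp (h1.mul (h2.mul h1))).measurable
      _ ≤ ENNReal.ofReal (ε ^ 2) := by
          refine liminf_le_of_frequently_le' (Eventually.frequently ?_)
          filter_upwards [eventually_ge_atTop N] with m hm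
          rw [lintegral_eq_norm_sq]
          refine ENNReal.ofReal_le_ofReal (pow_le_pow_left₀ (norm_nonneg _) ?_ 2)
          rw [← dist_eq_norm]
          exact (hN m hm n hn).le
  have hpos : ∀ (k : ℝ → ℝ) x, k x ^ 2 ≤ k x * (φ x * k x) := fun k x => by
    have := mul_le_mul_of_nonneg_right (hφ.one_le x) (sq_nonneg (k x))
    nlinarith
  have hfL : MemLp f 2 := by
    obtain ⟨N, hN⟩ := hfatou 1 one_pos
    have h1 := hN N le_rfl
    have hk : Continuous fun x => f x - (v N).fn x := hfc.sub ((v N).fn_mem.1.continuous hdx)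
    have h2 : MemLp (fun x => f x - (v N).fn x) 2 := by
      rw [memLp_two_iff_integrable_sq hk.aestronglyMeasurable]
      refine ⟨(hk.pow 2).aestronglyMeasurable, ?_⟩
      rw [hasFiniteIntegral_iff_ofReal (Eventually.of_forall fun x => sq_nonneg _)]
      refine lt_of_le_of_lt (lintegral_mono fun x => ENNReal.ofReal_le_ofReal
        (hpos (fun x => f x - (v N).fn x) x)) (h1.trans_lt ENNReal.ofReal_lt_top)
    have := h2.add (v N).memLp
    refine this.ae_eq (Eventually.of_forall fun x => ?_)
    simp
  refine ⟨of f ⟨hpoly, hdiff, hfL⟩, ?_⟩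
  rw [Metric.tendsto_atTop]
  intro ε hε
  obtain ⟨N, hN⟩ := hfatou (ε / 2) (by positivity)
  refine ⟨N, fun n hn => ?_⟩
  have h1 := hN n hn
  have h2 : ∫⁻ x, ENNReal.ofReal ((f x - (v n).fn x) * (φ x * (f x - (v n).fn x))) =
      ENNReal.ofReal (‖(of f ⟨hpoly, hdiff, hfL⟩ : WeightedSpline hφ r hdx) - v n‖ ^ 2) := by
    rw [← lintegral_eq_norm_sq]
    rfl
  rw [h2, ENNReal.ofReal_le_ofReal_iff (by positivity)] at h1
  rw [dist_comm, dist_eq_norm]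
  have := le_of_sq_le_sq h1 (by positivity)
  linarith

end WeightedSpline

end

/-! ### The forms of the scheme -/

section
variable {R : ℝ} {φ : ℝ → ℝ}

namespace WeightedSpline
variable {hφ : IsCutoff R φ} {r : ℕ} {dx : ℝ} {hdx : 0 < dx}

theorem exists_isH2Jet (v : WeightedSpline hφ r hdx) : ∃ g, IsH2Jet v.fn (deriv v.fn) g ∧
    l2norm (deriv v.fn) ≤ √(invConst r) / dx * l2norm v.fn ∧
    l2norm g ≤ (√(invConst r) / dx) ^ 2 * l2norm v.fn := exists_isH2Jet_of_mem hdx v.fn_mem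

theorem memLp_deriv (v : WeightedSpline hφ r hdx) : MemLp (deriv v.fn) 2 :=
  v.exists_isH2Jet.choose_spec.1.memLp_deriv

theorem continuous (v : WeightedSpline hφ r hdx) : Continuous v.fn := v.fn_mem.1.continuous hdx

theorem continuous_deriv (v : WeightedSpline hφ r hdx) : Continuous (deriv v.fn) :=
  v.exists_isH2Jet.choose_spec.1.continuous_deriv

theorem exists_bound (v : WeightedSpline hφ r hdx) :
    ∃ M, ∀ x, |v.fn x| ≤ M ∧ |deriv v.fn x| ≤ M := by
  obtain ⟨c, -, hc⟩ := exists_abs_le_norm hφ r hdx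
  exact ⟨c * ‖v‖, hc v⟩

theorem memLp_mul (a b : WeightedSpline hφ r hdx) : MemLp (fun x => a.fn x * b.fn x) 2 := by
  obtain ⟨M, hM⟩ := a.exists_bound
  exact memLp_mul_of_bounded a.continuous (fun x => (hM x).1) b.memLp

theorem memLp_deriv_mul (a b : WeightedSpline hφ r hdx) :
    MemLp (fun x => deriv a.fn x * b.fn x) 2 := by
  obtain ⟨M, hM⟩ := a.exists_bound
  exact memLp_mul_of_bounded a.continuous_deriv (fun x => (hM x).2) b.memLp

theorem memLp_cutoff_mul (v : WeightedSpline hφ r hdx) : MemLp (fun x => φ x * v.fn x) 2 :=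
  memLp_mul_of_bounded hφ.continuous hφ.abs_le v.memLp

/-- The derivative of `φ v`. -/
def weightedDeriv (v : WeightedSpline hφ r hdx) (x : ℝ) : ℝ :=
  deriv φ x * v.fn x + φ x * deriv v.fn x

theorem hasDerivAt_cutoff_mul (v : WeightedSpline hφ r hdx) (x : ℝ) :
    HasDerivAt (fun x => φ x * v.fn x) (v.weightedDeriv x) x :=
  (hφ.hasDerivAt x).mul (v.hasDerivAt x)

theorem deriv_cutoff_mul (v : WeightedSpline hφ r hdx) : deriv (φ * v.fn) = v.weightedDeriv :=
  funext fun x => (v.hasDerivAt_cutoff_mul x).deriv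

theorem memLp_weightedDeriv (v : WeightedSpline hφ r hdx) : MemLp v.weightedDeriv 2 :=
  (memLp_mul_of_bounded hφ.continuous_deriv hφ.abs_deriv_le v.memLp).add
    (memLp_mul_of_bounded hφ.continuous hφ.abs_le v.memLp_deriv)

theorem weightedDeriv_add (u v : WeightedSpline hφ r hdx) (x : ℝ) :
    (u + v).weightedDeriv x = u.weightedDeriv x + v.weightedDeriv x := by
  simp only [weightedDeriv, fn_add]
  rw [show deriv (fun x => u.fn x + v.fn x) x = deriv u.fn x + deriv v.fn x from deriv_add u v x]
  ring

theorem weightedDeriv_smul (c : ℝ) (v : WeightedSpline hφ r hdx) (x : ℝ) :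
    (c • v).weightedDeriv x = c * v.weightedDeriv x := by
  simp only [weightedDeriv, fn_smul]
  rw [show deriv (fun x => c * v.fn x) x = c * deriv v.fn x from deriv_smul c v x]
  ring

theorem l2norm_mul_le_of_bounded {b f : ℝ → ℝ} {C : ℝ} (hb : Continuous b) (hC : ∀ x, |b x| ≤ C)
    (hf : MemLp f 2) : l2norm (fun x => b x * f x) ≤ C * l2norm f := by
  have hC0 : 0 ≤ C := (abs_nonneg _).trans (hC 0)
  refine le_of_sq_le_sq ?_ (mul_nonneg hC0 (l2norm_nonneg _))
  rw [mul_pow, l2norm_sq, l2norm_sq, ← integral_const_mul]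
  refine integral_mono (memLp_mul_of_bounded hb hC hf).integrable_sq
    (hf.integrable_sq.const_mul _) fun x => ?_
  simp only [mul_pow]
  exact mul_le_mul_of_nonneg_right (sq_le_sq' (abs_le.1 (hC x)).1 (abs_le.1 (hC x)).2)
    (sq_nonneg _)

theorem exists_l2norm_weightedDeriv_le (hφ : IsCutoff R φ) (r : ℕ) {dx : ℝ} (hdx : 0 < dx) :
    ∃ c, 0 ≤ c ∧ ∀ v : WeightedSpline hφ r hdx, l2norm v.weightedDeriv ≤ c * ‖v‖ := by
  have hR : 0 ≤ 2 + 2 * R := (abs_nonneg _).trans (hφ.abs_le 0)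
  have h0 : 0 ≤ √(invConst r) / dx := by positivity
  refine ⟨1 + (2 + 2 * R) * (√(invConst r) / dx), by positivity, fun v => ?_⟩
  obtain ⟨g, -, h1, -⟩ := v.exists_isH2Jet
  have hn := v.l2norm_le_norm
  have k1 := l2norm_mul_le_of_bounded hφ.continuous_deriv hφ.abs_deriv_le v.memLp
  have k2 := l2norm_mul_le_of_bounded hφ.continuous hφ.abs_le v.memLp_deriv
  have k3 := l2norm_add_le (memLp_mul_of_bounded hφ.continuous_deriv hφ.abs_deriv_le v.memLp)
    (memLp_mul_of_bounded hφ.continuous hφ.abs_le v.memLp_deriv)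
  have k4 : l2norm (deriv v.fn) ≤ √(invConst r) / dx * ‖v‖ :=
    h1.trans (mul_le_mul_of_nonneg_left hn h0)
  have k5 := mul_le_mul_of_nonneg_left k4 hR
  refine (k3 : l2norm v.weightedDeriv ≤ _).trans ?_
  linarith

theorem integrable_fracLap_mul (w : WeightedSpline hφ r hdx) {g : ℝ → ℝ} (hg : MemLp g 2) :
    Integrable fun x => fracLap w.fn x * g x :=
  w.exists_isH2Jet.choose_spec.1.integrable_fracLap_mul hg

theorem integrableOn_secondDiff_div_sq (w : WeightedSpline hφ r hdx) (x : ℝ) :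
    IntegrableOn (fun y => secondDiff w.fn y x / y ^ 2) (Set.Ioi 0) :=
  w.exists_isH2Jet.choose_spec.1.integrableOn_secondDiff_div_sq x

theorem fracLap_add (u v : WeightedSpline hφ r hdx) (x : ℝ) :
    fracLap (u + v).fn x = fracLap u.fn x + fracLap v.fn x := by
  simp only [fracLap]
  rw [← mul_add, ← integral_add (u.integrableOn_secondDiff_div_sq x)
    (v.integrableOn_secondDiff_div_sq x)]
  congr 2
  ext y
  simp only [secondDiff, fn_add]
  ring

theorem fracLap_smul (c : ℝ) (v : WeightedSpline hφ r hdx) (x : ℝ) :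
    fracLap (c • v).fn x = c * fracLap v.fn x := by
  have h : ∀ y, secondDiff (c • v).fn y x / y ^ 2 = c * (secondDiff v.fn y x / y ^ 2) := fun y => by
    simp only [secondDiff, fn_smul]
    ring
  simp only [fracLap, h]
  rw [integral_const_mul, mul_left_comm]

/-- The dispersive form `⟨H(w_x), (φ v)_x⟩`. -/
def dispForm : WeightedSpline hφ r hdx →ₗ[ℝ] WeightedSpline hφ r hdx →ₗ[ℝ] ℝ :=
  LinearMap.mk₂ ℝ (fun w v => ∫ x, fracLap w.fn x * v.weightedDeriv x)
    (fun w w' v => by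
      simp only [fracLap_add, add_mul]
      exact integral_add (w.integrable_fracLap_mul v.memLp_weightedDeriv)
        (w'.integrable_fracLap_mul v.memLp_weightedDeriv))
    (fun c w v => by
      simp only [fracLap_smul, mul_assoc, smul_eq_mul]
      exact integral_const_mul c _)
    (fun w v v' => by
      simp only [weightedDeriv_add, mul_add]
      exact integral_add (w.integrable_fracLap_mul v.memLp_weightedDeriv)
        (w.integrable_fracLap_mul v'.memLp_weightedDeriv))
    (fun c w v => by
      simp only [weightedDeriv_smul, mul_left_comm _ c, smul_eq_mul]
      exact integral_const_mul c _)

theorem dispForm_eq_pairing_hilbert_deriv (w v : WeightedSpline hφ r hdx) :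
    dispForm w v = pairing (hilbert (deriv w.fn)) (deriv (φ * v.fn)) := by
  have h : hilbert (deriv w.fn) = fracLap w.fn :=
    funext w.exists_isH2Jet.choose_spec.1.hilbert_deriv_eq
  rw [h, deriv_cutoff_mul]
  rfl

/-- The iteration contains `(H m)_x` and the implicit scheme `H(m_x)`; this and the preceding
identity show that they pair alike. -/
theorem dispForm_eq_pairing_deriv_hilbert (w v : WeightedSpline hφ r hdx) :
    dispForm w v = pairing (deriv (hilbert w.fn)) (deriv (φ * v.fn)) := by
  have h : deriv (hilbert w.fn) = fracLap w.fn :=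
    funext fun x => (w.exists_isH2Jet.choose_spec.1.hasDerivAt_hilbert x).deriv
  rw [h, deriv_cutoff_mul]
  rfl

/-- This constant depends on `r` and `dx`. That is harmless, because it only serves Lax–Milgram and
passage to the limit. -/
theorem exists_abs_dispForm_le (hφ : IsCutoff R φ) (r : ℕ) {dx : ℝ} (hdx : 0 < dx) :
    ∃ C, ∀ w v : WeightedSpline hφ r hdx, |dispForm w v| ≤ C * ‖w‖ * ‖v‖ := by
  obtain ⟨c, hc0, hc⟩ := exists_l2norm_weightedDeriv_le hφ r hdx
  refine ⟨((√(invConst r) / dx) ^ 2 + 4) * c, fun w v => ?_⟩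
  obtain ⟨g, hg, -, h2⟩ := w.exists_isH2Jet
  refine (hg.abs_integral_fracLap_mul_le v.memLp_weightedDeriv).trans ?_
  have hn := w.l2norm_le_norm
  have k1 : l2norm g + 4 * l2norm w.fn ≤ ((√(invConst r) / dx) ^ 2 + 4) * ‖w‖ := by
    have := mul_le_mul_of_nonneg_left hn (sq_nonneg (√(invConst r) / dx))
    linarith
  calc _ ≤ ((√(invConst r) / dx) ^ 2 + 4) * ‖w‖ * (c * ‖v‖) :=
        mul_le_mul k1 (hc v) (l2norm_nonneg _) (by positivity)
    _ = _ := by ring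

/-- The quantifier order matters: `C` is fixed before `r` and `dx`, so the time step bound `δ`
depends on `φ` only. -/
theorem exists_dispForm_self_ge (hφ : IsCutoff R φ) : ∃ C, 0 ≤ C ∧ ∀ (r : ℕ) {dx : ℝ}
    (hdx : 0 < dx) (v : WeightedSpline hφ r hdx), -(C * ‖v‖ ^ 2) ≤ dispForm v v := by
  obtain ⟨C, hC, h⟩ := hφ.exists_integral_fracLap_ge
  refine ⟨C, hC, fun r dx hdx v => ?_⟩
  obtain ⟨g, hg, -⟩ := v.exists_isH2Jet
  have h1 := mul_le_mul_of_nonneg_left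
    (pow_le_pow_left₀ (l2norm_nonneg _) v.l2norm_le_norm 2) hC
  exact (neg_le_neg h1).trans (h _ _ _ hg)

theorem integrable_mul_mul_weightedDeriv (a b v : WeightedSpline hφ r hdx) :
    Integrable fun x => a.fn x * b.fn x * v.weightedDeriv x :=
  integrable_mul_of_memLp_two (a.memLp_mul b) v.memLp_weightedDeriv

/-- The convective form `⟨a b, (φ v)_x⟩`. -/
def convForm : WeightedSpline hφ r hdx →ₗ[ℝ] WeightedSpline hφ r hdx →ₗ[ℝ]
    WeightedSpline hφ r hdx →ₗ[ℝ] ℝ :=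
  LinearMap.mk₂ ℝ
    (fun a b =>
      { toFun := fun v => ∫ x, a.fn x * b.fn x * v.weightedDeriv x
        map_add' := fun v v' => by
          simp only [weightedDeriv_add, mul_add]
          exact integral_add (integrable_mul_mul_weightedDeriv a b v)
            (integrable_mul_mul_weightedDeriv a b v')
        map_smul' := fun c v => by
          simp only [weightedDeriv_smul, mul_left_comm _ c, smul_eq_mul, RingHom.id_apply]
          exact integral_const_mul c _ })
    (fun a a' b => LinearMap.ext fun v => by
      simp only [fn_add, add_mul, LinearMap.coe_mk, AddHom.coe_mk, LinearMap.add_apply]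
      exact integral_add (integrable_mul_mul_weightedDeriv a b v)
        (integrable_mul_mul_weightedDeriv a' b v))
    (fun c a b => LinearMap.ext fun v => by
      simp only [fn_smul, mul_assoc, LinearMap.coe_mk, AddHom.coe_mk, LinearMap.smul_apply,
        smul_eq_mul]
      exact integral_const_mul c _)
    (fun a b b' => LinearMap.ext fun v => by
      simp only [fn_add, add_mul, mul_add, LinearMap.coe_mk, AddHom.coe_mk, LinearMap.add_apply]
      exact integral_add (integrable_mul_mul_weightedDeriv a b v)
        (integrable_mul_mul_weightedDeriv a b' v))
    (fun c a b => LinearMap.ext fun v => by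
      simp only [fn_smul, mul_left_comm _ c, mul_assoc, LinearMap.coe_mk, AddHom.coe_mk,
        LinearMap.smul_apply, smul_eq_mul]
      exact integral_const_mul c _)

theorem convForm_apply (a b v : WeightedSpline hφ r hdx) :
    convForm a b v = ∫ x, a.fn x * b.fn x * v.weightedDeriv x := rfl

theorem convForm_comm (a b v : WeightedSpline hφ r hdx) : convForm a b v = convForm b a v := by
  simp only [convForm_apply, mul_comm (a.fn _)]

theorem convForm_self (a v : WeightedSpline hφ r hdx) :
    convForm a a v = pairing (fun x => a.fn x ^ 2) (deriv (φ * v.fn)) := by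
  simp only [convForm_apply, deriv_cutoff_mul, pairing, sq]

/-- Integration by parts moves the derivative off `φ v`, so the bound needs neither a derivative of
`v` nor one of `φ`. -/
theorem convForm_eq_neg (a b v : WeightedSpline hφ r hdx) :
    convForm a b v = -((∫ x, deriv a.fn x * b.fn x * (φ x * v.fn x)) +
      ∫ x, deriv b.fn x * a.fn x * (φ x * v.fn x)) := by
  have i1 := integrable_mul_of_memLp_two (a.memLp_deriv_mul b) v.memLp_cutoff_mul
  have i2 := integrable_mul_of_memLp_two (b.memLp_deriv_mul a) v.memLp_cutoff_mul
  have i3 := integrable_mul_mul_weightedDeriv a b v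
  have h := integral_eq_zero_of_hasDerivAt_of_integrable
    (fun x => ((a.hasDerivAt x).mul (b.hasDerivAt x)).mul (v.hasDerivAt_cutoff_mul x))
    (((i1.add i2).add i3).congr (Eventually.of_forall fun x => by
      simp only [Pi.add_apply, Pi.mul_apply]
      ring))
    (integrable_mul_of_memLp_two (a.memLp_mul b) v.memLp_cutoff_mul)
  have e := integral_add (i1.add i2) i3
  have e12 : ∫ x, ((fun x => deriv a.fn x * b.fn x * (φ x * v.fn x)) +
      fun x => deriv b.fn x * a.fn x * (φ x * v.fn x)) x = _ := integral_add i1 i2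
  rw [e12] at e
  rw [convForm_apply, ← add_eq_zero_iff_eq_neg, add_comm, ← e, ← h]
  congr 1
  ext x
  simp only [Pi.add_apply, Pi.mul_apply]
  ring

/-- Cauchy–Schwarz with the weight split evenly as `√φ · √φ`. -/
theorem integral_abs_mul_cutoff_mul_le (b v : WeightedSpline hφ r hdx) :
    ∫ x, |b.fn x * (φ x * v.fn x)| ≤ ‖b‖ * ‖v‖ := by
  have hs : Continuous fun x => √(φ x) := hφ.continuous.sqrt
  have hsb : ∀ x, |√(φ x)| ≤ √(2 + 2 * R) := fun x => by
    rw [abs_of_nonneg (Real.sqrt_nonneg _)]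
    exact Real.sqrt_le_sqrt (hφ.le_bound x)
  have hφ0 : ∀ x, 0 ≤ φ x := fun x => zero_le_one.trans (hφ.one_le x)
  have key : ∀ z : WeightedSpline hφ r hdx, l2norm (fun x => √(φ x) * z.fn x) = ‖z‖ := fun z => by
    rw [← Real.sqrt_sq (norm_nonneg z), norm_sq_eq, l2norm]
    congr 2
    ext x
    rw [mul_pow, Real.sq_sqrt (hφ0 x)]
    ring
  have h := integral_abs_mul_le (memLp_mul_of_bounded hs hsb b.memLp)
    (memLp_mul_of_bounded hs hsb v.memLp)
  rw [key, key] at h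
  refine le_of_eq_of_le ?_ h
  congr 1
  ext x
  congr 1
  have := Real.mul_self_sqrt (hφ0 x)
  calc _ = (√(φ x) * √(φ x)) * (b.fn x * v.fn x) := by rw [this]; ring
    _ = _ := by ring

theorem abs_integral_deriv_mul_le {M : ℝ} {a b v : WeightedSpline hφ r hdx}
    (hM : ∀ᵐ x, |deriv a.fn x| ≤ M) :
    |∫ x, deriv a.fn x * b.fn x * (φ x * v.fn x)| ≤ M * (‖b‖ * ‖v‖) := by
  have hM0 : 0 ≤ M := by
    obtain ⟨x, hx⟩ := hM.exists
    exact (abs_nonneg _).trans hx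
  refine abs_integral_le_integral_abs.trans ((integral_mono_ae
    (integrable_mul_of_memLp_two (a.memLp_deriv_mul b) v.memLp_cutoff_mul).abs
    ((integrable_mul_of_memLp_two b.memLp v.memLp_cutoff_mul).abs.const_mul M) ?_).trans ?_)
  · filter_upwards [hM] with x hx
    rw [mul_assoc, abs_mul]
    exact mul_le_mul_of_nonneg_right hx (abs_nonneg _)
  · rw [integral_const_mul]
    exact mul_le_mul_of_nonneg_left (integral_abs_mul_cutoff_mul_le b v) hM0

theorem ae_abs_deriv_le {C₁ C₂ : ℝ} (hinv : InverseInequality r C₁ C₂)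
    (a : WeightedSpline hφ r hdx) :
    ∀ᵐ x, |deriv a.fn x| ≤ √C₂ / dx ^ (3 / 2 : ℝ) * ‖a‖ := by
  have hκ : 0 ≤ √C₂ / dx ^ (3 / 2 : ℝ) := by positivity
  obtain ⟨h1, h2⟩ := hinv dx hdx a.fn ((mem_femSpace_iff_mem_splineSpace hdx).2 a.fn_mem)
  have h := h1.trans h2
  rw [eLpNorm_two_eq_ofReal_l2norm a.memLp, ← ENNReal.ofReal_mul hκ, eLpNorm_exponent_top] at h
  filter_upwards [enorm_ae_le_eLpNormEssSup (deriv a.fn) volume] with x hx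
  have h3 := hx.trans h
  rw [Real.enorm_eq_ofReal_abs, ENNReal.ofReal_le_ofReal_iff
    (mul_nonneg hκ (l2norm_nonneg _))] at h3
  exact h3.trans (mul_le_mul_of_nonneg_left a.l2norm_le_norm hκ)

theorem abs_convForm_le {C₁ C₂ : ℝ} (hinv : InverseInequality r C₁ C₂)
    (a b v : WeightedSpline hφ r hdx) :
    |convForm a b v| ≤ 2 * (√C₂ / dx ^ (3 / 2 : ℝ)) * ‖a‖ * ‖b‖ * ‖v‖ := by
  rw [convForm_eq_neg, abs_neg]
  refine (abs_add_le _ _).trans ((add_le_add (abs_integral_deriv_mul_le (ae_abs_deriv_le hinv a))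
    (abs_integral_deriv_mul_le (ae_abs_deriv_le hinv b))).trans (le_of_eq ?_))
  ring

/-! ### The scheme as a fixed point iteration -/

theorem fn_mid (w u : WeightedSpline hφ r hdx) :
    ((1 / 2 : ℝ) • (w + u)).fn = fun x => (w.fn x + u.fn x) / 2 := by
  ext x
  simp only [fn_smul, fn_add]
  ring

theorem linStep_iff {dt : ℝ} (u w w' : WeightedSpline hφ r hdx) :
    LinStep dispForm convForm dt u w w' ↔ ∀ v ∈ femSpace r dx,
    pairing w'.fn (φ * v)
      - dt / 2 * pairing (fun x => ((w.fn x + u.fn x) / 2) ^ 2) (deriv (φ * v))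
      + dt * pairing (deriv (hilbert (fun x => (w'.fn x + u.fn x) / 2))) (deriv (φ * v))
    = pairing u.fn (φ * v) := by
  simp only [LinStep, inner_eq, convForm_self, dispForm_eq_pairing_deriv_hilbert, fn_mid]
  exact ⟨fun h v hv => h (of v ((mem_femSpace_iff_mem_splineSpace hdx).1 hv)),
    fun h v => h v.fn ((mem_femSpace_iff_mem_splineSpace hdx).2 v.fn_mem)⟩

theorem solvesStep_of_linStep {dt : ℝ} {u u' : WeightedSpline hφ r hdx}
    (h : LinStep dispForm convForm dt u u' u') : SolvesStep φ r dx dt u.fn u'.fn := by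
  refine ⟨(mem_femSpace_iff_mem_splineSpace hdx).2 u'.fn_mem, fun v hv => ?_⟩
  have h1 := h (of v ((mem_femSpace_iff_mem_splineSpace hdx).1 hv))
  simp only [inner_eq, convForm_self, dispForm_eq_pairing_hilbert_deriv, fn_mid, fn_of] at h1
  rw [← h1]
  congr 2
  simp only [pairing, div_mul_eq_mul_div (_ ^ 2), integral_div]
  ring

theorem isIteration_iff {dt : ℝ} (u : WeightedSpline hφ r hdx) (w : ℕ → WeightedSpline hφ r hdx) :
    IsIteration φ r dx dt u.fn (fun l => (w l).fn) ↔
      w 0 = u ∧ ∀ l, LinStep dispForm convForm dt u (w l) (w (l + 1)) := by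
  simp only [IsIteration, linStep_iff, fn_injective.eq_iff]
  exact and_congr_right fun _ => and_iff_right
    fun l => (mem_femSpace_iff_mem_splineSpace hdx).2 (w l).fn_mem

theorem exists_fn_eq {f : ℕ → ℝ → ℝ} (hf : ∀ l, f l ∈ femSpace r dx) :
    ∃ w : ℕ → WeightedSpline hφ r hdx, f = fun l => (w l).fn :=
  ⟨fun l => of (f l) ((mem_femSpace_iff_mem_splineSpace hdx).1 (hf l)), rfl⟩

end WeightedSpline

end

end BOScheme

end

/-- The CFL condition is cleared of denominators, so for `u = 0` it holds automatically. -/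
theorem mainTheorem2 (R : ℝ) (hR : 0 < R) (φ : ℝ → ℝ) (hφ : BOScheme.IsCutoff R φ) :
    (∀ r : ℕ, 2 ≤ r → ∃ C₁ C₂ : ℝ, 0 < C₁ ∧ 0 < C₂ ∧ BOScheme.InverseInequality r C₁ C₂) ∧
    ∃ δ : ℝ, 0 < δ ∧
      ∀ r : ℕ, 2 ≤ r → ∀ C₁ C₂ : ℝ, 0 < C₁ → 0 < C₂ → BOScheme.InverseInequality r C₁ C₂ →
      ∀ L : ℝ, 0 < L → L < 1 → ∀ K : ℝ, K = (7 - L) / (1 - L) →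
      ∀ dx dt : ℝ, 0 < dx → 0 < dt → dt ≤ δ →
      ∀ u ∈ BOScheme.femSpace r dx,
        dt / dx ^ (3 / 2 : ℝ) * (2 * √2 * √C₂ * K * BOScheme.weightedNorm φ u) ≤ L →
        (∃! w : ℕ → ℝ → ℝ, BOScheme.IsIteration φ r dx dt u w) ∧
        ∀ w : ℕ → ℝ → ℝ, BOScheme.IsIteration φ r dx dt u w →
          ∃ u' : ℝ → ℝ, BOScheme.SolvesStep φ r dx dt u u' ∧
            Filter.Tendsto (fun l => BOScheme.weightedNorm φ (w l - u')) Filter.atTop (nhds 0) ∧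
            BOScheme.weightedNorm φ u' ≤ K * BOScheme.weightedNorm φ u := by
  open BOScheme BOScheme.WeightedSpline in
  refine ⟨fun r _ => exists_inverseInequality r, ?_⟩
  obtain ⟨C₀, hC₀, hB⟩ := exists_dispForm_self_ge hφ
  -- This yields `Δt C₀ ≤ 1/10`; the added 1 avoids dividing by zero when `C₀ = 0`.
  refine ⟨1 / (10 * (C₀ + 1)), by positivity, ?_⟩
  intro r _ C₁ C₂ _ _ hinv L hL0 hL1 K hK dx dt hdx hdt hdtδ u₀ hu₀ hcfl
  have hdtC : dt * C₀ ≤ 1 / 10 := by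
    rw [le_div_iff₀ (by positivity)] at hdtδ
    nlinarith
  obtain ⟨u, rfl⟩ : ∃ u : WeightedSpline hφ r hdx, u₀ = u.fn :=
    ⟨of u₀ ((mem_femSpace_iff_mem_splineSpace hdx).1 hu₀), rfl⟩
  obtain ⟨C, hBC⟩ := exists_abs_dispForm_le hφ r hdx
  have hq := abs_convForm_le (hφ := hφ) (hdx := hdx) hinv
  refine ⟨?_, fun f hf => ?_⟩
  · obtain ⟨w, hw, huniq⟩ := LinStep.existsUnique_seq (u := u) fun w =>
      LinStep.existsUnique hBC (hB r hdx) hq hdt hdtC w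
    refine ⟨fun l => (w l).fn, (isIteration_iff u w).2 hw, fun f hf => ?_⟩
    obtain ⟨w', rfl⟩ := exists_fn_eq (hφ := hφ) (hdx := hdx) hf.2.1
    rw [huniq w' ((isIteration_iff u w').1 hf)]
  · obtain ⟨w, rfl⟩ := exists_fn_eq (hφ := hφ) (hdx := hdx) hf.2.1
    obtain ⟨hw0, hw⟩ := (isIteration_iff u w).1 hf
    obtain ⟨u', hlim, hsol, hle⟩ := LinStep.exists_limit hBC (hB r hdx) convForm_comm hq
      (by positivity) hdt hdtC hL0 hL1 hK (by
        rw [norm_eq]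
        refine le_of_eq_of_le ?_ hcfl
        ring) hw0 hw
    refine ⟨u'.fn, solvesStep_of_linStep hsol, ?_, ?_⟩
    · simpa only [norm_eq, fn_sub] using tendsto_iff_norm_sub_tendsto_zero.1 hlim
    · simpa only [norm_eq] using hle
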